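/- **Theorem (variational principle for sofic entropy).** Let $G$ be a countable discrete group and let $\Sigma=\{\sigma_i:G\to\mathrm{Sym}(d_i)\}_{i\ge 1}$ be a sofic approximation sequence for $G$: $d_i\ge 1$, $d_i\to\infty$, and, as $i\to\infty$, $\frac1{d_i}|\{k:\sigma_{i,st}(k)=\sigma_{i,s}\sigma_{i,t}(k)\}|\to 1$ for all $s,t\in G$ and $\frac1{d_i}|\{k:\sigma_{i,s}(k)\ne\sigma_{i,t}(k)\}|\to 1$ for all $s\neq t$ in $G$ (so $G$ is sofic). Let $G$ act continuously on a compact metrizable space $X$, and let $M_G(X)$ be the set of $G$-invariant Borel probability measures on $X$. Then $$h_\Sigma(X,G)=\sup_{\mu\in M_G(X)}h_{\Sigma,\mu}(X,G)\quad\text{in }[-\infty,\infty],\qquad \sup\emptyset=-\infty .$$ In particular, if $h_\Sigma(X,G)\ne-\infty$ then $M_G(X)\neq\emptyset$. The entropies are defined as follows. Write $\alpha_s(f)(x)=f(s^{-1}x)$ for functions $f$ on $X$, $\sigma_s(f)=f\circ\sigma_s^{-1}$ and $\|f\|_2=(\frac1d\sum_{k}|f(k)|^2)^{1/2}$ for $f\in\mathbb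 C^d$, and $\zeta(f)=\frac1d\sum_k f(k)$. For a sequence $\mathcal S=(p_n)_{n\ge1}$ put $\rho_{\mathcal S}(\varphi,\psi)=\sum_{n}2^{-n}\|\varphi(p_n)-\psi(p_n)\|_2$; let $N_\varepsilon(Y,\rho)$ be the maximal cardinality of a finite subset of $Y$ whose distinct points are at $\rho$-distance $>\varepsilon$; and $\log 0=-\infty$. *Topological entropy.* For a sequence $\mathcal S$ in the unit ball of $C_{\mathbb R}(X)$, a nonempty finite $F\subseteq G$, $\delta>0$ and $\sigma:G\to\mathrm{Sym}(d)$, let $\mathrm{Hom}(\mathcal S,F,\delta,\sigma)$ be the set of unital homomorphisms $\varphi:C(X)\to\mathbb C^d$ with $\sum_n2^{-n}\|\varphi(\alpha_s(p_n))-\sigma_s(\varphi(p_n))\|_2<\delta$ for all $s\in F$, and $$h_\Sigma(\mathcal S)=\sup_{\varepsilon>0}\inf_F\inf_{\delta>0}\limsup_{i\to\infty}\tfrac1{d_i}\log N_\varepsilon(\mathrm{Hom}(\mathcal S,F,\delta,\sigma_i),\rho_{\mathcal S}).$$ $\mathcal S$ is dynamically generating if it lies in no proper $G$-invariant unital $C^*$-subalgebra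 of $C(X)$. $h_\Sigma(X,G)$ is the common value of $h_\Sigma(\mathcal S)$ over all dynamically generating $\mathcal S$. *Measure entropy.* Let $\mu\in M_G(X)$. For a sequence $\mathcal S$ in the unit ball of $L^\infty_{\mathbb R}(X,\mu)$, a nonempty finite $F\subseteq G$, $m\ge1$, $\delta>0$ and $\sigma:G\to\mathrm{Sym}(d)$, let $\mathrm{UP}_\mu(\mathcal S,F,m,\delta,\sigma)$ be the set of unital positive linear maps $\varphi:L^\infty(X,\mu)\to\mathbb C^d$ such that, for all $1\le j\le m$, $f_1,\dots,f_j\in\{p_1,\dots,p_m\}$ and $s,s_1,\dots,s_j\in F$, with $f=\alpha_{s_1}(f_1)\cdots\alpha_{s_j}(f_j)$: $\|\varphi(f)-\varphi(\alpha_{s_1}(f_1))\cdots\varphi(\alpha_{s_j}(f_j))\|_2<\delta$, $|\zeta(\varphi(f))-\mu(f)|<\delta$, and $\|\varphi(\alpha_s(f_1))-\sigma_s(\varphi(f_1))\|_2<\delta$. Put $$h_{\Sigma,\mu}(\mathcal S)=\sup_{\varepsilon>0}\inf_F\inf_{m\ge1}\inf_{\delta>0}\limsup_{i\to\infty}\tfrac1{d_i}\log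 N_\varepsilon(\mathrm{UP}_\mu(\mathcal S,F,m,\delta,\sigma_i),\rho_{\mathcal S}).$$ $\mathcal S$ is dynamically generating if it lies in no proper $G$-invariant von Neumann subalgebra (unital $*$-subalgebra closed in the $L^2(\mu)$-norm) of $L^\infty(X,\mu)$. $h_{\Sigma,\mu}(X,G)$ is the common value of $h_{\Sigma,\mu}(\mathcal S)$ over all dynamically generating $\mathcal S$. The assertion includes that these quantities are well defined: dynamically generating sequences exist in both settings, and $h_\Sigma(\mathcal S)$, respectively $h_{\Sigma,\mu}(\mathcal S)$ for each $\mu\in M_G(X)$, takes the same value on all of them. -/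

import Mathlib

open MeasureTheory Filter Topology
open scoped ENNReal ComplexOrder

noncomputable section

namespace SoficEntropy

/-! ### Sofic approximation sequences -/

/-- A sofic approximation sequence for `G`: maps `σ i : G → Sym (d i)`, with `d i` positive and
tending to infinity, which are asymptotically multiplicative and asymptotically free.
A countable group is sofic precisely when maps with these properties exist (up to the condition
`d i → ∞`, which can always be arranged). -/
structure SoficApproximation (G : Type*) [Group G] where
  d : ℕ → ℕ
  d_pos : ∀ i, 0 < d i
  σ : (i : ℕ) → G → Equiv.Perm (Fin (d i))
  tendsto_mul : ∀ s t : G, Tendsto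
    (fun i => (Nat.card {k : Fin (d i) // σ i (s * t) k = σ i s (σ i t k)} : ℝ) / (d i : ℝ))
    atTop (𝓝 1)
  tendsto_free : ∀ s t : G, s ≠ t → Tendsto
    (fun i => (Nat.card {k : Fin (d i) // σ i s k ≠ σ i t k} : ℝ) / (d i : ℝ))
    atTop (𝓝 1)
  tendsto_d : Tendsto d atTop atTop

/-! ### The finite-dimensional target `ℂ^d` and separated sets -/

/-- The `L²`-norm on `ℂ^d` with respect to the uniform probability measure. -/
def norm2 {d : ℕ} (f : Fin d → ℂ) : ℝ :=
  Real.sqrt ((d : ℝ)⁻¹ * ∑ k, ‖f k‖ ^ 2)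

/-- Integration on `ℂ^d` against the uniform probability measure. -/
def unif {d : ℕ} (f : Fin d → ℂ) : ℂ :=
  (d : ℂ)⁻¹ * ∑ k, f k

/-- The induced action of a permutation on `ℂ^d`: `f ↦ f ∘ τ⁻¹`. -/
def permAct {d : ℕ} (τ : Equiv.Perm (Fin d)) (f : Fin d → ℂ) : Fin d → ℂ :=
  fun k => f (τ⁻¹ k)

/-- The pseudometric `ρ_S (φ, ψ) = ∑_{n ≥ 1} 2^{-n} ‖φ(p_n) - ψ(p_n)‖₂`. The sequence
`p_1, p_2, …` is indexed here by `ℕ`, so that `p n` stands for `p_{n+1}`. -/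
def rho {A : Type*} {d : ℕ} (p : ℕ → A) (φ ψ : A → (Fin d → ℂ)) : ℝ :=
  ∑' n : ℕ, (1 / 2 : ℝ) ^ (n + 1) * norm2 (φ (p n) - ψ (p n))

/-- `N_ε(Y, ρ)`: the supremum of the cardinalities of the finite subsets of `Y` which are
`ε`-separated with respect to `ρ`. -/
def sepNumber {B : Type*} (ε : ℝ) (Y : Set B) (ρ : B → B → ℝ) : ℝ≥0∞ :=
  ⨆ (E : Finset B) (_ : (E : Set B) ⊆ Y ∧ ∀ x ∈ E, ∀ y ∈ E, x ≠ y → ε < ρ x y), (E.card : ℝ≥0∞)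

/-- The exponential growth rate `limsup_i (1 / d_i) log N_i`, with `log 0 = -∞`. -/
def growthRate {G : Type*} [Group G] (S : SoficApproximation G) (N : ℕ → ℝ≥0∞) : EReal :=
  limsup (fun i => (((S.d i : ℝ)⁻¹ : ℝ) : EReal) * ENNReal.log (N i)) atTop

/-! ### Topological entropy -/

/-- `α_s (f) (x) = f (s⁻¹ x)` on `C(X)`. -/
def actC {G : Type*} [Group G] {X : Type*} [TopologicalSpace X] [MulAction G X]
    [ContinuousConstSMul G X] (s : G) (f : C(X, ℂ)) : C(X, ℂ) :=
  f.comp ⟨fun x => s⁻¹ • x, continuous_const_smul s⁻¹⟩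

/-- `p` is a dynamically generating sequence in the unit ball of the real-valued continuous
functions: it is not contained in any proper `G`-invariant unital `C*`-subalgebra of `C(X)`. -/
structure IsGeneratingC (G : Type*) [Group G] {X : Type*} [TopologicalSpace X] [CompactSpace X]
    [MulAction G X] [ContinuousConstSMul G X] (p : ℕ → C(X, ℂ)) : Prop where
  real : ∀ n, IsSelfAdjoint (p n)
  norm_le : ∀ n, ‖p n‖ ≤ 1
  generating : ∀ A : StarSubalgebra ℂ C(X, ℂ), IsClosed (A : Set C(X, ℂ)) →
    (∀ s : G, ∀ f ∈ A, actC s f ∈ A) → (∀ n, p n ∈ A) → A = ⊤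

/-- `Hom(S, F, δ, σ)`: the approximately equivariant unital homomorphisms `C(X) → ℂ^d`. -/
def homSet {G : Type*} [Group G] {X : Type*} [TopologicalSpace X] [MulAction G X]
    [ContinuousConstSMul G X] {d : ℕ} (p : ℕ → C(X, ℂ)) (F : Finset G) (δ : ℝ)
    (σ : G → Equiv.Perm (Fin d)) : Set (C(X, ℂ) →ₐ[ℂ] (Fin d → ℂ)) :=
  {φ | ∀ s ∈ F,
    ∑' n : ℕ, (1 / 2 : ℝ) ^ (n + 1) * norm2 (φ (actC s (p n)) - permAct (σ s) (φ (p n))) < δ}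

/-- `h_Σ(S)` for a sequence `S` of continuous functions. -/
def topEntropySeq {G : Type*} [Group G] {X : Type*} [TopologicalSpace X] [MulAction G X]
    [ContinuousConstSMul G X] (S : SoficApproximation G) (p : ℕ → C(X, ℂ)) : EReal :=
  ⨆ (ε : ℝ) (_ : 0 < ε), ⨅ (F : Finset G) (_ : F.Nonempty), ⨅ (δ : ℝ) (_ : 0 < δ),
    growthRate S fun i => sepNumber ε (homSet p F δ (S.σ i)) fun φ ψ => rho p φ ψ

/-- The topological entropy `h_Σ(X, G)`: the common value of `h_Σ(S)` over all dynamically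
generating sequences `S` in the unit ball of the real-valued continuous functions. -/
def topEntropy {G : Type*} [Group G] (S : SoficApproximation G) (X : Type*) [TopologicalSpace X]
    [CompactSpace X] [MulAction G X] [ContinuousConstSMul G X] : EReal :=
  ⨆ (p : ℕ → C(X, ℂ)) (_ : IsGeneratingC G p), topEntropySeq S p

/-! ### The `*`-algebra `L^∞(X, μ)`

The normed space is Mathlib's `Lp ℂ ∞ μ`; the multiplication and involution are the (almost
everywhere) pointwise ones of `X →ₘ[μ] ℂ`. -/

section Linfty

variable {X : Type*} [MeasurableSpace X] {μ : Measure X}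

/-- The essentially bounded complex functions modulo almost everywhere equality. -/
abbrev Linfty (μ : Measure X) : Type _ := Lp ℂ ∞ μ

theorem mul_mem_Linfty (f g : Linfty μ) : (f : X →ₘ[μ] ℂ) * (g : X →ₘ[μ] ℂ) ∈ Lp ℂ ∞ μ := by
  have h : MemLp ((f : X → ℂ) * (g : X → ℂ)) ∞ μ := (Lp.memLp g).mul (Lp.memLp f)
  rw [Lp.mem_Lp_iff_memLp]
  exact h.ae_eq (AEEqFun.coeFn_mul _ _).symm

theorem one_mem_Linfty : (1 : X →ₘ[μ] ℂ) ∈ Lp ℂ ∞ μ := by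
  rw [Lp.mem_Lp_iff_memLp]
  have h : MemLp (fun _ : X => (1 : ℂ)) ∞ μ := memLp_top_const 1
  exact h.ae_eq (AEEqFun.coeFn_one).symm

instance : Mul (Linfty μ) := ⟨fun f g => ⟨(f : X →ₘ[μ] ℂ) * g, mul_mem_Linfty f g⟩⟩

instance : One (Linfty μ) := ⟨⟨1, one_mem_Linfty⟩⟩

instance : CommRing (Linfty μ) :=
  { (inferInstance : AddCommGroup (Linfty μ)), (inferInstance : Mul (Linfty μ)),
    (inferInstance : One (Linfty μ)) with
    mul_assoc := fun f g h => Subtype.ext (mul_assoc (f : X →ₘ[μ] ℂ) g h)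
    mul_comm := fun f g => Subtype.ext (mul_comm (f : X →ₘ[μ] ℂ) g)
    one_mul := fun f => Subtype.ext (one_mul (f : X →ₘ[μ] ℂ))
    mul_one := fun f => Subtype.ext (mul_one (f : X →ₘ[μ] ℂ))
    zero_mul := by
      rintro ⟨⟨f⟩, _⟩
      exact Subtype.ext (AEEqFun.mk_eq_mk.2 (.of_forall fun x => zero_mul (f.1 x)))
    mul_zero := by
      rintro ⟨⟨f⟩, _⟩
      exact Subtype.ext (AEEqFun.mk_eq_mk.2 (.of_forall fun x => mul_zero (f.1 x)))
    left_distrib := by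
      rintro ⟨⟨f⟩, _⟩ ⟨⟨g⟩, _⟩ ⟨⟨h⟩, _⟩
      exact Subtype.ext (AEEqFun.mk_eq_mk.2 (.of_forall fun x => mul_add (f.1 x) (g.1 x) (h.1 x)))
    right_distrib := by
      rintro ⟨⟨f⟩, _⟩ ⟨⟨g⟩, _⟩ ⟨⟨h⟩, _⟩
      exact Subtype.ext (AEEqFun.mk_eq_mk.2 (.of_forall fun x => add_mul (f.1 x) (g.1 x) (h.1 x))) }

instance : Algebra ℂ (Linfty μ) :=
  Algebra.ofModule
    (by
      rintro c ⟨⟨f⟩, _⟩ ⟨⟨g⟩, _⟩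
      exact Subtype.ext
        (AEEqFun.mk_eq_mk.2 (.of_forall fun x => smul_mul_assoc c (f.1 x) (g.1 x))))
    (by
      rintro c ⟨⟨f⟩, _⟩ ⟨⟨g⟩, _⟩
      exact Subtype.ext
        (AEEqFun.mk_eq_mk.2 (.of_forall fun x => mul_smul_comm c (f.1 x) (g.1 x))))

instance : StarRing (Linfty μ) where
  toInvolutiveStar := inferInstanceAs (InvolutiveStar (Lp ℂ ∞ μ))
  star_mul := by
    rintro ⟨⟨f⟩, _⟩ ⟨⟨g⟩, _⟩
    exact Subtype.ext (AEEqFun.mk_eq_mk.2 (.of_forall fun x => star_mul (f.1 x) (g.1 x)))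
  star_add := by
    rintro ⟨⟨f⟩, _⟩ ⟨⟨g⟩, _⟩
    exact Subtype.ext (AEEqFun.mk_eq_mk.2 (.of_forall fun x => star_add (f.1 x) (g.1 x)))

instance : StarModule ℂ (Linfty μ) where
  star_smul := by
    rintro c ⟨⟨f⟩, _⟩
    exact Subtype.ext (AEEqFun.mk_eq_mk.2 (.of_forall fun x => star_smul c (f.1 x)))

theorem coeFn_mul_Linfty (f g : Linfty μ) : ⇑(f * g) =ᵐ[μ] fun x => f x * g x :=
  AEEqFun.coeFn_mul _ _

theorem coeFn_one_Linfty : ⇑(1 : Linfty μ) =ᵐ[μ] fun _ => (1 : ℂ) :=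
  AEEqFun.coeFn_one

theorem coeFn_star_Linfty (f : Linfty μ) : ⇑(star f) =ᵐ[μ] fun x => star (f x) :=
  AEEqFun.coeFn_star _

end Linfty

/-! ### Measure entropy -/

/-- `α_s (f) (x) = f (s⁻¹ x)` on `L^∞(X, μ)`. -/
def actL {G : Type*} [Group G] {X : Type*} [MeasurableSpace X] [MulAction G X]
    [MeasurableConstSMul G X] {μ : Measure X} [SMulInvariantMeasure G X μ] (s : G)
    (f : Linfty μ) : Linfty μ :=
  Lp.compMeasurePreserving (fun x => s⁻¹ • x) (measurePreserving_smul s⁻¹ μ) f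

/-- A von Neumann subalgebra of `L^∞(X, μ)`, for a probability measure `μ`: a unital
`*`-subalgebra which is closed in the `L²`-norm. -/
def IsVonNeumannSubalgebra {X : Type*} [MeasurableSpace X] {μ : Measure X}
    (A : StarSubalgebra ℂ (Linfty μ)) : Prop :=
  ∀ f : Linfty μ,
    (∀ ε : ℝ, 0 < ε → ∃ g ∈ A, eLpNorm (⇑(f - g)) 2 μ < ENNReal.ofReal ε) → f ∈ A

/-- `p` is a dynamically generating sequence in the unit ball of the real-valued functions in
`L^∞(X, μ)`: it is not contained in any proper `G`-invariant von Neumann subalgebra. -/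
structure IsGeneratingL (G : Type*) [Group G] {X : Type*} [MeasurableSpace X] [MulAction G X]
    [MeasurableConstSMul G X] {μ : Measure X} [SMulInvariantMeasure G X μ]
    (p : ℕ → Linfty μ) : Prop where
  real : ∀ n, IsSelfAdjoint (p n)
  norm_le : ∀ n, ‖p n‖ ≤ 1
  generating : ∀ A : StarSubalgebra ℂ (Linfty μ), IsVonNeumannSubalgebra A →
    (∀ s : G, ∀ f ∈ A, actL s f ∈ A) → (∀ n, p n ∈ A) → A = ⊤

/-- `UP_μ(S, F, m, δ, σ)`: the unital positive linear maps `φ : L^∞(X, μ) → ℂ^d` which are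
approximately multiplicative, approximately measure-preserving and approximately equivariant.
The condition `n k < m` says that the `k`-th factor is one of the first `m` terms of the
sequence. -/
structure IsUP {G : Type*} [Group G] {X : Type*} [MeasurableSpace X] [MulAction G X]
    [MeasurableConstSMul G X] {μ : Measure X} [SMulInvariantMeasure G X μ] {d : ℕ}
    (p : ℕ → Linfty μ) (F : Finset G) (m : ℕ) (δ : ℝ) (σ : G → Equiv.Perm (Fin d))
    (φ : Linfty μ →ₗ[ℂ] (Fin d → ℂ)) : Prop where
  map_one : φ 1 = 1
  positive : ∀ f : Linfty μ, (∀ᵐ x ∂μ, 0 ≤ f x) → ∀ k, 0 ≤ φ f k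
  mult : ∀ j : ℕ, 1 ≤ j → j ≤ m → ∀ (s : Fin j → G) (n : Fin j → ℕ), (∀ k, s k ∈ F) →
    (∀ k, n k < m) →
      norm2 (φ (∏ k, actL (s k) (p (n k))) - ∏ k, φ (actL (s k) (p (n k)))) < δ
  measure : ∀ j : ℕ, 1 ≤ j → j ≤ m → ∀ (s : Fin j → G) (n : Fin j → ℕ), (∀ k, s k ∈ F) →
    (∀ k, n k < m) →
      ‖unif (φ (∏ k, actL (s k) (p (n k)))) - ∫ x, (∏ k, actL (s k) (p (n k))) x ∂μ‖ < δ
  equivariant : ∀ s ∈ F, ∀ n < m,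
    norm2 (φ (actL s (p n)) - permAct (σ s) (φ (p n))) < δ

/-- `h_{Σ,μ}(S)` for a sequence `S` in `L^∞(X, μ)`. -/
def measureEntropySeq {G : Type*} [Group G] {X : Type*} [MeasurableSpace X] [MulAction G X]
    [MeasurableConstSMul G X] {μ : Measure X} [SMulInvariantMeasure G X μ]
    (S : SoficApproximation G) (p : ℕ → Linfty μ) : EReal :=
  ⨆ (ε : ℝ) (_ : 0 < ε), ⨅ (F : Finset G) (_ : F.Nonempty), ⨅ (m : ℕ) (_ : 1 ≤ m),
    ⨅ (δ : ℝ) (_ : 0 < δ),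
      growthRate S fun i => sepNumber ε {φ | IsUP p F m δ (S.σ i) φ} fun φ ψ => rho p φ ψ

/-- The measure entropy `h_{Σ,μ}(X, G)`: the common value of `h_{Σ,μ}(S)` over all dynamically
generating sequences `S` in the unit ball of the real-valued functions in `L^∞(X, μ)`. -/
def measureEntropy {G : Type*} [Group G] (S : SoficApproximation G) {X : Type*}
    [MeasurableSpace X] [MulAction G X] [MeasurableConstSMul G X] (μ : Measure X)
    [SMulInvariantMeasure G X μ] : EReal :=
  ⨆ (p : ℕ → Linfty μ) (_ : IsGeneratingL G p), measureEntropySeq S p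

/-- `M_G(X)`: the `G`-invariant Borel probability measures on `X`. -/
structure InvariantProbability (G : Type*) [Group G] (X : Type*) [MeasurableSpace X]
    [MulAction G X] where
  toMeasure : Measure X
  isProbabilityMeasure : IsProbabilityMeasure toMeasure
  invariant : SMulInvariantMeasure G X toMeasure

attribute [instance] InvariantProbability.isProbabilityMeasure InvariantProbability.invariant

end SoficEntropy

end

/-!
Both entropies are growth rates of numbers of separated points in sets of approximations, in the
limit over finer and finer approximations. They are treated as entropies `filterEntropy` of filters
on disjoint unions `Σ i, B i`; inequalities between them come from maps which carry one filter into
another and keep separated points separated (`filterEntropy_le_of_map`).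

*Measure entropy.* Put `P x (s, n) = p n (s⁻¹ x)`, the profile map from `X` to the cube
`[-1, 1]^(G × ℕ)`. A microstate is a sequence of functions `Fin d → [-1, 1]` whose orbits under the
approximate action are distributed in the cube almost like `P` under `μ`. The values of an
approximately multiplicative, measure-preserving and equivariant positive map on `p` form a
microstate, since the mixed moments of `p` determine the distribution by the Stone–Weierstrass
theorem (`tendsto_valuesL`). Conversely, conditional expectation along a fine partition of unity on
the cube turns a microstate into such a positive map (`exists_eventually_isUP_microMap`). So the
measure entropy is the entropy of microstates (`measureEntropySeq_eq_microEntropy`). If `p`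
generates, every bounded function is a limit of continuous functions of `P`, so that two generating
sequences are related by codes which are approximately inverse to each other and which transport
microstates (`microEntropy_le_of_isGeneratingL`).

*Topological entropy.* Homomorphisms `C(X) → ℂ^d` are evaluations at `d` points of `X`. For a
generating sequence the profile map is injective, hence by Tietze's theorem every continuous
function on `X` is a continuous function of the profile. Therefore approximate equivariance does not
depend on the generating sequence (`tendsto_avg_equivariant`), and neither does the entropy
(`topEntropySeq_le_of_isGeneratingC`).

*Variational principle.* A sequence which generates `C(X)` generates `L^∞(X, μ)` for every invariant
`μ`, so one sequence serves for all entropies. The orbits of a microstate lie mostly near the image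
of the profile map, and nearest points there give an approximately equivariant homomorphism; hence
the measure entropies are at most the topological entropy (`microEntropy_le_topEntropySeq`).
For the other inequality, each homomorphism has an empirical measure on `X`. The space of
probability measures is compact, and a sum of finitely many numbers grows like the largest of them;
so at each scale the growth is attained near a single measure (`exists_entropyAt_le_inf_nhds`). This
measure is invariant because the homomorphisms are approximately equivariant, and homomorphisms
whose empirical measures are close to it are microstates for it
(`exists_entropyAt_le_microEntropy`).
-/

noncomputable section

namespace SoficEntropy

/-! ### Averages over a finite set -/

/-- The mean of a real function on `Fin d` (equal to `0` for `d = 0`). -/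
def avg {d : ℕ} (f : Fin d → ℝ) : ℝ := (d : ℝ)⁻¹ * ∑ k, f k

section Avg

variable {d : ℕ}

theorem avg_mono {f g : Fin d → ℝ} (h : ∀ k, f k ≤ g k) : avg f ≤ avg g :=
  mul_le_mul_of_nonneg_left (Finset.sum_le_sum fun k _ => h k) (by positivity)

theorem avg_nonneg {f : Fin d → ℝ} (h : ∀ k, 0 ≤ f k) : 0 ≤ avg f :=
  mul_nonneg (by positivity) (Finset.sum_nonneg fun k _ => h k)

theorem avg_add (f g : Fin d → ℝ) : avg (fun k => f k + g k) = avg f + avg g := by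
  simp [avg, Finset.sum_add_distrib, mul_add]

theorem avg_sub (f g : Fin d → ℝ) : avg (fun k => f k - g k) = avg f - avg g := by
  simp [avg, Finset.sum_sub_distrib, mul_sub]

theorem avg_const_mul (c : ℝ) (f : Fin d → ℝ) : avg (fun k => c * f k) = c * avg f := by
  simp only [avg, ← Finset.mul_sum]; ring

theorem avg_sum {ι : Type*} (J : Finset ι) (f : ι → Fin d → ℝ) :
    avg (fun k => ∑ j ∈ J, f j k) = ∑ j ∈ J, avg (f j) := by
  simp only [avg]
  rw [Finset.sum_comm, Finset.mul_sum]

theorem avg_const (hd : 0 < d) (c : ℝ) : avg (fun _ : Fin d => c) = c := by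
  have : (d : ℝ) ≠ 0 := by positivity
  simp [avg, this]

theorem avg_const_le {c : ℝ} (hc : 0 ≤ c) : avg (fun _ : Fin d => c) ≤ c := by
  rcases Nat.eq_zero_or_pos d with rfl | hd
  · simpa [avg] using hc
  · exact (avg_const hd c).le

theorem abs_avg_le (f : Fin d → ℝ) : |avg f| ≤ avg fun k => |f k| := by
  rw [avg, abs_mul, abs_of_nonneg (by positivity : (0 : ℝ) ≤ (d : ℝ)⁻¹)]
  exact mul_le_mul_of_nonneg_left (Finset.abs_sum_le_sum_abs _ _) (by positivity)

theorem avg_comp_perm (τ : Equiv.Perm (Fin d)) (f : Fin d → ℝ) :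
    avg (fun k => f (τ k)) = avg f := by
  simp only [avg]
  rw [Equiv.sum_comp τ f]

theorem avg_abs_sub_triangle (f g h : Fin d → ℝ) :
    avg (fun k => |f k - h k|) ≤ avg (fun k => |f k - g k|) + avg fun k => |g k - h k| := by
  rw [← avg_add]
  exact avg_mono fun k => abs_sub_le _ _ _

theorem norm2_eq (f : Fin d → ℂ) :
    norm2 f = Real.sqrt ((d : ℝ)⁻¹) * ‖(WithLp.toLp 2 f : EuclideanSpace ℂ (Fin d))‖ := by
  rw [norm2, Real.sqrt_mul (by positivity), EuclideanSpace.norm_eq]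

theorem norm2_nonneg (f : Fin d → ℂ) : 0 ≤ norm2 f := Real.sqrt_nonneg _

theorem norm2_add_le (f g : Fin d → ℂ) : norm2 (f + g) ≤ norm2 f + norm2 g := by
  rw [norm2_eq, norm2_eq, norm2_eq, WithLp.toLp_add, ← mul_add]
  exact mul_le_mul_of_nonneg_left (norm_add_le _ _) (Real.sqrt_nonneg _)

theorem norm2_neg (f : Fin d → ℂ) : norm2 (-f) = norm2 f := by
  simp [norm2]

theorem norm2_sub_triangle (f g h : Fin d → ℂ) :
    norm2 (f - h) ≤ norm2 (f - g) + norm2 (g - h) := by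
  have := norm2_add_le (f - g) (g - h)
  simpa using this

/-- Cauchy–Schwarz against the constant function. -/
theorem avg_norm_le_norm2 (f : Fin d → ℂ) : avg (fun k => ‖f k‖) ≤ norm2 f := by
  apply Real.le_sqrt_of_sq_le
  have h := sq_sum_le_card_mul_sum_sq (s := Finset.univ) (f := fun k : Fin d => ‖f k‖)
  simp only [Finset.card_univ, Fintype.card_fin] at h
  rcases Nat.eq_zero_or_pos d with rfl | hd
  · simp [avg]
  · have hd' : (0 : ℝ) < d := by positivity
    rw [avg, mul_pow]
    calc ((d : ℝ)⁻¹) ^ 2 * (∑ k, ‖f k‖) ^ 2 ≤ ((d : ℝ)⁻¹) ^ 2 * (d * ∑ k, ‖f k‖ ^ 2) :=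
          mul_le_mul_of_nonneg_left h (by positivity)
      _ = (d : ℝ)⁻¹ * ∑ k, ‖f k‖ ^ 2 := by field_simp

theorem norm2_le_sqrt_avg {C : ℝ} (f : Fin d → ℂ) (h : ∀ k, ‖f k‖ ≤ C) :
    norm2 f ≤ Real.sqrt (C * avg fun k => ‖f k‖) := by
  apply Real.sqrt_le_sqrt
  rw [← avg_const_mul]
  refine mul_le_mul_of_nonneg_left (Finset.sum_le_sum fun k _ => ?_) (by positivity)
  rw [sq]
  exact mul_le_mul_of_nonneg_right (h k) (norm_nonneg _)

theorem norm2_le_of_norm_le {C : ℝ} (hC : 0 ≤ C) (f : Fin d → ℂ) (h : ∀ k, ‖f k‖ ≤ C) :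
    norm2 f ≤ C := by
  refine (norm2_le_sqrt_avg f h).trans (Real.sqrt_le_iff.2 ⟨hC, ?_⟩)
  rw [sq]
  exact mul_le_mul_of_nonneg_left ((avg_mono h).trans (avg_const_le hC)) hC

/-- On uniformly bounded functions, smallness in mean implies smallness in `‖·‖₂`. -/
theorem norm2_lt_of_avg_lt {C δ : ℝ} (hC : 0 ≤ C) (hδ : 0 < δ) (f : Fin d → ℂ)
    (h : ∀ k, ‖f k‖ ≤ C) (h' : avg (fun k => ‖f k‖) < δ ^ 2 / (C + 1)) : norm2 f < δ := by
  refine (norm2_le_sqrt_avg f h).trans_lt ((Real.sqrt_lt' hδ).2 ?_)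
  rw [lt_div_iff₀ (by positivity)] at h'
  have := avg_nonneg (f := fun k => ‖f k‖) fun k => norm_nonneg _
  nlinarith

end Avg

/-! ### Sequences of functions with values in `[-1, 1]` -/

/-- The segment `[-1, 1]`. -/
abbrev Seg : Type := Set.Icc (-1 : ℝ) 1

/-- The retraction of the real line onto `[-1, 1]`. -/
def clamp (x : ℝ) : Seg := Set.projIcc (-1) 1 (by norm_num) x

theorem continuous_clamp : Continuous clamp := continuous_projIcc (h := by norm_num)

theorem coe_clamp {x : ℝ} (h : |x| ≤ 1) : (clamp x : ℝ) = x :=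
  congrArg Subtype.val (Set.projIcc_of_mem _ (abs_le.1 h))

theorem clamp_coe (x : Seg) : clamp x = x := Set.projIcc_val _ x

theorem abs_clamp_sub_le (x y : ℝ) : |(clamp x : ℝ) - clamp y| ≤ |x - y| :=
  Set.abs_projIcc_sub_projIcc _

theorem Seg.abs_le (x : Seg) : |(x : ℝ)| ≤ 1 := _root_.abs_le.2 x.2

theorem Seg.abs_sub_le (x y : Seg) : |(x : ℝ) - y| ≤ 2 := by
  have := x.2; have := y.2
  rw [_root_.abs_le]
  constructor <;> linarith [x.2.1, x.2.2, y.2.1, y.2.2]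

/-- The pseudometric `ρ` on sequences of functions `Fin d → [-1, 1]`. -/
def seqDist {d : ℕ} (a b : ℕ → Fin d → Seg) : ℝ :=
  rho (id : ℕ → ℕ) (fun n k => ((a n k : ℝ) : ℂ)) fun n k => ((b n k : ℝ) : ℂ)

section SeqDist

variable {d : ℕ}

/-- The `‖·‖₂`-distance of two functions with values in `[-1, 1]`. -/
def segDist (f g : Fin d → Seg) : ℝ :=
  norm2 ((fun k => ((f k : ℝ) : ℂ)) - fun k => ((g k : ℝ) : ℂ))

theorem norm_coe_sub (x y : Seg) : ‖((x : ℝ) : ℂ) - ((y : ℝ) : ℂ)‖ = |(x : ℝ) - y| := by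
  rw [← Complex.ofReal_sub, Complex.norm_real, Real.norm_eq_abs]

theorem avg_le_segDist (f g : Fin d → Seg) : avg (fun k => |(f k : ℝ) - g k|) ≤ segDist f g := by
  have := avg_norm_le_norm2 ((fun k => ((f k : ℝ) : ℂ)) - fun k => ((g k : ℝ) : ℂ))
  simpa only [Pi.sub_apply, norm_coe_sub, segDist] using this

theorem segDist_le_two (f g : Fin d → Seg) : segDist f g ≤ 2 :=
  norm2_le_of_norm_le (by norm_num) _ fun k => by
    rw [Pi.sub_apply, norm_coe_sub]; exact Seg.abs_sub_le _ _

theorem segDist_nonneg (f g : Fin d → Seg) : 0 ≤ segDist f g := norm2_nonneg _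

theorem segDist_lt {δ : ℝ} (hδ : 0 < δ) (f g : Fin d → Seg)
    (h : avg (fun k => |(f k : ℝ) - g k|) < δ ^ 2 / 3) : segDist f g < δ := by
  refine norm2_lt_of_avg_lt (C := 2) (by norm_num) hδ _ (fun k => ?_) ?_
  · rw [Pi.sub_apply, norm_coe_sub]; exact Seg.abs_sub_le _ _
  · simp only [Pi.sub_apply, norm_coe_sub]
    convert h using 2
    norm_num

theorem seqDist_eq (a b : ℕ → Fin d → Seg) :
    seqDist a b = ∑' n : ℕ, (1 / 2 : ℝ) ^ (n + 1) * segDist (a n) (b n) := rfl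

theorem summable_half_pow_succ : Summable fun n : ℕ => (1 / 2 : ℝ) ^ (n + 1) :=
  (summable_nat_add_iff 1).2 summable_geometric_two

theorem tsum_half_pow_succ : ∑' n : ℕ, (1 / 2 : ℝ) ^ (n + 1) = 1 := by
  simp_rw [pow_succ]
  rw [tsum_mul_right, tsum_geometric_two]
  norm_num

theorem summable_seqDist (a b : ℕ → Fin d → Seg) :
    Summable fun n : ℕ => (1 / 2 : ℝ) ^ (n + 1) * segDist (a n) (b n) :=
  (summable_half_pow_succ.mul_right 2).of_nonneg_of_le
    (fun n => mul_nonneg (by positivity) (segDist_nonneg _ _))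
    fun n => mul_le_mul_of_nonneg_left (segDist_le_two _ _) (by positivity)

theorem seqDist_self (a : ℕ → Fin d → Seg) : seqDist a a = 0 := by
  simp [seqDist_eq, segDist, norm2]

theorem seqDist_comm (a b : ℕ → Fin d → Seg) : seqDist a b = seqDist b a := by
  simp_rw [seqDist_eq]
  refine tsum_congr fun n => ?_
  rw [segDist, ← norm2_neg, neg_sub, segDist]

theorem seqDist_triangle (a b c : ℕ → Fin d → Seg) : seqDist a c ≤ seqDist a b + seqDist b c := by
  simp_rw [seqDist_eq]
  rw [← (summable_seqDist a b).tsum_add (summable_seqDist b c)]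
  refine (summable_seqDist a c).tsum_le_tsum (fun n => ?_)
    ((summable_seqDist a b).add (summable_seqDist b c))
  rw [← mul_add]
  exact mul_le_mul_of_nonneg_left (norm2_sub_triangle _ _ _) (by positivity)

theorem segDist_le_seqDist (a b : ℕ → Fin d → Seg) (n : ℕ) :
    segDist (a n) (b n) ≤ 2 ^ (n + 1) * seqDist a b := by
  have h := (summable_seqDist a b).le_tsum n
    fun j _ => mul_nonneg (by positivity) (segDist_nonneg (a j) (b j))
  rw [← seqDist_eq] at h
  calc segDist (a n) (b n) = 2 ^ (n + 1) * ((1 / 2 : ℝ) ^ (n + 1) * segDist (a n) (b n)) := by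
        rw [← mul_assoc, ← mul_pow]; norm_num
    _ ≤ _ := mul_le_mul_of_nonneg_left h (by positivity)

theorem avg_le_seqDist (a b : ℕ → Fin d → Seg) (n : ℕ) :
    avg (fun k => |(a n k : ℝ) - b n k|) ≤ 2 ^ (n + 1) * seqDist a b :=
  (avg_le_segDist _ _).trans (segDist_le_seqDist a b n)

end SeqDist

/-- Smallness of finitely many terms in the mean makes `ρ` small, uniformly in `d`. -/
theorem exists_forall_seqDist_lt {η : ℝ} (hη : 0 < η) :
    ∃ (N : ℕ) (κ : ℝ), 0 < κ ∧ ∀ (d : ℕ) (a b : ℕ → Fin d → Seg),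
      (∀ n < N, avg (fun k => |(a n k : ℝ) - b n k|) < κ) → seqDist a b < η := by
  -- the terms from `N` on contribute at most `2 * 2⁻ᴺ < η / 2`
  obtain ⟨N, hN⟩ := exists_pow_lt_of_lt_one (show 0 < η / 4 by positivity)
    (show (1 / 2 : ℝ) < 1 by norm_num)
  refine ⟨N, (η / 4) ^ 2 / 3, by positivity, fun d a b h => ?_⟩
  have h1 : ∀ n < N, segDist (a n) (b n) < η / 4 := fun n hn =>
    segDist_lt (by positivity) _ _ (h n hn)
  rw [seqDist_eq, ← (summable_seqDist a b).sum_add_tsum_nat_add N]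
  have h2 : ∑ n ∈ Finset.range N, (1 / 2 : ℝ) ^ (n + 1) * segDist (a n) (b n) ≤ η / 4 := by
    calc _ ≤ ∑ n ∈ Finset.range N, (1 / 2 : ℝ) ^ (n + 1) * (η / 4) :=
          Finset.sum_le_sum fun n hn => mul_le_mul_of_nonneg_left
            (h1 n (Finset.mem_range.1 hn)).le (by positivity)
      _ ≤ ∑' n : ℕ, (1 / 2 : ℝ) ^ (n + 1) * (η / 4) :=
          (summable_half_pow_succ.mul_right _).sum_le_tsum _ fun n _ => by positivity
      _ = η / 4 := by rw [tsum_mul_right, tsum_half_pow_succ, one_mul]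
  have h3 : ∑' n, (1 / 2 : ℝ) ^ (n + N + 1) * segDist (a (n + N)) (b (n + N))
      ≤ (1 / 2) ^ N * 2 := by
    have h4 : ∑' n : ℕ, (1 / 2 : ℝ) ^ (n + 1) * ((1 / 2) ^ N * 2) = (1 / 2) ^ N * 2 := by
      rw [tsum_mul_right, tsum_half_pow_succ, one_mul]
    rw [← h4]
    refine ((summable_nat_add_iff N).2 (summable_seqDist a b)).tsum_le_tsum (fun n => ?_)
      (summable_half_pow_succ.mul_right _)
    rw [show (1 / 2 : ℝ) ^ (n + 1) * ((1 / 2) ^ N * 2) = (1 / 2) ^ (n + N + 1) * 2 by ring]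
    exact mul_le_mul_of_nonneg_left (segDist_le_two _ _) (by positivity)
  linarith

/-! ### Separated sets and growth rates -/

section Sep

variable {B C : Type*} {ε ε' : ℝ} {ρ : B → B → ℝ} {ρ' : C → C → ℝ}

/-- A map which keeps `ε`-separated points `ε'`-separated does not decrease the number of separated
points. -/
theorem sepNumber_le_of_map {Y : Set B} {Z : Set C} (hε' : 0 < ε') (hρ' : ∀ c, ρ' c c = 0)
    (f : B → C) (hf : ∀ b ∈ Y, f b ∈ Z)
    (h : ∀ b ∈ Y, ∀ b' ∈ Y, ε < ρ b b' → ε' < ρ' (f b) (f b')) :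
    sepNumber ε Y ρ ≤ sepNumber ε' Z ρ' := by
  classical
  refine iSup₂_le fun E hE => ?_
  have hinj : Set.InjOn f E := by
    intro x hx y hy hxy
    by_contra hne
    have := h x (hE.1 hx) y (hE.1 hy) (hE.2 x hx y hy hne)
    rw [hxy, hρ'] at this
    exact absurd this (not_lt.2 hε'.le)
  rw [← Finset.card_image_of_injOn hinj]
  refine le_iSup₂_of_le (E.image f) ⟨?_, ?_⟩ le_rfl
  · intro c hc
    obtain ⟨b, hb, rfl⟩ := Finset.mem_image.1 (Finset.mem_coe.1 hc)
    exact hf b (hE.1 hb)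
  · intro x hx y hy hxy
    obtain ⟨b, hb, rfl⟩ := Finset.mem_image.1 hx
    obtain ⟨b', hb', rfl⟩ := Finset.mem_image.1 hy
    exact h b (hE.1 hb) b' (hE.1 hb') (hE.2 b hb b' hb' fun e => hxy (by rw [e]))

theorem sepNumber_mono {Y Z : Set B} (h : Y ⊆ Z) : sepNumber ε Y ρ ≤ sepNumber ε Z ρ :=
  iSup₂_le fun E hE => le_iSup₂_of_le E ⟨hE.1.trans h, hE.2⟩ le_rfl

theorem sepNumber_empty : sepNumber ε (∅ : Set B) ρ = 0 := by
  refine le_antisymm (iSup₂_le fun E hE => ?_) zero_le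
  have : E = ∅ := Finset.coe_eq_empty.1 (Set.subset_empty_iff.1 hE.1)
  simp [this]

theorem sepNumber_le_sum {ι : Type*} (J : Finset ι) (Z : ι → Set B) {Y : Set B}
    (h : ∀ b ∈ Y, ∃ j ∈ J, b ∈ Z j) : sepNumber ε Y ρ ≤ ∑ j ∈ J, sepNumber ε (Z j) ρ := by
  classical
  refine iSup₂_le fun E hE => ?_
  have h1 : E ⊆ J.biUnion fun j => E.filter fun b => b ∈ Z j := by
    intro b hb
    obtain ⟨j, hj, hbj⟩ := h b (hE.1 hb)
    exact Finset.mem_biUnion.2 ⟨j, hj, Finset.mem_filter.2 ⟨hb, hbj⟩⟩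
  calc (E.card : ℝ≥0∞) ≤ ((∑ j ∈ J, (E.filter fun b => b ∈ Z j).card : ℕ) : ℝ≥0∞) :=
        Nat.cast_le.2 ((Finset.card_le_card h1).trans Finset.card_biUnion_le)
    _ = ∑ j ∈ J, ((E.filter fun b => b ∈ Z j).card : ℝ≥0∞) := Nat.cast_sum _ _
    _ ≤ _ := Finset.sum_le_sum fun j _ => le_iSup₂_of_le (E.filter fun b => b ∈ Z j)
        ⟨fun b hb => (Finset.mem_filter.1 (Finset.mem_coe.1 hb)).2, fun x hx y hy hxy =>
          hE.2 x (Finset.mem_filter.1 hx).1 y (Finset.mem_filter.1 hy).1 hxy⟩ le_rfl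

end Sep

section Growth

variable {G : Type*} [Group G] (S : SoficApproximation G)

theorem growthRate_mono {N N' : ℕ → ℝ≥0∞} (h : ∀ᶠ i in atTop, N i ≤ N' i) :
    growthRate S N ≤ growthRate S N' := by
  refine limsup_le_limsup (h.mono fun i hi => ?_)
  exact mul_le_mul_of_nonneg_left (ENNReal.log_le_log hi)
    (EReal.coe_nonneg.2 (by positivity))

theorem growthRate_eq_bot {N : ℕ → ℝ≥0∞} (h : ∀ᶠ i in atTop, N i = 0) : growthRate S N = ⊥ := by
  have : ∀ᶠ i in atTop,
      (((S.d i : ℝ)⁻¹ : ℝ) : EReal) * ENNReal.log (N i) = ⊥ := by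
    filter_upwards [h] with i hi
    have : (0 : ℝ) < S.d i := by exact_mod_cast S.d_pos i
    rw [hi, ENNReal.log_zero, EReal.coe_mul_bot_of_pos (by positivity)]
  rw [growthRate, limsup_congr this, limsup_const]

theorem tendsto_inv_d : Tendsto (fun i => (S.d i : ℝ)⁻¹) atTop (𝓝 0) :=
  tendsto_inv_atTop_zero.comp (tendsto_natCast_atTop_atTop.comp S.tendsto_d)

/-- Sums have the growth rate of the larger summand. This is where `d i → ∞` enters: the factor `2`
costs `log 2 / d i`. -/
theorem growthRate_add_lt {N N' : ℕ → ℝ≥0∞} {c : EReal} (h : growthRate S N < c)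
    (h' : growthRate S N' < c) : growthRate S (fun i => N i + N' i) < c := by
  obtain ⟨b, hb, hbc⟩ := exists_between (max_lt h h')
  have hb1 : b ≠ ⊥ := ne_bot_of_gt hb
  have hb2 : b ≠ ⊤ := ne_top_of_lt hbc
  lift b to ℝ using ⟨hb2, hb1⟩
  obtain ⟨hN, hN'⟩ := max_lt_iff.1 hb
  have e1 := eventually_lt_of_limsup_lt hN
  have e2 := eventually_lt_of_limsup_lt hN'
  refine lt_of_le_of_lt ?_ hbc
  have key : ∀ᶠ i in atTop, (((S.d i : ℝ)⁻¹ : ℝ) : EReal) * ENNReal.log (N i + N' i)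
      ≤ (((S.d i : ℝ)⁻¹ * Real.log 2 + b : ℝ) : EReal) := by
    filter_upwards [e1, e2] with i h1 h2
    have hd : (0 : EReal) ≤ (((S.d i : ℝ)⁻¹ : ℝ) : EReal) := EReal.coe_nonneg.2 (by positivity)
    have hlog2 : ENNReal.log 2 = ((Real.log 2 : ℝ) : EReal) := by
      rw [ENNReal.log_pos_real (by simp) (by simp)]; simp
    have aux : ∀ M : ℝ≥0∞, N i + N' i ≤ 2 * M →
        (((S.d i : ℝ)⁻¹ : ℝ) : EReal) * ENNReal.log M < (b : EReal) →
        (((S.d i : ℝ)⁻¹ : ℝ) : EReal) * ENNReal.log (N i + N' i)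
          ≤ (((S.d i : ℝ)⁻¹ * Real.log 2 + b : ℝ) : EReal) := by
      intro M hM hb
      calc _ ≤ (((S.d i : ℝ)⁻¹ : ℝ) : EReal) * ENNReal.log (2 * M) :=
            mul_le_mul_of_nonneg_left (ENNReal.log_le_log hM) hd
        _ = (((S.d i : ℝ)⁻¹ : ℝ) : EReal) * (Real.log 2 : ℝ)
            + (((S.d i : ℝ)⁻¹ : ℝ) : EReal) * ENNReal.log M := by
            rw [ENNReal.log_mul_add, hlog2, EReal.left_distrib_of_nonneg_of_ne_top hd
              (EReal.coe_ne_top _)]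
        _ ≤ _ := by
            rw [EReal.coe_add, EReal.coe_mul]
            gcongr
    rcases le_total (N i) (N' i) with hle | hle
    · exact aux _ (by rw [two_mul]; gcongr) h2
    · exact aux _ (by rw [two_mul]; gcongr) h1
  have lim : Tendsto (fun i => (((S.d i : ℝ)⁻¹ * Real.log 2 + b : ℝ) : EReal)) atTop
      (𝓝 (b : EReal)) := by
    have := ((tendsto_inv_d S).mul_const (Real.log 2)).add_const b
    rw [zero_mul, zero_add] at this
    exact (continuous_coe_real_ereal.tendsto b).comp this
  rw [← lim.limsup_eq]
  exact limsup_le_limsup key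

theorem growthRate_sum_lt {ι : Type*} (J : Finset ι) {N : ι → ℕ → ℝ≥0∞} {c : EReal} (hc : ⊥ < c)
    (h : ∀ j ∈ J, growthRate S (N j) < c) : growthRate S (fun i => ∑ j ∈ J, N j i) < c := by
  classical
  induction J using Finset.induction_on with
  | empty => rwa [growthRate_eq_bot S (by simp)]
  | insert a J ha ih =>
    simp only [Finset.sum_insert ha]
    exact growthRate_add_lt S (h a (Finset.mem_insert_self a J))
      (ih fun j hj => h j (Finset.mem_insert_of_mem hj))

end Growth

/-! ### Entropy of a filter -/

section FilterEntropy

variable {G : Type*} [Group G] (S : SoficApproximation G) {B C : ℕ → Type*}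

/-- The growth rate, at scale `ε`, of the fibres of the members of a filter on `Σ i, B i`, in the
limit along the filter. -/
def entropyAt (𝓕 : Filter (Σ i, B i)) (ρ : ∀ i, B i → B i → ℝ) (ε : ℝ) : EReal :=
  ⨅ V ∈ 𝓕, growthRate S fun i => sepNumber ε {b : B i | (⟨i, b⟩ : Σ i, B i) ∈ V} (ρ i)

/-- The entropy of a filter on `Σ i, B i`. Both sofic entropies are of this form, for the filters
of topological and of measure-theoretic approximations. -/
def filterEntropy (𝓕 : Filter (Σ i, B i)) (ρ : ∀ i, B i → B i → ℝ) : EReal :=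
  ⨆ (ε : ℝ) (_ : 0 < ε), entropyAt S 𝓕 ρ ε

/-- The filter of the sets which contain, for some `x` and all large `i`, the fibre of `D x`
over `i`. -/
def limitFilter {Λ : Type*} (D : Λ → Set (Σ i, B i)) : Filter (Σ i, B i) :=
  comap Sigma.fst atTop ⊓ ⨅ x, 𝓟 (D x)

variable {S} {𝓕 : Filter (Σ i, B i)} {𝓖 : Filter (Σ i, C i)} {ρ : ∀ i, B i → B i → ℝ}
  {ρ' : ∀ i, C i → C i → ℝ} {ε ε' : ℝ}

theorem entropyAt_le {V : Set (Σ i, B i)} (hV : V ∈ 𝓕) : entropyAt S 𝓕 ρ ε ≤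
    growthRate S fun i => sepNumber ε {b : B i | (⟨i, b⟩ : Σ i, B i) ∈ V} (ρ i) :=
  iInf₂_le V hV

/-- Comparison of entropies: it is enough to map some member of `𝓕` into each member of `𝓖` so that
separated points stay separated. The map may depend on the member of `𝓖`. -/
theorem entropyAt_le_of_map (hε' : 0 < ε') (hρ' : ∀ i c, ρ' i c c = 0)
    (h : ∀ W ∈ 𝓖, ∃ T : ∀ i, B i → C i, ∃ V ∈ 𝓕,
      (∀ i b, (⟨i, b⟩ : Σ i, B i) ∈ V → (⟨i, T i b⟩ : Σ i, C i) ∈ W) ∧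
      ∀ i b b', (⟨i, b⟩ : Σ i, B i) ∈ V → (⟨i, b'⟩ : Σ i, B i) ∈ V →
        ε < ρ i b b' → ε' < ρ' i (T i b) (T i b')) :
    entropyAt S 𝓕 ρ ε ≤ entropyAt S 𝓖 ρ' ε' := by
  refine le_iInf₂ fun W hW => ?_
  obtain ⟨T, V, hV, h1, h2⟩ := h W hW
  refine (entropyAt_le hV).trans (growthRate_mono S (.of_forall fun i => ?_))
  exact sepNumber_le_of_map hε' (hρ' i) (T i) (fun b hb => h1 i b hb)
    fun b hb b' hb' => h2 i b b' hb hb'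

/-- `entropyAt_le_of_map` at all scales; the new scale must not depend on the member of `𝓖`. -/
theorem filterEntropy_le_of_map (hρ' : ∀ i c, ρ' i c c = 0)
    (h : ∀ ε : ℝ, 0 < ε → ∃ ε' : ℝ, 0 < ε' ∧ ∀ W ∈ 𝓖, ∃ T : ∀ i, B i → C i, ∃ V ∈ 𝓕,
      (∀ i b, (⟨i, b⟩ : Σ i, B i) ∈ V → (⟨i, T i b⟩ : Σ i, C i) ∈ W) ∧
      ∀ i b b', (⟨i, b⟩ : Σ i, B i) ∈ V → (⟨i, b'⟩ : Σ i, B i) ∈ V →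
        ε < ρ i b b' → ε' < ρ' i (T i b) (T i b')) :
    filterEntropy S 𝓕 ρ ≤ filterEntropy S 𝓖 ρ' := by
  refine iSup₂_le fun ε hε => ?_
  obtain ⟨ε', hε', h'⟩ := h ε hε
  exact le_iSup₂_of_le ε' hε' (entropyAt_le_of_map hε' hρ' h')

theorem entropyAt_le_of_tendsto (hε : 0 < ε) (hρ' : ∀ i c, ρ' i c c = 0) (T : ∀ i, B i → C i)
    (hT : Tendsto (fun z : Σ i, B i => (⟨z.1, T z.1 z.2⟩ : Σ i, C i)) 𝓕 𝓖) {V : Set (Σ i, B i)}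
    (hV : V ∈ 𝓕) (h : ∀ i b b', (⟨i, b⟩ : Σ i, B i) ∈ V → (⟨i, b'⟩ : Σ i, B i) ∈ V →
      ρ i b b' = ρ' i (T i b) (T i b')) :
    entropyAt S 𝓕 ρ ε ≤ entropyAt S 𝓖 ρ' ε := by
  refine entropyAt_le_of_map hε hρ' fun W hW => ⟨T, _, inter_mem (hT hW) hV,
    fun i b hb => hb.1, fun i b b' hb hb' hlt => ?_⟩
  rwa [← h i b b' hb.2 hb'.2]

/-- Localisation at a point of a compact space: if the fibres of the members of `𝓕`
grow at scale `ε`, they still do so after localisation at a suitable value of `E`. -/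
theorem exists_entropyAt_le_inf_nhds {Y : Type*} [TopologicalSpace Y] [CompactSpace Y]
    (E : (Σ i, B i) → Y) (h : entropyAt S 𝓕 ρ ε ≠ ⊥) :
    ∃ y, entropyAt S 𝓕 ρ ε ≤ entropyAt S (𝓕 ⊓ comap E (𝓝 y)) ρ ε := by
  by_contra! hcon
  have h1 : ∀ y, ∃ O ∈ 𝓝 y, ∃ V ∈ 𝓕, growthRate S (fun i => sepNumber ε
      {b : B i | (⟨i, b⟩ : Σ i, B i) ∈ V ∩ E ⁻¹' O} (ρ i)) < entropyAt S 𝓕 ρ ε := by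
    intro y
    obtain ⟨W, hW⟩ := iInf_lt_iff.1 (hcon y)
    obtain ⟨hmem, hlt⟩ := iInf_lt_iff.1 hW
    obtain ⟨V, hV, U, hU, rfl⟩ := mem_inf_iff.1 hmem
    obtain ⟨O, hO, hOU⟩ := mem_comap.1 hU
    refine ⟨O, hO, V, hV, lt_of_le_of_lt (growthRate_mono S (.of_forall fun i => ?_)) hlt⟩
    exact sepNumber_mono fun b hb => ⟨hb.1, hOU hb.2⟩
  choose O hO V hV hlt using h1
  obtain ⟨J, -, hJ⟩ := isCompact_univ.elim_nhds_subcover O fun y _ => hO y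
  have h2 := growthRate_sum_lt S J (bot_lt_iff_ne_bot.2 h) fun y _ => hlt y
  refine absurd h2 (not_lt.2 ?_)
  refine (entropyAt_le ((biInter_finset_mem J).2 fun y _ => hV y)).trans
    (growthRate_mono S (.of_forall fun i => ?_))
  refine sepNumber_le_sum J
    (fun y => {b : B i | (⟨i, b⟩ : Σ i, B i) ∈ V y ∩ E ⁻¹' O y}) fun b hb => ?_
  obtain ⟨y, hy, hbO⟩ := Set.mem_iUnion₂.1 (hJ (Set.mem_univ (E ⟨i, b⟩)))
  exact ⟨y, hy, Set.mem_iInter₂.1 hb y hy, hbO⟩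

theorem neBot_of_entropyAt_ne_bot (h : entropyAt S 𝓕 ρ ε ≠ ⊥) : 𝓕.NeBot := by
  refine ⟨fun h𝓕 => h ?_⟩
  refine eq_bot_iff.2 ((entropyAt_le (V := ∅) (by simp [h𝓕])).trans ?_)
  rw [growthRate_eq_bot S (.of_forall fun i => ?_)]
  exact sepNumber_empty

section LimitFilter

variable {Λ : Type*} {D : Λ → Set (Σ i, B i)}

theorem tendsto_fst_limitFilter : Tendsto Sigma.fst (limitFilter D) atTop :=
  tendsto_comap.mono_left inf_le_left

theorem mem_limitFilter_of_mem (x : Λ) : D x ∈ limitFilter D :=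
  mem_inf_of_right (mem_iInf_of_mem x (mem_principal_self _))

/-- For a directed family the filter is generated by the sets `D x` over large `i`. -/
theorem mem_limitFilter [Nonempty Λ] (hD : Directed (· ⊇ ·) D) {V : Set (Σ i, B i)} :
    V ∈ limitFilter D ↔
      ∃ x : Λ, ∀ᶠ i in atTop, ∀ b : B i, (⟨i, b⟩ : Σ i, B i) ∈ D x → (⟨i, b⟩ : Σ i, B i) ∈ V := by
  constructor
  · intro h
    obtain ⟨V₁, h₁, V₂, h₂, rfl⟩ := mem_inf_iff.1 h
    obtain ⟨A, hA, hAV⟩ := mem_comap.1 h₁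
    obtain ⟨x, hx⟩ := (mem_iInf_of_directed (f := fun x => 𝓟 (D x))
      (fun x y => by simpa using hD x y) _).1 h₂
    exact ⟨x, by filter_upwards [hA] with i hi b hb using ⟨hAV hi, hx hb⟩⟩
  · rintro ⟨x, hx⟩
    filter_upwards [tendsto_fst_limitFilter.eventually hx, mem_limitFilter_of_mem x] with z h1 h2
      using h1 z.2 h2

theorem entropyAt_limitFilter [Nonempty Λ] (hD : Directed (· ⊇ ·) D) :
    entropyAt S (limitFilter D) ρ ε =
      ⨅ x, growthRate S fun i => sepNumber ε {b : B i | (⟨i, b⟩ : Σ i, B i) ∈ D x} (ρ i) := by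
  refine le_antisymm (le_iInf fun x => entropyAt_le (mem_limitFilter_of_mem x))
    (le_iInf₂ fun V hV => ?_)
  obtain ⟨x, hx⟩ := (mem_limitFilter hD).1 hV
  exact iInf_le_of_le x (growthRate_mono S (hx.mono fun i hi => sepNumber_mono hi))

end LimitFilter

end FilterEntropy

/-! ### Continuous functions on a cube -/

section Cube

variable {ι : Type*}

/-- A continuous function on a cube is Lipschitz in finitely many coordinates up to a small
error. -/
theorem exists_modulus (u : C(ι → Seg, ℝ)) {η : ℝ} (hη : 0 < η) :
    ∃ (J : Finset ι) (C : ℝ), 0 ≤ C ∧ ∀ y y' : ι → Seg,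
      |u y - u y'| ≤ η + C * ∑ j ∈ J, |(y j : ℝ) - y' j| := by
  have hu : UniformContinuous u := CompactSpace.uniformContinuous_of_continuous u.continuous
  have h1 := hu (Metric.dist_mem_uniformity hη)
  rw [mem_map, Pi.uniformity] at h1
  obtain ⟨J, hJ, V, hV, -, hV', -⟩ := mem_iInf'.1 h1
  have h2 : ∀ j, ∃ κ > 0, ∀ y y' : ι → Seg, |(y j : ℝ) - y' j| < κ → (y, y') ∈ V j := by
    intro j
    obtain ⟨W, hW, hWV⟩ := mem_comap.1 (hV j)
    obtain ⟨κ, hκ, h⟩ := Metric.mem_uniformity_dist.1 hW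
    refine ⟨κ, hκ, fun y y' hyy => hWV (h ?_)⟩
    simpa [Subtype.dist_eq, Real.dist_eq] using hyy
  choose κ hκ hκV using h2
  obtain ⟨M, hM⟩ := isCompact_univ.exists_bound_of_continuousOn (f := u) u.continuous.continuousOn
  have hM0 : ∀ y y', |u y - u y'| ≤ 2 * |M| := fun y y' => by
    have a := hM y trivial; have b := hM y' trivial
    rw [Real.norm_eq_abs] at a b
    have := abs_sub (u y) (u y')
    have := le_abs_self M
    linarith
  classical
  refine ⟨hJ.toFinset, ∑ j ∈ hJ.toFinset, 2 * |M| / κ j,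
    Finset.sum_nonneg fun j _ => by have := hκ j; positivity, fun y y' => ?_⟩
  have hpos : ∀ j, 0 ≤ 2 * |M| / κ j := fun j => by have := hκ j; positivity
  by_cases hall : ∀ j ∈ J, |(y j : ℝ) - y' j| < κ j
  · have h3 : (y, y') ∈ ⋂ i ∈ J, V i := Set.mem_iInter₂.2 fun j hj => hκV j y y' (hall j hj)
    rw [← hV'] at h3
    have h4 : |u y - u y'| < η := by simpa [Real.dist_eq] using h3
    have h5 : 0 ≤ (∑ j ∈ hJ.toFinset, 2 * |M| / κ j) * ∑ j ∈ hJ.toFinset, |(y j : ℝ) - y' j| :=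
      mul_nonneg (Finset.sum_nonneg fun j _ => hpos j) (Finset.sum_nonneg fun j _ => abs_nonneg _)
    linarith
  · push Not at hall
    obtain ⟨j, hj, hle⟩ := hall
    have hj' := hJ.mem_toFinset.2 hj
    calc |u y - u y'| ≤ 2 * |M| := hM0 y y'
      _ = 2 * |M| / κ j * κ j := by have := (hκ j).ne'; field_simp
      _ ≤ (∑ j ∈ hJ.toFinset, 2 * |M| / κ j) * ∑ j ∈ hJ.toFinset, |(y j : ℝ) - y' j| := by
          refine mul_le_mul
            (Finset.single_le_sum (f := fun j => 2 * |M| / κ j) (fun j _ => hpos j) hj')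
            (hle.trans (Finset.single_le_sum (f := fun j => |(y j : ℝ) - y' j|)
              (fun j _ => abs_nonneg _) hj')) (hκ j).le (Finset.sum_nonneg fun j _ => hpos j)
      _ ≤ _ := by linarith

theorem avg_modulus_le {u : C(ι → Seg, ℝ)} {η C : ℝ} (hη : 0 ≤ η) {J : Finset ι}
    (h : ∀ y y' : ι → Seg, |u y - u y'| ≤ η + C * ∑ j ∈ J, |(y j : ℝ) - y' j|) {d : ℕ}
    (y y' : Fin d → ι → Seg) : avg (fun k => |u (y k) - u (y' k)|) ≤
      η + C * ∑ j ∈ J, avg fun k => |(y k j : ℝ) - y' k j| := by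
  refine (avg_mono fun k => h (y k) (y' k)).trans ?_
  rw [avg_add, avg_const_mul, avg_sum]
  exact add_le_add_left (avg_const_le hη) _

/-- Families of points of a cube which are close in the mean in each coordinate are close in the
mean for every continuous function. -/
theorem tendsto_avg_abs_sub {β : Type*} {l : Filter β} {d : β → ℕ} {y y' : ∀ b, Fin (d b) → ι → Seg}
    (h : ∀ j, Tendsto (fun b => avg fun k => |(y b k j : ℝ) - y' b k j|) l (𝓝 0))
    (u : C(ι → Seg, ℝ)) :
    Tendsto (fun b => avg fun k => |u (y b k) - u (y' b k)|) l (𝓝 0) := by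
  refine tendsto_order.2 ⟨fun a ha => .of_forall fun b =>
    ha.trans_le (avg_nonneg fun k => abs_nonneg _), fun η hη => ?_⟩
  obtain ⟨J, C, -, hJ⟩ := exists_modulus u (half_pos hη)
  have h1 : Tendsto (fun b => C * ∑ j ∈ J, avg fun k => |(y b k j : ℝ) - y' b k j|) l (𝓝 0) := by
    have := (tendsto_finsetSum J fun j _ => h j).const_mul C
    simpa using this
  filter_upwards [h1.eventually (gt_mem_nhds (half_pos hη))] with b hb
  have := avg_modulus_le (half_pos hη).le hJ (y b) (y' b)
  linarith

theorem tendsto_avg_sub_avg {β : Type*} {l : Filter β} {d : β → ℕ} {f g : ∀ b, Fin (d b) → ℝ}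
    (h : Tendsto (fun b => avg fun k => |f b k - g b k|) l (𝓝 0)) :
    Tendsto (fun b => avg (f b) - avg (g b)) l (𝓝 0) := by
  refine squeeze_zero_norm (fun b => ?_) h
  rw [← avg_sub]
  exact abs_avg_le _

theorem tendsto_avg_abs_trans {β : Type*} {l : Filter β} {d : β → ℕ} {f g h : ∀ b, Fin (d b) → ℝ}
    (h₁ : Tendsto (fun b => avg fun k => |f b k - g b k|) l (𝓝 0))
    (h₂ : Tendsto (fun b => avg fun k => |g b k - h b k|) l (𝓝 0)) :
    Tendsto (fun b => avg fun k => |f b k - h b k|) l (𝓝 0) := by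
  have := h₁.add h₂
  rw [add_zero] at this
  exact squeeze_zero (fun b => avg_nonneg fun k => abs_nonneg _)
    (fun b => avg_abs_sub_triangle _ _ _) this

theorem tendsto_avg_abs_symm {β : Type*} {l : Filter β} {d : β → ℕ} {f g : ∀ b, Fin (d b) → ℝ}
    (h : Tendsto (fun b => avg fun k => |f b k - g b k|) l (𝓝 0)) :
    Tendsto (fun b => avg fun k => |g b k - f b k|) l (𝓝 0) := by
  simpa only [abs_sub_comm] using h

theorem tendsto_avg_abs_perm {β : Type*} {l : Filter β} {d : β → ℕ} {f g : ∀ b, Fin (d b) → ℝ}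
    (τ : ∀ b, Equiv.Perm (Fin (d b)))
    (h : Tendsto (fun b => avg fun k => |f b k - g b k|) l (𝓝 0)) :
    Tendsto (fun b => avg fun k => |f b (τ b k) - g b (τ b k)|) l (𝓝 0) :=
  h.congr fun b => (avg_comp_perm (τ b) fun k => |f b k - g b k|).symm

end Cube

/-! ### Orbits of approximate actions -/

section Sofic

variable {G : Type*} [Group G] (S : SoficApproximation G)

theorem tendsto_avg_ne_mul (s t : G) : Tendsto (fun i => avg fun k : Fin (S.d i) =>
    if S.σ i (s * t) k = S.σ i s (S.σ i t k) then (0 : ℝ) else 1) atTop (𝓝 0) := by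
  have h := (S.tendsto_mul s t).const_sub 1
  rw [sub_self] at h
  refine h.congr fun i => ?_
  have hd := S.d_pos i
  rw [Nat.card_eq_fintype_card, Fintype.card_subtype, Finset.card_filter]
  push_cast
  rw [show (1 : ℝ) = avg fun _ : Fin (S.d i) => (1 : ℝ) from (avg_const hd 1).symm, div_eq_inv_mul,
    ← avg, ← avg_sub]
  congr 1
  funext k
  rw [avg_const hd]
  split_ifs <;> norm_num

theorem avg_abs_sub_le_of_ne {d : ℕ} (c : Fin d → Seg) (f g : Fin d → Fin d) (P : Fin d → Prop)
    [DecidablePred P] (h : ∀ k, P k → f k = g k) :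
    avg (fun k => |(c (f k) : ℝ) - c (g k)|) ≤ 2 * avg fun k => if P k then (0 : ℝ) else 1 := by
  rw [← avg_const_mul]
  refine avg_mono fun k => ?_
  split_ifs with hP
  · simp [h k hP]
  · simpa using Seg.abs_sub_le _ _

variable {β : Type*} {l : Filter β} {i : β → ℕ}

/-- `σ (s t)⁻¹` and `σ t⁻¹ σ s⁻¹` agree in mean on arbitrary functions with values in `[-1, 1]`. -/
theorem tendsto_avg_inv_mul (hi : Tendsto i l atTop) (s t : G) (c : ∀ b, Fin (S.d (i b)) → Seg) :
    Tendsto (fun b => avg fun k => |(c b ((S.σ (i b) (s * t))⁻¹ k) : ℝ)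
      - c b ((S.σ (i b) t)⁻¹ ((S.σ (i b) s)⁻¹ k))|) l (𝓝 0) := by
  have h := ((tendsto_avg_ne_mul S s t).comp hi).const_mul 2
  rw [mul_zero] at h
  refine squeeze_zero (fun b => avg_nonneg fun k => abs_nonneg _) (fun b => ?_) h
  rw [← avg_comp_perm (S.σ (i b) (s * t))]
  refine avg_abs_sub_le_of_ne (c b)
    (fun k => (S.σ (i b) (s * t))⁻¹ (S.σ (i b) (s * t) k))
    (fun k => (S.σ (i b) t)⁻¹ ((S.σ (i b) s)⁻¹ (S.σ (i b) (s * t) k))) _ fun k hk => ?_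
  simp only [Equiv.Perm.inv_def, Equiv.symm_apply_apply]
  rw [hk, Equiv.symm_apply_apply, Equiv.symm_apply_apply]

theorem tendsto_avg_inv_one (hi : Tendsto i l atTop) (c : ∀ b, Fin (S.d (i b)) → Seg) :
    Tendsto (fun b => avg fun k => |(c b ((S.σ (i b) 1)⁻¹ k) : ℝ) - c b k|) l (𝓝 0) := by
  have h := ((tendsto_avg_ne_mul S 1 1).comp hi).const_mul 2
  rw [mul_zero] at h
  refine squeeze_zero (fun b => avg_nonneg fun k => abs_nonneg _) (fun b => ?_) h
  refine avg_abs_sub_le_of_ne (c b) (fun k => (S.σ (i b) 1)⁻¹ k) (fun k => k) _ fun k hk => ?_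
  rw [mul_one] at hk
  rw [Equiv.Perm.inv_eq_iff_eq]
  exact (S.σ (i b) 1).injective hk

/-- The point of the cube `[-1, 1]^(G × ℕ)` which records the values along the orbit of `k` under
the approximate action `τ` of a sequence `a` of functions on `Fin d`. -/
def orbit {G : Type*} {d : ℕ} (τ : G → Equiv.Perm (Fin d)) (a : ℕ → Fin d → Seg) (k : Fin d) :
    G × ℕ → Seg :=
  fun j => a j.2 ((τ j.1)⁻¹ k)

/-- The translation `(shift s ω) (t, n) = ω (s t, n)`, which corresponds to the action of `s⁻¹`. -/
def shift (s : G) : C(G × ℕ → Seg, G × ℕ → Seg) :=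
  ⟨fun ω j => ω (s * j.1, j.2), by fun_prop⟩

/-- Moving the base point by `σ s⁻¹` shifts the orbit, up to an error which vanishes in mean. -/
theorem tendsto_avg_orbit_shift (hi : Tendsto i l atTop) (a : ∀ b, ℕ → Fin (S.d (i b)) → Seg)
    (s : G) (u : C(G × ℕ → Seg, ℝ)) :
    Tendsto (fun b => avg fun k => |u (orbit (S.σ (i b)) (a b) ((S.σ (i b) s)⁻¹ k))
      - u (shift s (orbit (S.σ (i b)) (a b) k))|) l (𝓝 0) :=
  tendsto_avg_abs_sub (d := fun b => S.d (i b))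
    (y := fun b k => orbit (S.σ (i b)) (a b) ((S.σ (i b) s)⁻¹ k))
    (y' := fun b k => shift s (orbit (S.σ (i b)) (a b) k)) (fun j => by
      have := tendsto_avg_inv_mul S hi s j.1 fun b => a b j.2
      exact tendsto_avg_abs_symm (f := fun b k => ((a b j.2 ((S.σ (i b) (s * j.1))⁻¹ k) : Seg) : ℝ))
        this) u

end Sofic

/-! ### Bounded functions and their profiles -/

section LinftyLemmas

variable {X : Type*} [MeasurableSpace X] {μ : Measure X}

theorem coeFn_prod_Linfty {ι : Type*} (J : Finset ι) (f : ι → Linfty μ) :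
    ⇑(∏ j ∈ J, f j) =ᵐ[μ] fun x => ∏ j ∈ J, f j x := by
  classical
  induction J using Finset.induction_on with
  | empty => simpa using coeFn_one_Linfty
  | insert a J ha ih =>
    rw [Finset.prod_insert ha]
    filter_upwards [coeFn_mul_Linfty (f a) (∏ j ∈ J, f j), ih] with x h1 h2
    rw [h1, h2, Finset.prod_insert ha]

theorem ae_norm_le_of_norm_le_one {f : Linfty μ} (h : ‖f‖ ≤ 1) : ∀ᵐ x ∂μ, ‖f x‖ ≤ 1 := by
  filter_upwards [ae_le_eLpNormEssSup (f := f) (μ := μ)] with x hx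
  have h1 : eLpNormEssSup f μ ≤ 1 := by
    rw [← eLpNorm_exponent_top, ← Lp.enorm_def, ← ofReal_norm]
    simpa using ENNReal.ofReal_le_ofReal h
  have h2 := hx.trans h1
  rw [← ofReal_norm] at h2
  exact ENNReal.ofReal_le_one.1 h2

theorem ae_eq_ofReal_of_isSelfAdjoint {f : Linfty μ} (h : IsSelfAdjoint f) :
    ∀ᵐ x ∂μ, f x = ((f x).re : ℂ) := by
  have h1 := coeFn_star_Linfty f
  rw [h.star_eq] at h1
  filter_upwards [h1] with x hx
  exact (Complex.conj_eq_iff_re.1 hx.symm).symm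

theorem ae_eq_clamp {f : Linfty μ} (h : IsSelfAdjoint f) (h' : ‖f‖ ≤ 1) :
    ∀ᵐ x ∂μ, f x = ((clamp (f x).re : ℝ) : ℂ) := by
  filter_upwards [ae_norm_le_of_norm_le_one h', ae_eq_ofReal_of_isSelfAdjoint h] with x h1 h2
  rw [coe_clamp ((Complex.abs_re_le_norm _).trans h1), ← h2]

theorem measurable_Linfty (f : Linfty μ) : Measurable f := (Lp.stronglyMeasurable f).measurable

theorem integrable_Linfty [IsFiniteMeasure μ] (f : Linfty μ) : Integrable f μ :=
  (Lp.memLp f).integrable le_top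

end LinftyLemmas

/-- Continuous functions on a cube are determined by monomials: convergence of the averages of
all monomials gives the convergence of the averages of all continuous functions. -/
theorem tendsto_avg_of_monomial {ι X β : Type*} [Countable ι] [MeasurableSpace X] {μ : Measure X}
    [IsProbabilityMeasure μ] {P : X → ι → Seg} (hP : Measurable P) {l : Filter β} {d : β → ℕ}
    (hd : ∀ b, 0 < d b) {y : ∀ b, Fin (d b) → ι → Seg}
    (h : ∀ (j : ℕ) (w : Fin j → ι), 1 ≤ j → Tendsto
      (fun b => avg fun k => ∏ m, (y b k (w m) : ℝ)) l (𝓝 (∫ x, ∏ m, (P x (w m) : ℝ) ∂μ)))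
    (u : C(ι → Seg, ℝ)) :
    Tendsto (fun b => avg fun k => u (y b k)) l (𝓝 (∫ x, u (P x) ∂μ)) := by
  have hint : ∀ v : C(ι → Seg, ℝ), Integrable (fun x => v (P x)) μ := fun v => by
    obtain ⟨M, hM⟩ := isCompact_univ.exists_bound_of_continuousOn (f := v) v.continuous.continuousOn
    exact .of_bound (v.continuous.measurable.comp hP).aestronglyMeasurable M
      (.of_forall fun x => hM _ trivial)
  let Q : Submodule ℝ C(ι → Seg, ℝ) :=
    { carrier := {v | Tendsto (fun b => avg fun k => v (y b k)) l (𝓝 (∫ x, v (P x) ∂μ))}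
      add_mem' := fun {v w} hv hw => by
        have := Tendsto.add hv hw
        rw [← integral_add (hint v) (hint w)] at this
        simp only [Set.mem_ofPred_eq, ContinuousMap.add_apply]
        refine this.congr fun b => ?_
        rw [← avg_add]
      zero_mem' := by simpa [avg] using tendsto_const_nhds
      smul_mem' := fun c v hv => by
        have := Tendsto.const_mul c hv
        rw [← integral_const_mul] at this
        simp only [Set.mem_ofPred_eq, ContinuousMap.smul_apply, smul_eq_mul]
        refine this.congr fun b => ?_
        rw [← avg_const_mul] }
  let c : ι → C(ι → Seg, ℝ) := fun j => ⟨fun ω => (ω j : ℝ), by fun_prop⟩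
  let A : Subalgebra ℝ C(ι → Seg, ℝ) := Algebra.adjoin ℝ (Set.range c)
  have hAQ : ∀ v ∈ A, v ∈ Q := by
    intro v hv
    have hv' : v ∈ Subalgebra.toSubmodule A := hv
    rw [Algebra.adjoin_eq_span] at hv'
    refine (Submodule.span_le (p := Q)).2 (fun m hm => ?_) hv'
    obtain ⟨L, hL, rfl⟩ := Submonoid.exists_list_of_mem_closure hm
    have hL' : ∃ w : Fin L.length → ι, ∀ m, c (w m) = L.get m :=
      ⟨fun m => (hL (L.get m) (L.get_mem m)).choose,
        fun m => (hL (L.get m) (L.get_mem m)).choose_spec⟩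
    obtain ⟨w, hw⟩ := hL'
    have hprod : ∀ ω, L.prod ω = ∏ m, (ω (w m) : ℝ) := fun ω => by
      have : L.prod = ∏ m, c (w m) := by
        simp only [hw]
        rw [← List.prod_ofFn, List.ofFn_get]
      rw [this, ContinuousMap.prod_apply]
      rfl
    change Tendsto _ l (𝓝 _)
    simp only [hprod]
    rcases Nat.eq_zero_or_pos L.length with h0 | h0
    · have : ∀ ω : ι → Seg, ∏ m, (ω (w m) : ℝ) = 1 := fun ω => by
        have : IsEmpty (Fin L.length) := by rw [h0]; infer_instance
        simp
      simpa [this, avg_const (hd _)] using tendsto_const_nhds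
    · exact h _ w h0
  have hAtop : A.topologicalClosure = ⊤ := by
    refine ContinuousMap.subalgebra_topologicalClosure_eq_top_of_separatesPoints A ?_
    intro ω ω' hne
    obtain ⟨j, hj⟩ := Function.ne_iff.1 hne
    exact ⟨c j, ⟨c j, Algebra.subset_adjoin ⟨j, rfl⟩, rfl⟩, fun e => hj (Subtype.ext e)⟩
  have hu : u ∈ closure (A : Set C(ι → Seg, ℝ)) := by
    rw [← Subalgebra.topologicalClosure_coe, hAtop]; trivial
  refine Metric.tendsto_nhds.2 fun η hη => ?_
  obtain ⟨v, hv, huv⟩ := Metric.mem_closure_iff.1 hu (η / 3) (by positivity)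
  have hle : ∀ ω, |u ω - v ω| ≤ η / 3 := fun ω => by
    rw [← Real.dist_eq]
    exact (ContinuousMap.dist_apply_le_dist ω).trans huv.le
  filter_upwards [Metric.tendsto_nhds.1 (hAQ v hv) (η / 3) (by positivity)] with b hb
  rw [Real.dist_eq] at hb ⊢
  have h1 : |avg (fun k => u (y b k)) - avg fun k => v (y b k)| ≤ η / 3 := by
    rw [← avg_sub]
    exact (abs_avg_le _).trans ((avg_mono fun k => hle _).trans (avg_const_le (by positivity)))
  have h2 : |(∫ x, u (P x) ∂μ) - ∫ x, v (P x) ∂μ| ≤ η / 3 := by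
    rw [← integral_sub (hint u) (hint v)]
    refine (norm_integral_le_of_norm_le_const (C := η / 3)
      (.of_forall fun x => (Real.norm_eq_abs _).trans_le (hle (P x)))).trans ?_
    simp
  rw [abs_le] at h1 h2
  rw [abs_lt] at hb ⊢
  constructor <;> linarith [h1.1, h1.2, h2.1, h2.2, hb.1, hb.2]

section Profile

variable {G : Type*} [Group G] {X : Type*} [MeasurableSpace X] [MulAction G X] {μ : Measure X}

/-- The values of the translates of a sequence of bounded functions at a point, as a point of the
cube `[-1, 1]^(G × ℕ)`. -/
def profile (G : Type*) [Group G] [MulAction G X] (p : ℕ → Linfty μ) (x : X) : G × ℕ → Seg :=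
  fun j => clamp (p j.2 (j.1⁻¹ • x)).re

theorem profile_smul (p : ℕ → Linfty μ) (s : G) (x : X) :
    profile G p (s⁻¹ • x) = shift s (profile G p x) := by
  funext j
  simp [profile, shift, mul_smul]

theorem ae_eq_profile {p : ℕ → Linfty μ} (hr : ∀ n, IsSelfAdjoint (p n))
    (hn : ∀ n, ‖p n‖ ≤ 1) (n : ℕ) :
    ⇑(p n) =ᵐ[μ] fun x => ((profile G p x (1, n) : ℝ) : ℂ) := by
  filter_upwards [ae_eq_clamp (hr n) (hn n)] with x h
  simpa [profile] using h

theorem measurable_profile [MeasurableConstSMul G X] (p : ℕ → Linfty μ) :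
    Measurable (profile G p) :=
  measurable_pi_iff.2 fun j => continuous_clamp.measurable.comp (Complex.measurable_re.comp
    ((measurable_Linfty (p j.2)).comp (measurable_const_smul _)))

variable [MeasurableConstSMul G X]

theorem measurable_comp_profile [Countable G] {E : Type*} [TopologicalSpace E] [MeasurableSpace E]
    [BorelSpace E] (p : ℕ → Linfty μ) (u : C(G × ℕ → Seg, E)) :
    Measurable fun x => u (profile G p x) :=
  u.continuous.measurable.comp (measurable_profile p)

theorem integrable_comp_profile [Countable G] [IsFiniteMeasure μ] (p : ℕ → Linfty μ)
    (u : C(G × ℕ → Seg, ℝ)) : Integrable (fun x => u (profile G p x)) μ := by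
  obtain ⟨M, hM⟩ := isCompact_univ.exists_bound_of_continuousOn (f := u) u.continuous.continuousOn
  exact .of_bound (measurable_comp_profile p u).aestronglyMeasurable M
    (.of_forall fun x => hM _ trivial)

variable [SMulInvariantMeasure G X μ]

theorem coeFn_actL (s : G) (f : Linfty μ) : ⇑(actL s f) =ᵐ[μ] fun x => f (s⁻¹ • x) :=
  Lp.coeFn_compMeasurePreserving f (measurePreserving_smul s⁻¹ μ)

theorem actL_ae_eq_profile {p : ℕ → Linfty μ} (hr : ∀ n, IsSelfAdjoint (p n))
    (hn : ∀ n, ‖p n‖ ≤ 1) (s : G) (n : ℕ) :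
    ⇑(actL s (p n)) =ᵐ[μ] fun x => ((profile G p x (s, n) : ℝ) : ℂ) := by
  filter_upwards [coeFn_actL s (p n), (measurePreserving_smul s⁻¹ μ).quasiMeasurePreserving.ae
    (ae_eq_clamp (hr n) (hn n))] with x h1 h2
  rw [h1, h2]
  rfl

theorem prod_actL_ae_eq_profile {p : ℕ → Linfty μ} (hr : ∀ n, IsSelfAdjoint (p n))
    (hn : ∀ n, ‖p n‖ ≤ 1) {j : ℕ} (s : Fin j → G) (n : Fin j → ℕ) :
    ⇑(∏ k, actL (s k) (p (n k))) =ᵐ[μ]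
      fun x => ((∏ k, (profile G p x (s k, n k) : ℝ) : ℝ) : ℂ) := by
  have h : ∀ᵐ x ∂μ, ∀ k, actL (s k) (p (n k)) x = ((profile G p x (s k, n k) : ℝ) : ℂ) :=
    ae_all_iff.2 fun k => actL_ae_eq_profile hr hn (s k) (n k)
  filter_upwards [coeFn_prod_Linfty Finset.univ fun k => actL (s k) (p (n k)), h] with x h1 h2
  rw [h1, Complex.ofReal_prod]
  exact Finset.prod_congr rfl fun k _ => h2 k

end Profile

/-! ### The filter of microstates -/

section Micro

variable {G : Type*} [Group G] (S : SoficApproximation G)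

/-- The filter of microstates: sequences of functions `Fin (d i) → [-1, 1]` for which the
distribution of the orbits in the cube `[-1, 1]^(G × ℕ)` converges to `ν` as `i → ∞`. -/
def microFilter (ν : C(G × ℕ → Seg, ℝ) → ℝ) : Filter (Σ i, ℕ → Fin (S.d i) → Seg) :=
  comap Sigma.fst atTop ⊓ ⨅ u : C(G × ℕ → Seg, ℝ),
    comap (fun z => avg fun k => u (orbit (S.σ z.1) z.2 k)) (𝓝 (ν u))

/-- The entropy computed from microstates. -/
def microEntropy (ν : C(G × ℕ → Seg, ℝ) → ℝ) : EReal :=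
  filterEntropy S (microFilter S ν) fun _ => seqDist

variable {S} {ν : C(G × ℕ → Seg, ℝ) → ℝ}

theorem tendsto_fst_microFilter : Tendsto Sigma.fst (microFilter S ν) atTop :=
  tendsto_comap.mono_left inf_le_left

theorem tendsto_avg_microFilter (u : C(G × ℕ → Seg, ℝ)) :
    Tendsto (fun z : Σ i, ℕ → Fin (S.d i) → Seg => avg fun k => u (orbit (S.σ z.1) z.2 k))
      (microFilter S ν) (𝓝 (ν u)) :=
  tendsto_comap.mono_left (inf_le_right.trans (iInf_le _ u))

theorem tendsto_microFilter {β : Type*} {l : Filter β} {T : β → Σ i, ℕ → Fin (S.d i) → Seg} :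
    Tendsto T l (microFilter S ν) ↔ Tendsto (fun b => (T b).1) l atTop ∧
      ∀ u : C(G × ℕ → Seg, ℝ),
        Tendsto (fun b => avg fun k => u (orbit (S.σ (T b).1) (T b).2 k)) l (𝓝 (ν u)) := by
  simp only [microFilter, tendsto_inf, tendsto_iInf, tendsto_comap_iff, Function.comp_def]

end Micro

/-! ### From positive maps to microstates -/

section UP

variable {G : Type*} [Group G] {X : Type*} [MeasurableSpace X] [MulAction G X] {μ : Measure X}

/-- A unital positive map sends functions with values in `[-1, 1]` to functions with values in
`[-1, 1]`. -/
theorem map_eq_clamp {d : ℕ} {φ : Linfty μ →ₗ[ℂ] (Fin d → ℂ)} (hone : φ 1 = 1)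
    (hpos : ∀ f : Linfty μ, (∀ᵐ x ∂μ, 0 ≤ f x) → ∀ k, 0 ≤ φ f k) {f : Linfty μ} {g : X → Seg}
    (hf : ⇑f =ᵐ[μ] fun x => ((g x : ℝ) : ℂ)) (k : Fin d) :
    φ f k = ((clamp (φ f k).re : ℝ) : ℂ) := by
  have h1 := hpos (1 - f) (by
    filter_upwards [Lp.coeFn_sub 1 f, coeFn_one_Linfty (μ := μ), hf] with x h1 h2 h3
    rw [h1, Pi.sub_apply, h2, h3, ← Complex.ofReal_one, ← Complex.ofReal_sub,
      Complex.zero_le_real]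
    linarith [(g x).2.2]) k
  have h2 := hpos (1 + f) (by
    filter_upwards [Lp.coeFn_add 1 f, coeFn_one_Linfty (μ := μ), hf] with x h1 h2 h3
    rw [h1, Pi.add_apply, h2, h3, ← Complex.ofReal_one, ← Complex.ofReal_add,
      Complex.zero_le_real]
    linarith [(g x).2.1]) k
  rw [map_sub, hone, Complex.nonneg_iff] at h1
  rw [map_add, hone, Complex.nonneg_iff] at h2
  simp only [Pi.sub_apply, Pi.one_apply, Complex.sub_re, Complex.one_re, Complex.sub_im,
    Complex.one_im] at h1
  simp only [Pi.add_apply, Pi.one_apply, Complex.add_re, Complex.one_re] at h2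
  have h3 : |(φ f k).re| ≤ 1 := abs_le.2 ⟨by linarith [h2.1], by linarith [h1.1]⟩
  rw [coe_clamp h3]
  exact Complex.ext rfl (by simpa using h1.2)

theorem abs_clamp_re_sub_le (z w : ℂ) : |(clamp z.re : ℝ) - clamp w.re| ≤ ‖z - w‖ :=
  (abs_clamp_sub_le _ _).trans ((Complex.sub_re z w).symm ▸ Complex.abs_re_le_norm (z - w))

theorem norm_unif_le {d : ℕ} (f : Fin d → ℂ) : ‖unif f‖ ≤ avg fun k => ‖f k‖ := by
  rw [unif, avg, norm_mul, norm_inv, Complex.norm_natCast]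
  exact mul_le_mul_of_nonneg_left (norm_sum_le _ _) (by positivity)

theorem unif_sub {d : ℕ} (f g : Fin d → ℂ) : unif (f - g) = unif f - unif g := by
  simp [unif, Finset.sum_sub_distrib, mul_sub]

theorem unif_ofReal {d : ℕ} (f : Fin d → ℝ) : unif (fun k => (f k : ℂ)) = (avg f : ℂ) := by
  simp [unif, avg]

variable [MeasurableConstSMul G X] [SMulInvariantMeasure G X μ]

theorem IsUP.mono {p : ℕ → Linfty μ} {F F' : Finset G} {m m' : ℕ} {δ δ' : ℝ} {d : ℕ}
    {σ : G → Equiv.Perm (Fin d)} {φ : Linfty μ →ₗ[ℂ] (Fin d → ℂ)} (h : IsUP p F' m' δ' σ φ)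
    (hF : F ⊆ F') (hm : m ≤ m') (hδ : δ' ≤ δ) : IsUP p F m δ σ φ where
  map_one := h.map_one
  positive := h.positive
  mult j h1 h2 s n hs hn :=
    (h.mult j h1 (h2.trans hm) s n (fun k => hF (hs k)) fun k => (hn k).trans_le hm).trans_le hδ
  measure j h1 h2 s n hs hn :=
    (h.measure j h1 (h2.trans hm) s n (fun k => hF (hs k)) fun k => (hn k).trans_le hm).trans_le hδ
  equivariant s hs n hn := (h.equivariant s (hF hs) n (hn.trans_le hm)).trans_le hδ

/-- The parameters `(F, m, δ)` of the sets `UP_μ(S, F, m, δ, σ)`. -/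
abbrev UPParam (G : Type*) : Type _ :=
  {x : Finset G × ℕ × ℝ // x.1.Nonempty ∧ 1 ≤ x.2.1 ∧ 0 < x.2.2}

instance : Nonempty (UPParam G) := ⟨⟨({1}, 1, 1), by simp⟩⟩

/-- The sets `UP_μ(S, F, m, δ, σ_i)`, as a subset of the disjoint union over `i`. -/
def upSet (S : SoficApproximation G) (p : ℕ → Linfty μ) (x : UPParam G) :
    Set (Σ i, Linfty μ →ₗ[ℂ] (Fin (S.d i) → ℂ)) :=
  {z | IsUP p x.1.1 x.1.2.1 x.1.2.2 (S.σ z.1) z.2}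

theorem directed_upSet (S : SoficApproximation G) (p : ℕ → Linfty μ) :
    Directed (· ⊇ ·) (upSet S p) := by
  classical
  intro x y
  refine ⟨⟨(x.1.1 ∪ y.1.1, max x.1.2.1 y.1.2.1, min x.1.2.2 y.1.2.2),
    x.2.1.mono Finset.subset_union_left, x.2.2.1.trans (le_max_left _ _),
    lt_min x.2.2.2 y.2.2.2⟩, fun z hz => ?_, fun z hz => ?_⟩
  · exact IsUP.mono hz Finset.subset_union_left (le_max_left _ _) (min_le_left _ _)
  · exact IsUP.mono hz Finset.subset_union_right (le_max_right _ _) (min_le_right _ _)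

/-- The measure entropy is the entropy of the filter of approximately multiplicative,
measure-preserving and equivariant positive maps. -/
theorem measureEntropySeq_eq (S : SoficApproximation G) (p : ℕ → Linfty μ) :
    measureEntropySeq S p =
      filterEntropy S (limitFilter (upSet S p)) fun _ φ ψ => rho p φ ψ := by
  refine iSup_congr fun ε => iSup_congr fun _ => ?_
  rw [entropyAt_limitFilter (directed_upSet S p)]
  refine le_antisymm (le_iInf fun x => ?_) (le_iInf₂ fun F hF => le_iInf₂ fun m hm =>
    le_iInf₂ fun δ hδ => ?_)
  · exact iInf₂_le_of_le x.1.1 x.2.1 (iInf₂_le_of_le x.1.2.1 x.2.2.1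
      (iInf₂_le_of_le x.1.2.2 x.2.2.2 le_rfl))
  · exact iInf_le_of_le ⟨(F, m, δ), hF, hm, hδ⟩ le_rfl

variable {S : SoficApproximation G} {p : ℕ → Linfty μ}

/-- The values of a map `L^∞ → ℂ^d` on the sequence `p`, truncated to `[-1, 1]`. -/
def valuesL (p : ℕ → Linfty μ) {d : ℕ} (φ : Linfty μ →ₗ[ℂ] (Fin d → ℂ)) : ℕ → Fin d → Seg :=
  fun n k => clamp (φ (p n) k).re

theorem rho_eq_seqDist_valuesL (hr : ∀ n, IsSelfAdjoint (p n)) (hn : ∀ n, ‖p n‖ ≤ 1) {d : ℕ}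
    {φ ψ : Linfty μ →ₗ[ℂ] (Fin d → ℂ)} (hφ : φ 1 = 1)
    (hφ' : ∀ f : Linfty μ, (∀ᵐ x ∂μ, 0 ≤ f x) → ∀ k, 0 ≤ φ f k) (hψ : ψ 1 = 1)
    (hψ' : ∀ f : Linfty μ, (∀ᵐ x ∂μ, 0 ≤ f x) → ∀ k, 0 ≤ ψ f k) :
    rho p φ ψ = seqDist (valuesL p φ) (valuesL p ψ) := by
  refine tsum_congr fun n => ?_
  congr 2
  funext k
  have h := ae_eq_clamp (hr n) (hn n)
  exact congrArg₂ (fun a b : ℂ => a - b) (map_eq_clamp hφ hφ' h k) (map_eq_clamp hψ hψ' h k)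

theorem eventually_isUP (F : Finset G) (m : ℕ) {δ : ℝ} (hδ : 0 < δ) :
    ∀ᶠ z in limitFilter (upSet S p), IsUP p F m δ (S.σ z.1) z.2 := by
  classical
  have := mem_limitFilter_of_mem (D := upSet S p) ⟨(insert 1 F, max m 1, δ),
    Finset.insert_nonempty _ _, le_max_right _ _, hδ⟩
  filter_upwards [this] with z hz
  exact IsUP.mono hz (Finset.subset_insert _ _) (le_max_left _ _) le_rfl

theorem tendsto_zero_of_forall_eventually_lt {β : Type*} {l : Filter β} {f : β → ℝ}
    (h0 : ∀ b, 0 ≤ f b) (h : ∀ δ > 0, ∀ᶠ b in l, f b < δ) : Tendsto f l (𝓝 0) :=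
  tendsto_order.2 ⟨fun _ ha => .of_forall fun b => ha.trans_le (h0 b), h⟩

/-- The values on `p` of approximately multiplicative, measure-preserving and equivariant maps are
microstates. -/
theorem tendsto_valuesL [Countable G] [IsProbabilityMeasure μ] (hr : ∀ n, IsSelfAdjoint (p n))
    (hn : ∀ n, ‖p n‖ ≤ 1) :
    Tendsto (fun z => (⟨z.1, valuesL p z.2⟩ : Σ i, ℕ → Fin (S.d i) → Seg))
      (limitFilter (upSet S p)) (microFilter S fun u => ∫ x, u (profile G p x) ∂μ) := by
  refine tendsto_microFilter.2 ⟨tendsto_fst_limitFilter, fun u => ?_⟩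
  set l := limitFilter (upSet S p)
  let y : ∀ z : Σ i, Linfty μ →ₗ[ℂ] (Fin (S.d i) → ℂ), Fin (S.d z.1) → G × ℕ → Seg :=
    fun z k j => clamp (z.2 (actL j.1 (p j.2)) k).re
  have h1 : Tendsto (fun z => avg fun k => |u (orbit (S.σ z.1) (valuesL p z.2) k) - u (y z k)|)
      l (𝓝 0) := by
    refine tendsto_avg_abs_sub (d := fun z : Σ i, Linfty μ →ₗ[ℂ] (Fin (S.d i) → ℂ) => S.d z.1)
      (y := fun z => orbit (S.σ z.1) (valuesL p z.2)) (y' := y) (fun j => ?_) u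
    refine tendsto_zero_of_forall_eventually_lt (fun z => avg_nonneg fun k => abs_nonneg _)
      fun δ hδ => ?_
    filter_upwards [eventually_isUP {j.1} (j.2 + 1) hδ] with z hz
    refine lt_of_le_of_lt ?_ (hz.equivariant j.1 (by simp) j.2 (by simp))
    refine (avg_mono fun k => ?_).trans (avg_norm_le_norm2 _)
    rw [abs_sub_comm]
    exact abs_clamp_re_sub_le _ _
  have h2 : Tendsto (fun z => avg fun k => u (y z k)) l (𝓝 (∫ x, u (profile G p x) ∂μ)) := by
    refine tendsto_avg_of_monomial (d := fun z : Σ i, Linfty μ →ₗ[ℂ] (Fin (S.d i) → ℂ) => S.d z.1)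
      (y := y) (measurable_profile p) (fun z => S.d_pos z.1) (fun j w hj => ?_) u
    refine tendsto_iff_dist_tendsto_zero.2 (tendsto_zero_of_forall_eventually_lt
      (fun z => dist_nonneg) fun δ hδ => ?_)
    classical
    filter_upwards [eventually_isUP (p := p) (Finset.univ.image fun k => (w k).1)
      (j + ∑ k, ((w k).2 + 1)) (half_pos hδ)] with z hz
    have hF : ∀ k, (w k).1 ∈ Finset.univ.image fun k => (w k).1 := fun k =>
      Finset.mem_image_of_mem _ (Finset.mem_univ k)
    have hm : ∀ k, (w k).2 < j + ∑ k, ((w k).2 + 1) := fun k => by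
      have := Finset.single_le_sum (f := fun k => (w k).2 + 1) (fun _ _ => Nat.zero_le _)
        (Finset.mem_univ k)
      omega
    have e1 := hz.mult j hj (Nat.le_add_right _ _) (fun k => (w k).1) (fun k => (w k).2) hF hm
    have e2 := hz.measure j hj (Nat.le_add_right _ _) (fun k => (w k).1) (fun k => (w k).2) hF hm
    have e3 : (∏ k, z.2 (actL (w k).1 (p (w k).2))) =
        fun k => ((∏ m, (y z k (w m) : ℝ) : ℝ) : ℂ) := by
      funext k
      rw [Finset.prod_apply, Complex.ofReal_prod]
      exact Finset.prod_congr rfl fun m _ =>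
        map_eq_clamp hz.map_one hz.positive (actL_ae_eq_profile hr hn (w m).1 (w m).2) k
    rw [integral_congr_ae (prod_actL_ae_eq_profile hr hn _ _), integral_complex_ofReal] at e2
    rw [e3] at e1
    have e4 := (norm_unif_le _).trans_lt ((avg_norm_le_norm2 _).trans_lt e1)
    rw [unif_sub, unif_ofReal] at e4
    rw [Real.dist_eq, ← Real.norm_eq_abs, ← Complex.norm_real, Complex.ofReal_sub,
      ← dist_eq_norm]
    rw [← dist_eq_norm, dist_comm] at e4
    rw [← dist_eq_norm] at e2
    calc _ ≤ _ := dist_triangle _ _ _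
      _ < δ / 2 + δ / 2 := add_lt_add e4 e2
      _ = δ := add_halves δ
  have h3 := (tendsto_avg_sub_avg h1).add h2
  simpa using h3

theorem measureEntropySeq_le_microEntropy [Countable G] [IsProbabilityMeasure μ]
    (hr : ∀ n, IsSelfAdjoint (p n)) (hn : ∀ n, ‖p n‖ ≤ 1) :
    measureEntropySeq S p ≤ microEntropy S fun u => ∫ x, u (profile G p x) ∂μ := by
  rw [measureEntropySeq_eq]
  refine iSup₂_mono fun ε hε => entropyAt_le_of_tendsto hε (fun _ => seqDist_self)
    (fun i => valuesL p) (tendsto_valuesL hr hn) (eventually_isUP ∅ 0 one_pos)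
    fun i φ ψ hφ hψ => rho_eq_seqDist_valuesL hr hn hφ.map_one hφ.positive hψ.map_one hψ.positive

end UP

/-! ### From microstates to positive maps -/

theorem norm_prod_sub_prod_le_sum {ι 𝕜 : Type*} [NormedField 𝕜] (J : Finset ι) {f g : ι → 𝕜}
    (hf : ∀ j, ‖f j‖ ≤ 1) (hg : ∀ j, ‖g j‖ ≤ 1) :
    ‖∏ j ∈ J, f j - ∏ j ∈ J, g j‖ ≤ ∑ j ∈ J, ‖f j - g j‖ := by
  classical
  induction J using Finset.induction_on with
  | empty => simp
  | insert a J ha ih =>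
    rw [Finset.prod_insert ha, Finset.prod_insert ha, Finset.sum_insert ha,
      show f a * ∏ j ∈ J, f j - g a * ∏ j ∈ J, g j =
        (f a - g a) * ∏ j ∈ J, f j + g a * (∏ j ∈ J, f j - ∏ j ∈ J, g j) by ring]
    refine (norm_add_le _ _).trans ?_
    rw [norm_mul, norm_mul, norm_prod]
    have h1 : ∏ j ∈ J, ‖f j‖ ≤ 1 := Finset.prod_le_one (fun j _ => norm_nonneg _) fun j _ => hf j
    have h2 := mul_le_mul_of_nonneg_left h1 (norm_nonneg (f a - g a))
    have h3 := mul_le_mul_of_nonneg_right (hg a) (norm_nonneg (∏ j ∈ J, f j - ∏ j ∈ J, g j))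
    linarith

/-- Partitions of unity on a cube such that finitely many given coordinates hardly vary on the
support of each function. -/
theorem exists_partition {ι : Type*} (J : Finset ι) {η : ℝ} (hη : 0 < η) :
    ∃ (n : ℕ) (H : Fin n → C(ι → Seg, ℝ)), (∀ t ω, 0 ≤ H t ω) ∧ (∀ ω, ∑ t, H t ω = 1) ∧
      ∀ t ω ω', H t ω ≠ 0 → H t ω' ≠ 0 → ∀ j ∈ J, |(ω j : ℝ) - ω' j| ≤ η := by
  let O : (ι → Seg) → Set (ι → Seg) := fun c => ⋂ j ∈ J, {ω | |(ω j : ℝ) - c j| < η / 2}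
  have hO : ∀ c, IsOpen (O c) := fun c => isOpen_biInter_finset fun j _ =>
    isOpen_lt (by fun_prop) continuous_const
  have hc : ∀ c, c ∈ O c := fun c => Set.mem_iInter₂.2 fun j _ => by
    simp only [Set.mem_ofPred_eq, sub_self, abs_zero]
    positivity
  obtain ⟨T, -, hT⟩ := isCompact_univ.elim_nhds_subcover O fun c _ => (hO c).mem_nhds (hc c)
  obtain ⟨H, hsub, hone, h01, -⟩ := exists_continuous_sum_one_of_isOpen_isCompact
    (s := fun t : Fin T.card => O (T.equivFin.symm t)) (fun t => hO _) isCompact_univ (by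
      intro ω hω
      obtain ⟨c, hcT, hωc⟩ := Set.mem_iUnion₂.1 (hT hω)
      exact Set.mem_iUnion.2 ⟨T.equivFin ⟨c, hcT⟩, by simpa using hωc⟩)
  refine ⟨T.card, H, fun t ω => (h01 t ω).1, fun ω => ?_, fun t ω ω' h1 h2 j hj => ?_⟩
  · have := hone (Set.mem_univ ω)
    simpa using this
  · have e1 := Set.mem_iInter₂.1 (hsub t (subset_tsupport _ h1)) j hj
    have e2 := Set.mem_iInter₂.1 (hsub t (subset_tsupport _ h2)) j hj
    simp only [Set.mem_ofPred_eq, abs_lt] at e1 e2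
    rw [abs_le]
    constructor <;> linarith [e1.1, e1.2, e2.1, e2.2]

section NullPart

variable {G : Type*} [Group G] {X : Type*} [MeasurableSpace X] [MulAction G X] {μ : Measure X}

/-- The sum of those members of a family of functions on the cube which vanish almost everywhere
with respect to the distribution of the profile map. -/
def nullPart (p : ℕ → Linfty μ) {n : ℕ} (H : Fin n → C(G × ℕ → Seg, ℝ)) : C(G × ℕ → Seg, ℝ) :=
  ∑ t, if ∫ x, H t (profile G p x) ∂μ = 0 then H t else 0

theorem nullPart_nonneg {p : ℕ → Linfty μ} {n : ℕ} {H : Fin n → C(G × ℕ → Seg, ℝ)}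
    (hH : ∀ t ω, 0 ≤ H t ω) (ω : G × ℕ → Seg) : 0 ≤ nullPart p H ω := by
  rw [nullPart, ContinuousMap.sum_apply]
  refine Finset.sum_nonneg fun t _ => ?_
  split_ifs
  · exact hH t ω
  · simp

end NullPart

section MicroMap

variable {G : Type*} [Group G] [Countable G] {X : Type*} [MeasurableSpace X] [MulAction G X]
  [MeasurableConstSMul G X] {μ : Measure X} [IsProbabilityMeasure μ]

theorem integrable_profile_mul (p : ℕ → Linfty μ) (H : C(G × ℕ → Seg, ℝ)) (f : Linfty μ) :
    Integrable (fun x => (H (profile G p x) : ℂ) * f x) μ := by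
  obtain ⟨M, hM⟩ := isCompact_univ.exists_bound_of_continuousOn (f := H) H.continuous.continuousOn
  refine (integrable_Linfty f).bdd_mul (c := M)
    (Complex.measurable_ofReal.comp (measurable_comp_profile p H)).aestronglyMeasurable
    (.of_forall fun x => ?_)
  rw [Complex.norm_real]
  exact hM _ trivial

/-- Integration against the density `H ∘ P`, where `P` is the profile map. -/
def profileIntegral (p : ℕ → Linfty μ) (H : C(G × ℕ → Seg, ℝ)) : Linfty μ →ₗ[ℂ] ℂ where
  toFun f := ∫ x, (H (profile G p x) : ℂ) * f x ∂μ
  map_add' f g := by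
    rw [← integral_add (integrable_profile_mul p H f) (integrable_profile_mul p H g)]
    refine integral_congr_ae ?_
    filter_upwards [Lp.coeFn_add f g] with x hx
    rw [hx, Pi.add_apply, mul_add]
  map_smul' c f := by
    rw [RingHom.id_apply, smul_eq_mul, ← integral_const_mul]
    refine integral_congr_ae ?_
    filter_upwards [Lp.coeFn_smul c f] with x hx
    rw [hx, Pi.smul_apply, smul_eq_mul]
    ring

/-- The normalised integral against `H ∘ P`; for a density which vanishes almost everywhere it is
replaced by the integral, so that the result is always a state. -/
def profileAvg (p : ℕ → Linfty μ) (H : C(G × ℕ → Seg, ℝ)) : Linfty μ →ₗ[ℂ] ℂ :=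
  if ∫ x, H (profile G p x) ∂μ = 0 then profileIntegral p (1 : C(G × ℕ → Seg, ℝ))
  else ((∫ x, H (profile G p x) ∂μ : ℝ) : ℂ)⁻¹ • profileIntegral p H

theorem profileIntegral_of_ae_eq {p : ℕ → Linfty μ} (H : C(G × ℕ → Seg, ℝ)) {f : Linfty μ}
    {u : C(G × ℕ → Seg, ℝ)} (hf : ⇑f =ᵐ[μ] fun x => (u (profile G p x) : ℂ)) :
    profileIntegral p H f = ((∫ x, H (profile G p x) * u (profile G p x) ∂μ : ℝ) : ℂ) := by
  rw [← integral_complex_ofReal]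
  refine integral_congr_ae ?_
  filter_upwards [hf] with x hx
  rw [hx, Complex.ofReal_mul]

theorem profileAvg_one (p : ℕ → Linfty μ) (H : C(G × ℕ → Seg, ℝ)) : profileAvg p H 1 = 1 := by
  have h1 : ⇑(1 : Linfty μ) =ᵐ[μ] fun x => ((1 : C(G × ℕ → Seg, ℝ)) (profile G p x) : ℂ) := by
    filter_upwards [coeFn_one_Linfty (μ := μ)] with x hx
    simp [hx]
  rw [profileAvg]
  split_ifs with h
  · rw [profileIntegral_of_ae_eq _ h1]
    simp
  · rw [LinearMap.smul_apply, profileIntegral_of_ae_eq _ h1]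
    simp only [ContinuousMap.one_apply, mul_one, smul_eq_mul]
    exact inv_mul_cancel₀ (Complex.ofReal_ne_zero.2 h)

theorem profileIntegral_nonneg (p : ℕ → Linfty μ) {H : C(G × ℕ → Seg, ℝ)} (hH : ∀ ω, 0 ≤ H ω)
    {f : Linfty μ} (hf : ∀ᵐ x ∂μ, 0 ≤ f x) : 0 ≤ profileIntegral p H f := by
  have h1 : ∀ᵐ x ∂μ, (H (profile G p x) : ℂ) * f x =
      ((H (profile G p x) * (f x).re : ℝ) : ℂ) := by
    filter_upwards [hf] with x hx
    rw [Complex.ofReal_mul]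
    congr 1
    exact Complex.ext rfl (by simpa using (Complex.nonneg_iff.1 hx).2.symm)
  change 0 ≤ ∫ x, (H (profile G p x) : ℂ) * f x ∂μ
  rw [integral_congr_ae h1, integral_complex_ofReal, Complex.zero_le_real]
  refine integral_nonneg_of_ae ?_
  filter_upwards [hf] with x hx
  exact mul_nonneg (hH _) (Complex.nonneg_iff.1 hx).1

theorem profileAvg_nonneg (p : ℕ → Linfty μ) {H : C(G × ℕ → Seg, ℝ)} (hH : ∀ ω, 0 ≤ H ω)
    {f : Linfty μ} (hf : ∀ᵐ x ∂μ, 0 ≤ f x) : 0 ≤ profileAvg p H f := by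
  rw [profileAvg]
  split_ifs with h
  · exact profileIntegral_nonneg p (fun ω => by simp) hf
  · rw [LinearMap.smul_apply, smul_eq_mul, ← Complex.ofReal_inv]
    exact mul_nonneg (Complex.zero_le_real.2 (inv_nonneg.2 (integral_nonneg fun x => hH _)))
      (profileIntegral_nonneg p hH hf)

/-- If `u` is within `η` of `v` on the support of the density, so is its normalised integral. -/
theorem norm_profileAvg_sub_le {p : ℕ → Linfty μ} {H : C(G × ℕ → Seg, ℝ)} (hH : ∀ ω, 0 ≤ H ω)
    {f : Linfty μ} {u : C(G × ℕ → Seg, ℝ)} (hf : ⇑f =ᵐ[μ] fun x => (u (profile G p x) : ℂ))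
    {v η : ℝ} (hv : ∀ ω, H ω ≠ 0 → |u ω - v| ≤ η) (h0 : ∫ x, H (profile G p x) ∂μ ≠ 0) :
    ‖profileAvg p H f - v‖ ≤ η := by
  set c := ∫ x, H (profile G p x) ∂μ with hc
  have hc0 : 0 < c := lt_of_le_of_ne (integral_nonneg fun x => hH _) (Ne.symm h0)
  have h1 : profileAvg p H f = ((c⁻¹ * ∫ x, H (profile G p x) * u (profile G p x) ∂μ : ℝ) : ℂ) := by
    rw [profileAvg, if_neg h0, LinearMap.smul_apply, profileIntegral_of_ae_eq H hf, smul_eq_mul,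
      Complex.ofReal_mul, Complex.ofReal_inv]
  have hHu : Integrable (fun x => H (profile G p x) * u (profile G p x)) μ :=
    integrable_comp_profile p (H * u)
  have hHi : Integrable (fun x => H (profile G p x)) μ := integrable_comp_profile p H
  have h2 : |(∫ x, H (profile G p x) * u (profile G p x) ∂μ) - c * v| ≤ η * c := by
    rw [hc, ← integral_mul_const, ← integral_sub hHu (hHi.mul_const v), ← integral_const_mul,
      ← Real.norm_eq_abs]
    refine norm_integral_le_of_norm_le (hHi.const_mul η) (.of_forall fun x => ?_)
    rw [← mul_sub, Real.norm_eq_abs, abs_mul, abs_of_nonneg (hH _), mul_comm]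
    by_cases hx : H (profile G p x) = 0
    · simp [hx]
    · exact mul_le_mul_of_nonneg_right (hv _ hx) (hH _)
  rw [h1, ← Complex.ofReal_sub, Complex.norm_real, Real.norm_eq_abs,
    show c⁻¹ * (∫ x, H (profile G p x) * u (profile G p x) ∂μ) - v =
      c⁻¹ * ((∫ x, H (profile G p x) * u (profile G p x) ∂μ) - c * v) by field_simp,
    abs_mul, abs_of_pos (inv_pos.2 hc0), inv_mul_le_iff₀ hc0, mul_comm c η]
  exact h2

/-- The positive map associated with a partition of unity `H` on the cube and a microstate: the
conditional expectation of `f` along `H`, evaluated at the orbits of the microstate. -/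
def microMap (p : ℕ → Linfty μ) {n : ℕ} (H : Fin n → C(G × ℕ → Seg, ℝ)) {d : ℕ}
    (τ : G → Equiv.Perm (Fin d)) (a : ℕ → Fin d → Seg) : Linfty μ →ₗ[ℂ] (Fin d → ℂ) :=
  LinearMap.pi fun k => ∑ t, (H t (orbit τ a k) : ℂ) • profileAvg p (H t)

theorem microMap_apply (p : ℕ → Linfty μ) {n : ℕ} (H : Fin n → C(G × ℕ → Seg, ℝ)) {d : ℕ}
    (τ : G → Equiv.Perm (Fin d)) (a : ℕ → Fin d → Seg) (f : Linfty μ) (k : Fin d) :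
    microMap p H τ a f k = ∑ t, (H t (orbit τ a k) : ℂ) * profileAvg p (H t) f := by
  simp [microMap]

theorem integral_nullPart (p : ℕ → Linfty μ) {n : ℕ} (H : Fin n → C(G × ℕ → Seg, ℝ)) :
    ∫ x, nullPart p H (profile G p x) ∂μ = 0 := by
  simp only [nullPart, ContinuousMap.sum_apply]
  rw [integral_finsetSum _ fun t _ => integrable_comp_profile p _]
  refine Finset.sum_eq_zero fun t _ => ?_
  split_ifs with h
  · exact h
  · simp

variable {p : ℕ → Linfty μ} {n : ℕ} {H : Fin n → C(G × ℕ → Seg, ℝ)}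

theorem microMap_one (h1 : ∀ ω, ∑ t, H t ω = 1) {d : ℕ} (τ : G → Equiv.Perm (Fin d))
    (a : ℕ → Fin d → Seg) : microMap p H τ a 1 = 1 := by
  funext k
  simp only [microMap_apply, profileAvg_one, mul_one, Pi.one_apply]
  rw [← Complex.ofReal_sum, h1, Complex.ofReal_one]

theorem microMap_nonneg (hH : ∀ t ω, 0 ≤ H t ω) {d : ℕ} (τ : G → Equiv.Perm (Fin d))
    (a : ℕ → Fin d → Seg) (f : Linfty μ) (hf : ∀ᵐ x ∂μ, 0 ≤ f x) (k : Fin d) :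
    0 ≤ microMap p H τ a f k := by
  rw [microMap_apply]
  exact Finset.sum_nonneg fun t _ =>
    mul_nonneg (Complex.zero_le_real.2 (hH t _)) (profileAvg_nonneg p (hH t) hf)

/-- If `u` oscillates by at most `η` on the supports of the partition of unity, then the positive
map of a microstate sends `u ∘ P`, for the profile map `P`, to the values of `u` along the
microstate, up to `η` and the contribution of the null members of the partition. -/
theorem norm_microMap_sub_le (hH : ∀ t ω, 0 ≤ H t ω) (h1 : ∀ ω, ∑ t, H t ω = 1) {f : Linfty μ}
    {u : C(G × ℕ → Seg, ℝ)} (hf : ⇑f =ᵐ[μ] fun x => (u (profile G p x) : ℂ))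
    (hu : ∀ ω, |u ω| ≤ 1) {η : ℝ} (hη : ∀ t ω ω', H t ω ≠ 0 → H t ω' ≠ 0 → |u ω - u ω'| ≤ η)
    {d : ℕ} (τ : G → Equiv.Perm (Fin d)) (a : ℕ → Fin d → Seg) (k : Fin d) :
    ‖microMap p H τ a f k - u (orbit τ a k)‖ ≤ η + 2 * nullPart p H (orbit τ a k) := by
  set ω := orbit τ a k
  have e1 : microMap p H τ a f k - u ω = ∑ t, (H t ω : ℂ) * (profileAvg p (H t) f - u ω) := by
    simp only [mul_sub, Finset.sum_sub_distrib, ← Finset.sum_mul]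
    rw [← Complex.ofReal_sum, h1, microMap_apply, Complex.ofReal_one, one_mul]
  have e2 : η + 2 * nullPart p H ω = ∑ t, (H t ω * η +
      2 * (if ∫ x, H t (profile G p x) ∂μ = 0 then H t else 0) ω) := by
    rw [Finset.sum_add_distrib, ← Finset.sum_mul, h1, one_mul, ← Finset.mul_sum, nullPart,
      ContinuousMap.sum_apply]
  rw [e1, e2]
  refine (norm_sum_le _ _).trans (Finset.sum_le_sum fun t _ => ?_)
  rw [norm_mul, Complex.norm_real, Real.norm_eq_abs, abs_of_nonneg (hH t ω)]
  by_cases hω : H t ω = 0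
  · rw [hω]
    split_ifs <;> simp [hω]
  · have hη0 : 0 ≤ η := (abs_nonneg _).trans (hη t ω ω hω hω)
    split_ifs with h0
    · have h2 : ‖profileAvg p (H t) f - u ω‖ ≤ 2 := by
        rw [profileAvg, if_pos h0, profileIntegral_of_ae_eq _ hf, ← Complex.ofReal_sub,
          Complex.norm_real]
        have h3 : ‖∫ x, (1 : C(G × ℕ → Seg, ℝ)) (profile G p x) * u (profile G p x) ∂μ‖ ≤ 1 := by
          refine (norm_integral_le_of_norm_le_const (C := 1) (.of_forall fun x => ?_)).trans
            (by simp)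
          simpa using hu _
        calc _ ≤ _ := norm_sub_le _ _
          _ ≤ 1 + 1 := add_le_add h3 (hu ω)
          _ = 2 := by norm_num
      have := mul_le_mul_of_nonneg_left h2 (hH t ω)
      have := mul_nonneg (hH t ω) hη0
      linarith
    · have := mul_le_mul_of_nonneg_left (norm_profileAvg_sub_le (hH t) hf
        (fun ω' h => hη t ω' ω h hω) h0) (hH t ω)
      simpa using this

end MicroMap

section MicroToUP

variable {G : Type*} [Group G] [Countable G] {X : Type*} [MeasurableSpace X] [MulAction G X]
  [MeasurableConstSMul G X] {μ : Measure X} [IsProbabilityMeasure μ]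
  {p : ℕ → Linfty μ} {n : ℕ} {H : Fin n → C(G × ℕ → Seg, ℝ)} {J : Finset (G × ℕ)} {η : ℝ}

theorem norm_microMap_self_sub_le (hr : ∀ n, IsSelfAdjoint (p n)) (hn : ∀ n, ‖p n‖ ≤ 1)
    (hH : ∀ t ω, 0 ≤ H t ω) (h1 : ∀ ω, ∑ t, H t ω = 1)
    (hη : ∀ t ω ω', H t ω ≠ 0 → H t ω' ≠ 0 → ∀ j ∈ J, |(ω j : ℝ) - ω' j| ≤ η)
    {m : ℕ} (hJ : ((1 : G), m) ∈ J) {d : ℕ} (τ : G → Equiv.Perm (Fin d)) (a : ℕ → Fin d → Seg)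
    (k : Fin d) : ‖microMap p H τ a (p m) k - ((orbit τ a k (1, m) : ℝ) : ℂ)‖
      ≤ η + 2 * nullPart p H (orbit τ a k) := by
  let u : C(G × ℕ → Seg, ℝ) := ⟨fun ω => (ω (1, m) : ℝ), by fun_prop⟩
  exact norm_microMap_sub_le (u := u) hH h1 (ae_eq_profile hr hn m) (fun ω => Seg.abs_le _)
    (fun t ω ω' h h' => hη t ω ω' h h' _ hJ) τ a k

variable [SMulInvariantMeasure G X μ]

theorem norm_microMap_prod_sub_le (hr : ∀ n, IsSelfAdjoint (p n)) (hn : ∀ n, ‖p n‖ ≤ 1)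
    (hH : ∀ t ω, 0 ≤ H t ω) (h1 : ∀ ω, ∑ t, H t ω = 1)
    (hη : ∀ t ω ω', H t ω ≠ 0 → H t ω' ≠ 0 → ∀ j ∈ J, |(ω j : ℝ) - ω' j| ≤ η) {j : ℕ}
    (s : Fin j → G) (m : Fin j → ℕ) (hJ : ∀ k, (s k, m k) ∈ J) {d : ℕ}
    (τ : G → Equiv.Perm (Fin d)) (a : ℕ → Fin d → Seg) (k : Fin d) :
    ‖microMap p H τ a (∏ k, actL (s k) (p (m k))) k
        - ((∏ l, (orbit τ a k (s l, m l) : ℝ) : ℝ) : ℂ)‖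
      ≤ j * η + 2 * nullPart p H (orbit τ a k) := by
  let u : C(G × ℕ → Seg, ℝ) := ⟨fun ω => ∏ l, (ω (s l, m l) : ℝ), by fun_prop⟩
  refine norm_microMap_sub_le (u := u) hH h1 (prod_actL_ae_eq_profile hr hn s m) (fun ω => ?_)
    (fun t ω ω' h h' => ?_) τ a k
  · change |∏ l, (ω (s l, m l) : ℝ)| ≤ 1
    rw [Finset.abs_prod]
    exact Finset.prod_le_one (fun _ _ => abs_nonneg _) fun _ _ => Seg.abs_le _
  · refine (norm_prod_sub_prod_le_sum Finset.univ (f := fun l => (ω (s l, m l) : ℝ))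
      (g := fun l => (ω' (s l, m l) : ℝ)) (fun l => Seg.abs_le _) fun l => Seg.abs_le _).trans ?_
    refine (Finset.sum_le_sum fun l _ => hη t ω ω' h h' _ (hJ l)).trans ?_
    simp

theorem norm_microMap_actL_sub_le (hr : ∀ n, IsSelfAdjoint (p n)) (hn : ∀ n, ‖p n‖ ≤ 1)
    (hH : ∀ t ω, 0 ≤ H t ω) (h1 : ∀ ω, ∑ t, H t ω = 1)
    (hη : ∀ t ω ω', H t ω ≠ 0 → H t ω' ≠ 0 → ∀ j ∈ J, |(ω j : ℝ) - ω' j| ≤ η)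
    {s : G} {m : ℕ} (hJ : (s, m) ∈ J) {d : ℕ} (τ : G → Equiv.Perm (Fin d)) (a : ℕ → Fin d → Seg)
    (k : Fin d) : ‖microMap p H τ a (actL s (p m)) k - ((orbit τ a k (s, m) : ℝ) : ℂ)‖
      ≤ η + 2 * nullPart p H (orbit τ a k) := by
  let u : C(G × ℕ → Seg, ℝ) := ⟨fun ω => (ω (s, m) : ℝ), by fun_prop⟩
  exact norm_microMap_sub_le (u := u) hH h1 (actL_ae_eq_profile hr hn s m) (fun ω => Seg.abs_le _)
    (fun t ω ω' h h' => hη t ω ω' h h' _ hJ) τ a k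

theorem norm_le_one_of_eq_clamp {z : ℂ} (h : z = ((clamp z.re : ℝ) : ℂ)) : ‖z‖ ≤ 1 := by
  rw [h, Complex.norm_real]
  exact Seg.abs_le _

/-- Microstates give rise to approximately multiplicative, measure-preserving and equivariant
positive maps with almost the same values on the sequence. -/
theorem exists_eventually_isUP_microMap (S : SoficApproximation G)
    (hr : ∀ n, IsSelfAdjoint (p n)) (hn : ∀ n, ‖p n‖ ≤ 1) (F : Finset G) (m : ℕ) {δ κ : ℝ}
    (hδ : 0 < δ) (hκ : 0 < κ) :
    ∃ (n : ℕ) (H : Fin n → C(G × ℕ → Seg, ℝ)),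
      ∀ᶠ z in microFilter S fun u => ∫ x, u (profile G p x) ∂μ,
        IsUP p F m δ (S.σ z.1) (microMap p H (S.σ z.1) z.2) ∧
        seqDist z.2 (valuesL p (microMap p H (S.σ z.1) z.2)) < κ := by
  classical
  obtain ⟨N, κ', hκ', hN⟩ := exists_forall_seqDist_lt hκ
  -- `θ` is the tolerance for all errors in the mean
  let θ : ℝ := min (min (δ ^ 2 / 3) δ) κ'
  have hθ : 0 < θ := lt_min (lt_min (by positivity) hδ) hκ'
  have hθ1 : θ ≤ δ ^ 2 / 3 := (min_le_left _ _).trans (min_le_left _ _)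
  have hθ2 : θ ≤ δ := (min_le_left _ _).trans (min_le_right _ _)
  have hθ3 : θ ≤ κ' := min_le_right _ _
  let η : ℝ := θ / (8 * (m + 1))
  have hη0 : 0 < η := by positivity
  have hηm : (m + 1) * η = θ / 8 := by simp only [η]; field_simp
  let J : Finset (G × ℕ) := insert 1 F ×ˢ Finset.range (max m N)
  obtain ⟨n, H, hH, h1, hη⟩ := exists_partition J hη0
  refine ⟨n, H, ?_⟩
  set l := microFilter S fun u => ∫ x, u (profile G p x) ∂μ
  have ev1 : ∀ᶠ z in l, avg (fun k => nullPart p H (orbit (S.σ z.1) z.2 k)) < η / 2 := by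
    have := tendsto_avg_microFilter (S := S) (ν := fun u => ∫ x, u (profile G p x) ∂μ)
      (nullPart p H)
    simp only [integral_nullPart] at this
    exact this.eventually (gt_mem_nhds (by positivity))
  have ev2 : ∀ᶠ z in l, ∀ (j : Fin (m + 1)) (w : Fin j → J),
      |avg (fun k => ∏ q, (orbit (S.σ z.1) z.2 k (w q) : ℝ))
        - ∫ x, ∏ q, (profile G p x (w q) : ℝ) ∂μ| < θ / 4 := by
    refine eventually_all.2 fun j => eventually_all.2 fun w => ?_
    let u : C(G × ℕ → Seg, ℝ) := ⟨fun ω => ∏ q, (ω (w q) : ℝ), by fun_prop⟩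
    exact Metric.tendsto_nhds.1 (tendsto_avg_microFilter (S := S)
      (ν := fun u => ∫ x, u (profile G p x) ∂μ) u) (θ / 4) (by positivity)
  have ev3 : ∀ᶠ z in l, ∀ q : Fin (max m N), avg (fun k =>
      |(z.2 q ((S.σ z.1 1)⁻¹ k) : ℝ) - z.2 q k|) < θ / 4 := by
    refine eventually_all.2 fun q => ?_
    exact (tendsto_avg_inv_one S (tendsto_fst_microFilter (S := S)
      (ν := fun u => ∫ x, u (profile G p x) ∂μ)) fun z => z.2 q).eventually
        (gt_mem_nhds (by positivity))
  filter_upwards [ev1, ev2, ev3] with z hz1 hz2 hz3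
  set τ := S.σ z.1
  set a := z.2
  set Φ := microMap p H τ a
  let A : Fin (S.d z.1) → ℝ := fun k => η + 2 * nullPart p H (orbit τ a k)
  have hA0 : ∀ k, 0 ≤ A k := fun k =>
    add_nonneg hη0.le (mul_nonneg zero_le_two (nullPart_nonneg hH _))
  have hA : avg A ≤ 2 * η := by
    simp only [A]
    rw [avg_add, avg_const_mul]
    have := avg_const_le (d := S.d z.1) hη0.le
    linarith
  have hΦ1 : Φ 1 = 1 := microMap_one h1 τ a
  have hΦ0 : ∀ f : Linfty μ, (∀ᵐ x ∂μ, 0 ≤ f x) → ∀ k, 0 ≤ Φ f k :=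
    fun f hf k => microMap_nonneg hH τ a f hf k
  have hJ : ∀ {s q}, s ∈ F → q < m → (s, q) ∈ J := fun hs hq => Finset.mem_product.2
    ⟨Finset.mem_insert_of_mem hs, Finset.mem_range.2 (lt_max_of_lt_left hq)⟩
  have hJ1 : ∀ {q}, q < max m N → ((1 : G), q) ∈ J := fun hq => Finset.mem_product.2
    ⟨Finset.mem_insert_self _ _, Finset.mem_range.2 hq⟩
  have hword : ∀ (j : ℕ) (s : Fin j → G) (q : Fin j → ℕ), j ≤ m → (∀ k, s k ∈ F) →
      (∀ k, q k < m) → ∀ k, ‖Φ (∏ k, actL (s k) (p (q k))) k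
        - ((∏ l, (orbit τ a k (s l, q l) : ℝ) : ℝ) : ℂ)‖ ≤ (m + 1) * A k := by
    intro j s q hj hs hq k
    refine (norm_microMap_prod_sub_le hr hn hH h1 hη s q (fun k => hJ (hs k) (hq k)) τ a k).trans ?_
    have e1 : (j : ℝ) ≤ m := by exact_mod_cast hj
    have e2 := nullPart_nonneg (p := p) hH (orbit τ a k)
    have e3 : (0 : ℝ) ≤ m := Nat.cast_nonneg _
    simp only [A]
    nlinarith [mul_le_mul_of_nonneg_right e1 hη0.le, mul_nonneg e3 e2]
  have hle : ∀ (s : G) (q : ℕ) k, ‖Φ (actL s (p q)) k‖ ≤ 1 := fun s q k =>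
    norm_le_one_of_eq_clamp (map_eq_clamp hΦ1 hΦ0 (actL_ae_eq_profile hr hn s q) k)
  have hle' : ∀ (q : ℕ) k, ‖Φ (p q) k‖ ≤ 1 := fun q k =>
    norm_le_one_of_eq_clamp (map_eq_clamp hΦ1 hΦ0 (ae_eq_profile (G := G) hr hn q) k)
  have hmη : (m : ℝ) * η ≤ θ / 8 := by rw [← hηm]; nlinarith
  have h1η : η ≤ θ / 8 := by
    rw [← hηm]; nlinarith [mul_nonneg (Nat.cast_nonneg m : (0 : ℝ) ≤ m) hη0.le]
  refine ⟨⟨hΦ1, hΦ0, ?_, ?_, ?_⟩, ?_⟩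
  · intro j hj1 hj s q hs hq
    refine norm2_lt_of_avg_lt (C := 2) zero_le_two hδ _ (fun k => ?_) ?_
    · rw [Pi.sub_apply, Finset.prod_apply]
      refine (norm_sub_le _ _).trans ?_
      have e1 := norm_le_one_of_eq_clamp (map_eq_clamp hΦ1 hΦ0
        (g := fun x => ⟨∏ k, (profile G p x (s k, q k) : ℝ), abs_le.1 (by
          rw [Finset.abs_prod]
          exact Finset.prod_le_one (fun _ _ => abs_nonneg _) fun _ _ => Seg.abs_le _)⟩)
        (prod_actL_ae_eq_profile hr hn s q) k)
      have e2 : ‖∏ c, Φ (actL (s c) (p (q c))) k‖ ≤ 1 := by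
        rw [norm_prod]
        exact Finset.prod_le_one (fun _ _ => norm_nonneg _) fun c _ => hle _ _ k
      linarith
    · have e3 : ∀ k, ‖(Φ (∏ k, actL (s k) (p (q k))) - ∏ k, Φ (actL (s k) (p (q k)))) k‖
          ≤ (2 * m + 1) * A k := by
        intro k
        rw [Pi.sub_apply, Finset.prod_apply]
        have e4 := hword j s q hj hs hq k
        have e5 : ‖((∏ l, (orbit τ a k (s l, q l) : ℝ) : ℝ) : ℂ) -
            ∏ c, Φ (actL (s c) (p (q c))) k‖ ≤ m * A k := by
          rw [Complex.ofReal_prod]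
          refine (norm_prod_sub_prod_le_sum Finset.univ (fun c => ?_) fun c => hle _ _ k).trans ?_
          · rw [Complex.norm_real]; exact Seg.abs_le _
          · refine (Finset.sum_le_sum fun c _ => (norm_sub_rev _ _).trans_le
              (norm_microMap_actL_sub_le hr hn hH h1 hη (hJ (hs c) (hq c)) τ a k)).trans ?_
            rw [Finset.sum_const, Finset.card_univ, Fintype.card_fin, nsmul_eq_mul]
            exact mul_le_mul_of_nonneg_right (by exact_mod_cast hj) (hA0 k)
        have := norm_sub_le_norm_sub_add_norm_sub (Φ (∏ k, actL (s k) (p (q k))) k)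
          ((∏ l, (orbit τ a k (s l, q l) : ℝ) : ℝ) : ℂ) (∏ c, Φ (actL (s c) (p (q c))) k)
        linarith
      refine (avg_mono e3).trans_lt ?_
      rw [avg_const_mul]
      have := mul_le_mul_of_nonneg_left hA (show (0 : ℝ) ≤ 2 * m + 1 by positivity)
      have : (2 + 1 : ℝ) = 3 := by norm_num
      rw [this]
      nlinarith
  · intro j hj1 hj s q hs hq
    rw [integral_congr_ae (prod_actL_ae_eq_profile hr hn s q), integral_complex_ofReal]
    have e1 : ‖unif (Φ (∏ k, actL (s k) (p (q k)))) -
        ((avg fun k => ∏ l, (orbit τ a k (s l, q l) : ℝ) : ℝ) : ℂ)‖ ≤ (m + 1) * (2 * η) := by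
      rw [← unif_ofReal, ← unif_sub]
      refine (norm_unif_le _).trans ((avg_mono (hword j s q hj hs hq)).trans ?_)
      rw [avg_const_mul]
      exact mul_le_mul_of_nonneg_left hA (by positivity)
    have e2 := hz2 ⟨j, by omega⟩ fun c => ⟨(s c, q c), hJ (hs c) (hq c)⟩
    rw [← Real.norm_eq_abs, ← Complex.norm_real, Complex.ofReal_sub] at e2
    have := norm_sub_le_norm_sub_add_norm_sub (unif (Φ (∏ k, actL (s k) (p (q k)))))
      ((avg fun k => ∏ l, (orbit τ a k (s l, q l) : ℝ) : ℝ) : ℂ)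
      ((∫ x, ∏ k, (profile G p x (s k, q k) : ℝ) ∂μ : ℝ) : ℂ)
    simp only at e2
    linarith
  · intro s hs q hq
    refine norm2_lt_of_avg_lt (C := 2) zero_le_two hδ _ (fun k => ?_) ?_
    · rw [Pi.sub_apply, permAct]
      refine (norm_sub_le _ _).trans ?_
      linarith [hle s q k, hle' q ((τ s)⁻¹ k)]
    · have e3 : ∀ k, ‖(Φ (actL s (p q)) - permAct (τ s) (Φ (p q))) k‖ ≤
          A k + (|(a q ((τ 1)⁻¹ ((τ s)⁻¹ k)) : ℝ) - a q ((τ s)⁻¹ k)| + A ((τ s)⁻¹ k)) := by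
        intro k
        have e4 := norm_microMap_actL_sub_le hr hn hH h1 hη (hJ hs hq) τ a k
        have e5 := norm_microMap_self_sub_le hr hn hH h1 hη (hJ1 (lt_max_of_lt_left hq)) τ a
          ((τ s)⁻¹ k)
        rw [Pi.sub_apply, permAct]
        have e6 := norm_sub_le_norm_sub_add_norm_sub (Φ (actL s (p q)) k)
          ((orbit τ a k (s, q) : ℝ) : ℂ) (Φ (p q) ((τ s)⁻¹ k))
        have e7 := norm_sub_le_norm_sub_add_norm_sub ((orbit τ a k (s, q) : ℝ) : ℂ)
          ((orbit τ a ((τ s)⁻¹ k) (1, q) : ℝ) : ℂ) (Φ (p q) ((τ s)⁻¹ k))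
        rw [norm_sub_rev] at e5
        have e8 : ‖((orbit τ a k (s, q) : ℝ) : ℂ) - ((orbit τ a ((τ s)⁻¹ k) (1, q) : ℝ) : ℂ)‖ =
            |(a q ((τ 1)⁻¹ ((τ s)⁻¹ k)) : ℝ) - a q ((τ s)⁻¹ k)| := by
          rw [norm_coe_sub, abs_sub_comm]
          rfl
        rw [e8] at e7
        linarith
      refine (avg_mono e3).trans_lt ?_
      rw [avg_add A, avg_add (fun k => |(a q ((τ 1)⁻¹ ((τ s)⁻¹ k)) : ℝ) - a q ((τ s)⁻¹ k)|)
        (fun k => A ((τ s)⁻¹ k)), avg_comp_perm (τ s)⁻¹ A,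
        avg_comp_perm (τ s)⁻¹ fun k => |(a q ((τ 1)⁻¹ k) : ℝ) - a q k|]
      have := hz3 ⟨q, lt_max_of_lt_left hq⟩
      simp only at this
      have : (2 + 1 : ℝ) = 3 := by norm_num
      rw [this]
      linarith
  · refine hN _ _ _ fun q hq => ?_
    have hq' : q < max m N := lt_max_of_lt_right hq
    have e3 : ∀ k, |(a q k : ℝ) - valuesL p Φ q k| ≤
        |(a q ((τ 1)⁻¹ k) : ℝ) - a q k| + A k := by
      intro k
      have e5 := norm_microMap_self_sub_le hr hn hH h1 hη (hJ1 hq') τ a k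
      have e6 := abs_clamp_re_sub_le (Φ (p q) k) ((orbit τ a k (1, q) : ℝ) : ℂ)
      rw [Complex.ofReal_re, clamp_coe] at e6
      have e7 := abs_sub_le (a q k : ℝ) (a q ((τ 1)⁻¹ k)) (valuesL p Φ q k)
      have e8 : |(a q ((τ 1)⁻¹ k) : ℝ) - valuesL p Φ q k| ≤ A k := by
        rw [abs_sub_comm]; exact e6.trans e5
      have e9 := abs_sub_comm (a q k : ℝ) (a q ((τ 1)⁻¹ k))
      linarith
    refine (avg_mono e3).trans_lt ?_
    rw [avg_add _ A]
    have := hz3 ⟨q, hq'⟩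
    simp only at this
    linarith

/-- The maps `microMap` hit every set of approximations and move the values by a small amount, so
that separated microstates give separated maps. -/
theorem microEntropy_le_measureEntropySeq (S : SoficApproximation G)
    (hr : ∀ n, IsSelfAdjoint (p n)) (hn : ∀ n, ‖p n‖ ≤ 1) :
    microEntropy S (fun u => ∫ x, u (profile G p x) ∂μ) ≤ measureEntropySeq S p := by
  rw [measureEntropySeq_eq]
  have hself : ∀ (i : ℕ) (φ : Linfty μ →ₗ[ℂ] (Fin (S.d i) → ℂ)), rho p φ φ = 0 := fun i φ => by
    simp [rho, norm2]
  refine filterEntropy_le_of_map hself fun ε hε => ⟨ε / 2, half_pos hε, fun W hW => ?_⟩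
  obtain ⟨x, hx⟩ := (mem_limitFilter (directed_upSet S p)).1 hW
  obtain ⟨n, H, hz⟩ := exists_eventually_isUP_microMap S hr hn x.1.1 x.1.2.1 x.2.2.2
    (show 0 < ε / 4 by positivity)
  refine ⟨fun i a => microMap p H (S.σ i) a, _, hz.and (tendsto_fst_microFilter.eventually hx),
    fun i a ha => ha.2 _ ha.1.1, fun i a a' ha ha' hlt => ?_⟩
  rw [rho_eq_seqDist_valuesL hr hn ha.1.1.map_one ha.1.1.positive ha'.1.1.map_one ha'.1.1.positive]
  have h1 := ha.1.2
  have h2 := ha'.1.2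
  have h3 := seqDist_triangle a (valuesL p (microMap p H (S.σ i) a)) a'
  have h4 := seqDist_triangle (valuesL p (microMap p H (S.σ i) a))
    (valuesL p (microMap p H (S.σ i) a')) a'
  rw [seqDist_comm (valuesL p (microMap p H (S.σ i) a')) a'] at h4
  simp only at h1 h2 hlt
  linarith

/-- The measure entropy depends only on the distribution of the profile map. -/
theorem measureEntropySeq_eq_microEntropy (S : SoficApproximation G)
    (hr : ∀ n, IsSelfAdjoint (p n)) (hn : ∀ n, ‖p n‖ ≤ 1) :
    measureEntropySeq S p = microEntropy S fun u => ∫ x, u (profile G p x) ∂μ :=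
  le_antisymm (measureEntropySeq_le_microEntropy hr hn) (microEntropy_le_measureEntropySeq S hr hn)

end MicroToUP

/-! ### Independence of the generating sequence, measure case -/

section Approx

variable {G : Type*} [Group G] [Countable G] {X : Type*} [MeasurableSpace X] [MulAction G X]
  [MeasurableConstSMul G X] {μ : Measure X}

theorem aestronglyMeasurable_sub_comp_profile (p : ℕ → Linfty μ) (f : Linfty μ)
    (Q : C(G × ℕ → Seg, ℂ)) :
    AEStronglyMeasurable (fun x => f x - Q (profile G p x)) μ :=
  (Lp.aestronglyMeasurable f).sub (measurable_comp_profile p Q).aestronglyMeasurable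

variable [SMulInvariantMeasure G X μ]

/-- The bounded functions which are `L²`-limits of continuous functions of the profile map. -/
def profileAlgebra (G : Type*) [Group G] [Countable G] [MulAction G X] [MeasurableConstSMul G X]
    (p : ℕ → Linfty μ) : StarSubalgebra ℂ (Linfty μ) where
  carrier := {f | ∀ ε : ℝ, 0 < ε → ∃ Q : C(G × ℕ → Seg, ℂ),
    eLpNorm (fun x => f x - Q (profile G p x)) 2 μ < ENNReal.ofReal ε}
  add_mem' := fun {f g} hf hg ε hε => by
    obtain ⟨Q, hQ⟩ := hf (ε / 2) (half_pos hε)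
    obtain ⟨R, hR⟩ := hg (ε / 2) (half_pos hε)
    refine ⟨Q + R, ?_⟩
    have h1 : (fun x => (f + g) x - (Q + R) (profile G p x)) =ᵐ[μ]
        (fun x => f x - Q (profile G p x)) + fun x => g x - R (profile G p x) := by
      filter_upwards [Lp.coeFn_add f g] with x hx
      rw [hx]
      simp only [Pi.add_apply, ContinuousMap.add_apply]
      ring
    rw [eLpNorm_congr_ae h1]
    refine (eLpNorm_add_le (aestronglyMeasurable_sub_comp_profile p f Q)
      (aestronglyMeasurable_sub_comp_profile p g R) (by norm_num)).trans_lt ?_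
    rw [← add_halves ε, ENNReal.ofReal_add (half_pos hε).le (half_pos hε).le]
    exact ENNReal.add_lt_add hQ hR
  mul_mem' := fun {f g} hf hg ε hε => by
    have hC : 0 < ‖f‖ + 1 := by positivity
    obtain ⟨R, hR⟩ := hg (ε / 2 / (‖f‖ + 1)) (by positivity)
    obtain ⟨M, hM⟩ := isCompact_univ.exists_bound_of_continuousOn (f := R) R.continuous.continuousOn
    obtain ⟨Q, hQ⟩ := hf (ε / 2 / (|M| + 1)) (by positivity)
    refine ⟨Q * R, ?_⟩
    have h1 : (fun x => (f * g) x - (Q * R) (profile G p x)) =ᵐ[μ]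
        (fun x => f x * (g x - R (profile G p x))) +
          fun x => (f x - Q (profile G p x)) * R (profile G p x) := by
      filter_upwards [coeFn_mul_Linfty f g] with x hx
      rw [hx]
      simp only [Pi.add_apply, ContinuousMap.mul_apply]
      ring
    have h2 : eLpNorm (fun x => f x * (g x - R (profile G p x))) 2 μ ≤
        ENNReal.ofReal (‖f‖ + 1) * eLpNorm (fun x => g x - R (profile G p x)) 2 μ := by
      refine eLpNorm_le_mul_eLpNorm_of_ae_le_mul ?_ 2
      filter_upwards [ae_le_eLpNormEssSup (f := f) (μ := μ)] with x hx
      rw [norm_mul]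
      refine mul_le_mul_of_nonneg_right ?_ (norm_nonneg _)
      rw [← eLpNorm_exponent_top, ← Lp.enorm_def, enorm_le_iff_norm_le] at hx
      linarith
    have h3 : eLpNorm (fun x => (f x - Q (profile G p x)) * R (profile G p x)) 2 μ ≤
        ENNReal.ofReal (|M| + 1) * eLpNorm (fun x => f x - Q (profile G p x)) 2 μ := by
      refine eLpNorm_le_mul_eLpNorm_of_ae_le_mul (.of_forall fun x => ?_) 2
      rw [norm_mul, mul_comm]
      refine mul_le_mul_of_nonneg_right ?_ (norm_nonneg _)
      linarith [hM (profile G p x) trivial, le_abs_self M]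
    have h4 : ∀ {c : ℝ} {e : ℝ≥0∞}, 0 < c → e < ENNReal.ofReal (ε / 2 / c) →
        ENNReal.ofReal c * e < ENNReal.ofReal (ε / 2) := fun {c e} hc he => by
      have := ENNReal.mul_lt_mul_right (a := ENNReal.ofReal c) (by simpa using hc)
        ENNReal.ofReal_ne_top he
      rwa [← ENNReal.ofReal_mul hc.le, mul_div_cancel₀ _ hc.ne'] at this
    rw [eLpNorm_congr_ae h1]
    refine (eLpNorm_add_le
      ((Lp.aestronglyMeasurable f).mul (aestronglyMeasurable_sub_comp_profile p g R))
      ((aestronglyMeasurable_sub_comp_profile p f Q).mul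
        (measurable_comp_profile p R).aestronglyMeasurable) (by norm_num)).trans_lt ?_
    rw [← add_halves ε, ENNReal.ofReal_add (half_pos hε).le (half_pos hε).le]
    exact ENNReal.add_lt_add (h2.trans_lt (h4 hC hR)) (h3.trans_lt (h4 (by positivity) hQ))
  algebraMap_mem' := fun c ε hε => by
    refine ⟨ContinuousMap.const _ c, ?_⟩
    have h1 : (fun x => (algebraMap ℂ (Linfty μ) c) x -
        (ContinuousMap.const (G × ℕ → Seg) c) (profile G p x)) =ᵐ[μ] fun _ => (0 : ℂ) := by
      rw [Algebra.algebraMap_eq_smul_one]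
      filter_upwards [Lp.coeFn_smul c (1 : Linfty μ), coeFn_one_Linfty (μ := μ)] with x h1 h2
      rw [h1, Pi.smul_apply, h2]
      simp
    rw [eLpNorm_congr_ae h1]
    simpa using hε
  star_mem' := fun {f} hf ε hε => by
    obtain ⟨Q, hQ⟩ := hf ε hε
    refine ⟨star Q, lt_of_le_of_lt (le_of_eq ?_) hQ⟩
    refine eLpNorm_congr_norm_ae ?_
    filter_upwards [coeFn_star_Linfty f] with x hx
    rw [hx, ContinuousMap.star_apply, ← star_sub, norm_star]

theorem profileAlgebra_eq_top {p : ℕ → Linfty μ} (hp : IsGeneratingL G p) :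
    profileAlgebra G p = ⊤ := by
  refine hp.generating _ (fun f hf ε hε => ?_) (fun s f hf ε hε => ?_) (fun n ε hε => ?_)
  · obtain ⟨g, hg, hfg⟩ := hf (ε / 2) (half_pos hε)
    obtain ⟨Q, hQ⟩ := hg (ε / 2) (half_pos hε)
    refine ⟨Q, ?_⟩
    have h1 : (fun x => f x - Q (profile G p x)) =ᵐ[μ]
        ⇑(f - g) + fun x => g x - Q (profile G p x) := by
      filter_upwards [Lp.coeFn_sub f g] with x hx
      rw [Pi.add_apply, hx]
      simp
    rw [eLpNorm_congr_ae h1]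
    refine (eLpNorm_add_le (Lp.aestronglyMeasurable _)
      (aestronglyMeasurable_sub_comp_profile p g Q) (by norm_num)).trans_lt ?_
    rw [← add_halves ε, ENNReal.ofReal_add (half_pos hε).le (half_pos hε).le]
    exact ENNReal.add_lt_add hfg hQ
  · obtain ⟨Q, hQ⟩ := hf ε hε
    refine ⟨Q.comp (shift s), lt_of_le_of_lt (le_of_eq ?_) hQ⟩
    rw [← eLpNorm_comp_measurePreserving (aestronglyMeasurable_sub_comp_profile p f Q)
      (measurePreserving_smul s⁻¹ μ)]
    refine eLpNorm_congr_ae ?_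
    filter_upwards [coeFn_actL s f] with x hx
    rw [hx, Function.comp_apply, profile_smul]
    rfl
  · refine ⟨⟨fun ω => ((ω (1, n) : ℝ) : ℂ), by fun_prop⟩, ?_⟩
    have h1 : (fun x => p n x - ((profile G p x (1, n) : ℝ) : ℂ)) =ᵐ[μ] fun _ => (0 : ℂ) := by
      filter_upwards [ae_eq_profile (G := G) hp.real hp.norm_le n] with x hx
      rw [hx, sub_self]
    change eLpNorm (fun x => p n x - ((profile G p x (1, n) : ℝ) : ℂ)) 2 μ < _
    rw [eLpNorm_congr_ae h1]
    simpa using hε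

/-- Every bounded function is almost everywhere a limit of continuous functions of the profile of
a generating sequence. -/
theorem exists_tendsto_comp_profile [IsFiniteMeasure μ] {p : ℕ → Linfty μ}
    (hp : IsGeneratingL G p) (f : Linfty μ) : ∃ Q : ℕ → C(G × ℕ → Seg, Seg), ∀ᵐ x ∂μ,
      Tendsto (fun j => Q j (profile G p x)) atTop (𝓝 (clamp (f x).re)) := by
  have hf : f ∈ profileAlgebra G p := by rw [profileAlgebra_eq_top hp]; trivial
  have h1 : ∀ j : ℕ, ∃ Q : C(G × ℕ → Seg, ℂ),
      eLpNorm (fun x => f x - Q (profile G p x)) 2 μ < ENNReal.ofReal (1 / ((j : ℝ) + 1)) :=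
    fun j => hf _ (by positivity)
  choose Q hQ using h1
  have h2 : Tendsto (fun j => eLpNorm ((fun x => Q j (profile G p x)) - ⇑f) 2 μ) atTop (𝓝 0) := by
    have h3 : Tendsto (fun j : ℕ => ENNReal.ofReal (1 / ((j : ℝ) + 1))) atTop (𝓝 0) := by
      rw [← ENNReal.ofReal_zero]
      exact ENNReal.tendsto_ofReal tendsto_one_div_add_atTop_nhds_zero_nat
    refine tendsto_of_tendsto_of_tendsto_of_le_of_le tendsto_const_nhds h3
      (fun _ => zero_le) fun j => ?_
    rw [eLpNorm_sub_comm]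
    exact (hQ j).le
  obtain ⟨ns, -, hns⟩ := (tendstoInMeasure_of_tendsto_eLpNorm (by norm_num)
    (fun j => (measurable_comp_profile p (Q j)).aestronglyMeasurable)
    (Lp.aestronglyMeasurable f) h2).exists_seq_tendsto_ae
  refine ⟨fun j => ⟨fun ω => clamp (Q (ns j) ω).re, continuous_clamp.comp (by fun_prop)⟩, ?_⟩
  filter_upwards [hns] with x hx
  exact (continuous_clamp.tendsto _).comp ((Complex.continuous_re.tendsto _).comp hx)

end Approx

theorem avg_orbit_sub_orbit_le {G : Type*} {R : C(G × ℕ → Seg, ℝ)} {η C : ℝ} (hη : 0 ≤ η)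
    (hC : 0 ≤ C) {J : Finset (G × ℕ)}
    (h : ∀ y y' : G × ℕ → Seg, |R y - R y'| ≤ η + C * ∑ j ∈ J, |(y j : ℝ) - y' j|) {d : ℕ}
    (τ : G → Equiv.Perm (Fin d)) (a b : ℕ → Fin d → Seg) :
    avg (fun k => |R (orbit τ a k) - R (orbit τ b k)|) ≤
      η + C * (∑ j ∈ J, 2 ^ (j.2 + 1)) * seqDist a b := by
  refine (avg_modulus_le hη h _ _).trans ?_
  rw [mul_assoc, Finset.sum_mul]
  refine add_le_add_right (mul_le_mul_of_nonneg_left (Finset.sum_le_sum fun j _ => ?_) hC) _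
  refine le_of_eq_of_le ?_ (avg_le_seqDist a b j.2)
  exact avg_comp_perm (τ j.1)⁻¹ fun k => |(a j.2 k : ℝ) - b j.2 k|

/-- If finitely many terms of `a` and `b` are recovered in mean, up to `κ / 3`, by continuous
functions `r n` from the orbits of `a'` and `b'`, then they are close as soon as `a'` and `b'`
are. -/
theorem exists_forall_avg_lt_of_recover {G : Type*} (r : ℕ → C(G × ℕ → Seg, ℝ)) (N : ℕ) {κ : ℝ}
    (hκ : 0 < κ) : ∃ ε' : ℝ, 0 < ε' ∧ ∀ (d : ℕ) (τ : G → Equiv.Perm (Fin d))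
      (a b a' b' : ℕ → Fin d → Seg),
      (∀ n < N, avg (fun k => |(a n k : ℝ) - r n (orbit τ a' k)|) < κ / 3) →
      (∀ n < N, avg (fun k => |(b n k : ℝ) - r n (orbit τ b' k)|) < κ / 3) →
      seqDist a' b' ≤ ε' → ∀ n < N, avg (fun k => |(a n k : ℝ) - b n k|) < κ := by
  choose J C hC hJ using fun n => exists_modulus (r n) (show 0 < κ / 6 by positivity)
  let D : ℝ := ∑ n ∈ Finset.range N, C n * ∑ j ∈ J n, 2 ^ (j.2 + 1)
  have hDn : ∀ n, 0 ≤ C n * ∑ j ∈ J n, (2 : ℝ) ^ (j.2 + 1) := fun n =>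
    mul_nonneg (hC n) (Finset.sum_nonneg fun _ _ => by positivity)
  have hD : 0 ≤ D := Finset.sum_nonneg fun n _ => hDn n
  refine ⟨κ / (6 * (D + 1)), by positivity, fun d τ a b a' b' ha hb hle n hn => ?_⟩
  have t1 := ha n hn
  have t2 := hb n hn
  have t3 := avg_orbit_sub_orbit_le (by positivity) (hC n) (hJ n) τ a' b'
  have t4 : C n * (∑ j ∈ J n, (2 : ℝ) ^ (j.2 + 1)) ≤ D :=
    Finset.single_le_sum (f := fun n => C n * ∑ j ∈ J n, (2 : ℝ) ^ (j.2 + 1))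
      (fun n _ => hDn n) (Finset.mem_range.2 hn)
  have t5 : C n * (∑ j ∈ J n, (2 : ℝ) ^ (j.2 + 1)) * seqDist a' b' < κ / 6 := by
    refine (mul_le_mul t4 hle (tsum_nonneg fun n => mul_nonneg (by positivity)
      (norm2_nonneg _)) hD).trans_lt ?_
    rw [mul_div_assoc', div_lt_iff₀ (by positivity)]
    nlinarith
  have t6 := avg_abs_sub_triangle (fun k => (a n k : ℝ)) (fun k => r n (orbit τ a' k))
    (fun k => (b n k : ℝ))
  have t7 := avg_abs_sub_triangle (fun k => r n (orbit τ a' k)) (fun k => r n (orbit τ b' k))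
    (fun k => (b n k : ℝ))
  simp only [abs_sub_comm (b n _ : ℝ) (r n _)] at t2
  linarith

section Code

variable {G : Type*} [Group G] (S : SoficApproximation G)

/-- The equivariant map from the cube to itself given by a sequence of functions. -/
def codeMap (Q : ℕ → C(G × ℕ → Seg, Seg)) : C(G × ℕ → Seg, G × ℕ → Seg) :=
  ⟨fun ω j => Q j.2 (shift j.1 ω), by fun_prop⟩

/-- The action of a code on microstates. -/
def codeMicro (Q : ℕ → C(G × ℕ → Seg, Seg)) {d : ℕ} (τ : G → Equiv.Perm (Fin d))
    (a : ℕ → Fin d → Seg) : ℕ → Fin d → Seg :=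
  fun n k => Q n (orbit τ a k)

variable {S} {ν : C(G × ℕ → Seg, ℝ) → ℝ}

theorem tendsto_avg_orbit_codeMicro (Q : ℕ → C(G × ℕ → Seg, Seg)) (u : C(G × ℕ → Seg, ℝ)) :
    Tendsto (fun z : Σ i, ℕ → Fin (S.d i) → Seg => avg fun k =>
      |u (orbit (S.σ z.1) (codeMicro Q (S.σ z.1) z.2) k) - u (codeMap Q (orbit (S.σ z.1) z.2 k))|)
      (microFilter S ν) (𝓝 0) :=
  tendsto_avg_abs_sub (d := fun z : Σ i, ℕ → Fin (S.d i) → Seg => S.d z.1)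
    (y := fun z k => orbit (S.σ z.1) (codeMicro Q (S.σ z.1) z.2) k)
    (y' := fun z k => codeMap Q (orbit (S.σ z.1) z.2 k))
    (fun j => tendsto_avg_orbit_shift S tendsto_fst_microFilter (fun z => z.2) j.1
      ⟨fun ω => (Q j.2 ω : ℝ), by fun_prop⟩) u

/-- A code carries microstates of a distribution to microstates of its image. -/
theorem tendsto_codeMicro (Q : ℕ → C(G × ℕ → Seg, Seg)) :
    Tendsto (fun z => (⟨z.1, codeMicro Q (S.σ z.1) z.2⟩ : Σ i, ℕ → Fin (S.d i) → Seg))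
      (microFilter S ν) (microFilter S fun u => ν (u.comp (codeMap Q))) := by
  refine tendsto_microFilter.2 ⟨tendsto_fst_microFilter, fun u => ?_⟩
  have := (tendsto_avg_sub_avg (tendsto_avg_orbit_codeMicro (S := S) (ν := ν) Q u)).add
    (tendsto_avg_microFilter (u.comp (codeMap Q)))
  simpa using this

/-- The filter of microstates depends continuously on the distribution. -/
theorem eventually_mem_microFilter {κ : ℕ → C(G × ℕ → Seg, ℝ) → ℝ}
    (h : ∀ u, Tendsto (fun j => κ j u) atTop (𝓝 (ν u))) {W : Set (Σ i, ℕ → Fin (S.d i) → Seg)}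
    (hW : W ∈ microFilter S ν) : ∀ᶠ j in atTop, W ∈ microFilter S (κ j) := by
  have hle : Tendsto id ((atTop : Filter ℕ).bind fun j => microFilter S (κ j))
      (microFilter S ν) := by
    refine tendsto_microFilter.2 ⟨fun V hV => mem_map.2 (mem_bind'.2 (univ_mem' fun j =>
      tendsto_fst_microFilter hV)), fun u O hO => mem_map.2 (mem_bind'.2 ?_)⟩
    obtain ⟨O', hO', hopen, hmem⟩ := mem_nhds_iff.1 hO
    filter_upwards [h u (hopen.mem_nhds hmem)] with j hj
    exact mem_of_superset (tendsto_avg_microFilter u (hopen.mem_nhds hj))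
      (Set.preimage_mono hO')
  exact mem_bind'.1 (hle hW)

end Code

theorem tendsto_integral_comp {ι X : Type*} [Countable ι] [MeasurableSpace X] {μ : Measure X}
    [IsProbabilityMeasure μ] {P P' : X → ι → Seg} {Pj : ℕ → X → ι → Seg}
    (hPj : ∀ j, Measurable (Pj j)) (h : ∀ᵐ x ∂μ, Tendsto (fun j => Pj j x) atTop (𝓝 (P x)))
    (hP' : Measurable P') (u : C((ι → Seg) × (ι → Seg), ℝ)) :
    Tendsto (fun j => ∫ x, u (P' x, Pj j x) ∂μ) atTop (𝓝 (∫ x, u (P' x, P x) ∂μ)) := by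
  obtain ⟨M, hM⟩ := isCompact_univ.exists_bound_of_continuousOn (f := u) u.continuous.continuousOn
  refine tendsto_integral_of_dominated_convergence (fun _ => M)
    (fun j => (u.continuous.measurable.comp (hP'.prodMk (hPj j))).aestronglyMeasurable)
    (integrable_const _) (fun j => .of_forall fun x => hM _ trivial) ?_
  filter_upwards [h] with x hx
  exact (u.continuous.tendsto _).comp (tendsto_const_nhds.prodMk_nhds hx)

section Independence

variable {G : Type*} [Group G] [Countable G] {X : Type*} [MeasurableSpace X] [MulAction G X]
  [MeasurableConstSMul G X] {μ : Measure X} [IsProbabilityMeasure μ] [SMulInvariantMeasure G X μ]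

/-- Codes approximate the profile of any bounded sequence by the profile of a generating one. -/
theorem exists_tendsto_codeMap {p q : ℕ → Linfty μ} (hp : IsGeneratingL G p) :
    ∃ Q : ℕ → ℕ → C(G × ℕ → Seg, Seg), ∀ᵐ x ∂μ,
      Tendsto (fun j => codeMap (Q j) (profile G p x)) atTop (𝓝 (profile G q x)) := by
  choose Q hQ using fun n => exists_tendsto_comp_profile hp (q n)
  refine ⟨fun j n => Q n j, ?_⟩
  have h : ∀ᵐ x ∂μ, ∀ i : G × ℕ, Tendsto (fun j => Q i.2 j (profile G p (i.1⁻¹ • x))) atTop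
      (𝓝 (profile G q x i)) := ae_all_iff.2 fun i =>
    (measurePreserving_smul i.1⁻¹ μ).quasiMeasurePreserving.ae (hQ i.2)
  filter_upwards [h] with x hx
  refine tendsto_pi_nhds.2 fun i => ?_
  simpa [codeMap, profile_smul] using hx i

/-- The entropy of microstates does not depend on the generating sequence. Codes between the two
sequences carry microstates of one to microstates of the other, and they keep separated
microstates separated because they are approximately invertible. -/
theorem microEntropy_le_of_isGeneratingL (S : SoficApproximation G) {p q : ℕ → Linfty μ}
    (hp : IsGeneratingL G p) (hq : IsGeneratingL G q) :
    microEntropy S (fun u => ∫ x, u (profile G p x) ∂μ) ≤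
      microEntropy S fun u => ∫ x, u (profile G q x) ∂μ := by
  refine filterEntropy_le_of_map (fun _ => seqDist_self) fun ε hε => ?_
  obtain ⟨N, κ, hκ, hN⟩ := exists_forall_seqDist_lt hε
  obtain ⟨Rs, hRs⟩ := exists_tendsto_codeMap (q := p) hq
  obtain ⟨Qs, hQs⟩ := exists_tendsto_codeMap (q := q) hp
  -- a code which recovers the first `N` terms of `p` from `q`, in mean
  have h1 : ∃ R : ℕ → C(G × ℕ → Seg, Seg), ∀ n < N,
      ∫ x, |(profile G p x (1, n) : ℝ) - codeMap R (profile G q x) (1, n)| ∂μ < κ / 6 := by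
    have : ∀ᶠ j in atTop, ∀ n : Fin N,
        ∫ x, |(profile G p x (1, (n : ℕ)) : ℝ) - codeMap (Rs j) (profile G q x) (1, (n : ℕ))| ∂μ
          < κ / 6 := by
      refine eventually_all.2 fun n => ?_
      have := tendsto_integral_comp (μ := μ) (P' := profile G p)
        (Pj := fun j x => codeMap (Rs j) (profile G q x))
        (fun j => (codeMap (Rs j)).continuous.measurable.comp (measurable_profile q)) hRs
        (measurable_profile p)
        ⟨fun y => |(y.1 (1, (n : ℕ)) : ℝ) - y.2 (1, (n : ℕ))|, by fun_prop⟩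
      simp only [ContinuousMap.coe_mk, sub_self, abs_zero, integral_zero] at this
      exact this.eventually (gt_mem_nhds (by positivity))
    obtain ⟨j, hj⟩ := this.exists
    exact ⟨Rs j, fun n hn => hj ⟨n, hn⟩⟩
  obtain ⟨R, hR⟩ := h1
  let r : ℕ → C(G × ℕ → Seg, ℝ) := fun n => ⟨fun ω => codeMap R ω (1, n), by fun_prop⟩
  obtain ⟨ε', hε', hrec⟩ := exists_forall_avg_lt_of_recover r N hκ
  refine ⟨ε', hε', fun W hW => ?_⟩
  have h2 : ∀ u : C(G × ℕ → Seg, ℝ), Tendsto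
      (fun j => ∫ x, u (codeMap (Qs j) (profile G p x)) ∂μ) atTop
      (𝓝 (∫ x, u (profile G q x) ∂μ)) := fun u =>
    tendsto_integral_comp (P' := profile G p) (Pj := fun j x => codeMap (Qs j) (profile G p x))
      (fun j => (codeMap (Qs j)).continuous.measurable.comp (measurable_profile p)) hQs
      (measurable_profile p) ⟨fun y => u y.2, by fun_prop⟩
  have h3 : ∀ᶠ j in atTop, ∀ n : Fin N,
      ∫ x, |(profile G p x (1, (n : ℕ)) : ℝ) - r n (codeMap (Qs j) (profile G p x))| ∂μ
        < κ / 6 := by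
    refine eventually_all.2 fun n => ?_
    have := tendsto_integral_comp (μ := μ) (P' := profile G p)
      (Pj := fun j x => codeMap (Qs j) (profile G p x))
      (fun j => (codeMap (Qs j)).continuous.measurable.comp (measurable_profile p)) hQs
      (measurable_profile p) ⟨fun y => |(y.1 (1, (n : ℕ)) : ℝ) - r n y.2|, by fun_prop⟩
    exact this.eventually (gt_mem_nhds (hR n n.2))
  -- a code which carries microstates of `p` into `W` and is recovered by `r`
  obtain ⟨j, hj1, hj2⟩ := ((eventually_mem_microFilter (S := S) h2 hW).and h3).exists
  set Q := Qs j
  set l := microFilter S fun u => ∫ x, u (profile G p x) ∂μ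
  have ev0 : ∀ᶠ z in l,
      (⟨z.1, codeMicro Q (S.σ z.1) z.2⟩ : Σ i, ℕ → Fin (S.d i) → Seg) ∈ W :=
    tendsto_codeMicro (S := S) (ν := fun u => ∫ x, u (profile G p x) ∂μ) Q hj1
  have ev1 : ∀ᶠ z in l, ∀ n : Fin N, avg (fun k =>
      |(z.2 n k : ℝ) - r n (orbit (S.σ z.1) (codeMicro Q (S.σ z.1) z.2) k)|) < κ / 3 := by
    refine eventually_all.2 fun n => ?_
    have e1 := (tendsto_avg_inv_one S (tendsto_fst_microFilter (S := S)
      (ν := fun u => ∫ x, u (profile G p x) ∂μ)) fun z => z.2 n).eventually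
        (gt_mem_nhds (show 0 < κ / 12 by positivity))
    have e2 := (tendsto_avg_microFilter (S := S) (ν := fun u => ∫ x, u (profile G p x) ∂μ)
      ⟨fun ω => |(ω (1, (n : ℕ)) : ℝ) - r n (codeMap Q ω)|, by fun_prop⟩).eventually
        (gt_mem_nhds (hj2 n))
    have e3 := (tendsto_avg_orbit_codeMicro (S := S) (ν := fun u => ∫ x, u (profile G p x) ∂μ) Q
      (r n)).eventually (gt_mem_nhds (show 0 < κ / 12 by positivity))
    filter_upwards [e1, e2, e3] with z h1 h2 h3
    simp only [ContinuousMap.coe_mk] at h2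
    have t1 := avg_abs_sub_triangle (fun k => (z.2 n k : ℝ))
      (fun k => (z.2 n ((S.σ z.1 1)⁻¹ k) : ℝ))
      (fun k => r n (orbit (S.σ z.1) (codeMicro Q (S.σ z.1) z.2) k))
    have t2 := avg_abs_sub_triangle (fun k => (z.2 n ((S.σ z.1 1)⁻¹ k) : ℝ))
      (fun k => r n (codeMap Q (orbit (S.σ z.1) z.2 k)))
      (fun k => r n (orbit (S.σ z.1) (codeMicro Q (S.σ z.1) z.2) k))
    simp only [abs_sub_comm (r n (codeMap Q _))] at t2
    simp only [abs_sub_comm (z.2 n _ : ℝ) (z.2 n ((S.σ z.1 1)⁻¹ _))] at t1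
    have t3 : avg (fun k => |(z.2 n ((S.σ z.1 1)⁻¹ k) : ℝ)
        - r n (codeMap Q (orbit (S.σ z.1) z.2 k))|) < κ / 6 := h2
    linarith
  refine ⟨fun i a => codeMicro Q (S.σ i) a, _, ev0.and ev1, fun i a ha => ha.1,
    fun i a b ha hb hlt => ?_⟩
  by_contra! hle
  exact absurd hlt (not_lt.2 (hN _ a b (hrec _ (S.σ i) a b _ _ (fun n hn => ha.2 ⟨n, hn⟩)
    (fun n hn => hb.2 ⟨n, hn⟩) hle)).le)

end Independence

/-! ### Homomorphisms and approximate equivariance -/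

section Top

variable {G : Type*} [Group G] {X : Type*} [TopologicalSpace X]

theorem exists_eq_eval [CompactSpace X] [T2Space X] {d : ℕ} (φ : C(X, ℂ) →ₐ[ℂ] (Fin d → ℂ))
    (k : Fin d) : ∃ x : X, ∀ f, φ f k = f x := by
  obtain ⟨x, hx⟩ := (WeakDual.CharacterSpace.continuousMapEval_bijective (X := X) (𝕜 := ℂ)).2
    (WeakDual.CharacterSpace.equivAlgHom.symm ((Pi.evalAlgHom ℂ (fun _ => ℂ) k).comp φ))
  refine ⟨x, fun f => ?_⟩
  have := DFunLike.congr_fun hx f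
  exact this.symm

/-- The points of `X` at which a unital homomorphism `C(X) → ℂ^d` evaluates. -/
def homPoint [CompactSpace X] [T2Space X] {d : ℕ} (φ : C(X, ℂ) →ₐ[ℂ] (Fin d → ℂ))
    (k : Fin d) : X :=
  (exists_eq_eval φ k).choose

theorem apply_homPoint [CompactSpace X] [T2Space X] {d : ℕ} (φ : C(X, ℂ) →ₐ[ℂ] (Fin d → ℂ))
    (f : C(X, ℂ)) (k : Fin d) : φ f k = f (homPoint φ k) :=
  (exists_eq_eval φ k).choose_spec f

theorem eq_clamp_of_isSelfAdjoint [CompactSpace X] {f : C(X, ℂ)} (h : IsSelfAdjoint f)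
    (h' : ‖f‖ ≤ 1) (x : X) : f x = ((clamp (f x).re : ℝ) : ℂ) := by
  have h1 : star (f x) = f x := by rw [← ContinuousMap.star_apply, h.star_eq]
  rw [coe_clamp ((Complex.abs_re_le_norm _).trans ((f.norm_coe_le_norm x).trans h'))]
  exact (Complex.conj_eq_iff_re.1 h1).symm

variable [MulAction G X] [ContinuousConstSMul G X]

/-- The values of the translates of a sequence of continuous functions at a point, as a point of
the cube `[-1, 1]^(G × ℕ)`. -/
def profileC (G : Type*) [Group G] [MulAction G X] [ContinuousConstSMul G X] (p : ℕ → C(X, ℂ)) :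
    C(X, G × ℕ → Seg) :=
  ⟨fun x j => clamp (p j.2 (j.1⁻¹ • x)).re, continuous_pi fun _ =>
    continuous_clamp.comp (Complex.continuous_re.comp
      ((p _).continuous.comp (continuous_const_smul _)))⟩

theorem profileC_smul (p : ℕ → C(X, ℂ)) (s : G) (x : X) :
    profileC G p (s⁻¹ • x) = shift s (profileC G p x) := by
  funext j
  simp [profileC, shift, mul_smul]

/-- The functions which take the same values along the orbits of two points form an invariant closed
subalgebra, so a generating sequence separates orbits pointwise. -/
theorem injective_profileC [CompactSpace X] [T2Space X] {p : ℕ → C(X, ℂ)} (hp : IsGeneratingC G p) :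
    Function.Injective (profileC G p) := by
  intro x y hxy
  let A : StarSubalgebra ℂ C(X, ℂ) :=
    { carrier := {f | ∀ s : G, f (s⁻¹ • x) = f (s⁻¹ • y)}
      add_mem' := fun {f g} hf hg s => by simp [hf s, hg s]
      mul_mem' := fun {f g} hf hg s => by simp [hf s, hg s]
      algebraMap_mem' := fun c s => rfl
      star_mem' := fun {f} hf s => by simp [hf s] }
  have hA : A = ⊤ := by
    refine hp.generating A ?_ (fun t f hf s => ?_) fun n s => ?_
    · have : (A : Set C(X, ℂ)) = ⋂ s : G, {f | f (s⁻¹ • x) = f (s⁻¹ • y)} := by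
        ext f
        simp only [Set.mem_iInter, Set.mem_ofPred_eq]
        rfl
      rw [this]
      exact isClosed_iInter fun s => isClosed_eq (continuous_eval_const _) (continuous_eval_const _)
    · have := hf (s * t)
      simp only [mul_inv_rev, mul_smul] at this
      exact this
    · rw [eq_clamp_of_isSelfAdjoint (hp.real n) (hp.norm_le n) (s⁻¹ • x),
        eq_clamp_of_isSelfAdjoint (hp.real n) (hp.norm_le n) (s⁻¹ • y)]
      exact congrArg (fun c : Seg => ((c : ℝ) : ℂ)) (congrFun hxy (s, n))
  by_contra hne
  obtain ⟨f, hfx, hfy, -⟩ := exists_continuous_zero_one_of_isClosed (isClosed_singleton (x := x))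
    (isClosed_singleton (x := y)) (Set.disjoint_singleton.2 hne)
  let f' : C(X, ℂ) := ⟨fun z => (f z : ℂ), by fun_prop⟩
  have hf' : f' ∈ A := by rw [hA]; trivial
  have h1 := hf' 1
  simp only [inv_one, one_smul] at h1
  have h2 : (f x : ℂ) = f y := h1
  rw [hfx (Set.mem_singleton x), hfy (Set.mem_singleton y)] at h2
  simp at h2

/-- Every continuous function on `X` is a continuous function of the profile of a generating
sequence. -/
theorem exists_eq_comp_profileC [CompactSpace X] [T2Space X] {p : ℕ → C(X, ℂ)}
    (hp : IsGeneratingC G p) (f : C(X, ℝ)) :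
    ∃ u : C(G × ℕ → Seg, ℝ), ∀ x, u (profileC G p x) = f x := by
  obtain ⟨u, hu⟩ := f.exists_extension' ((profileC G p).continuous.isClosedEmbedding
    (injective_profileC hp))
  exact ⟨u, fun x => congrFun hu x⟩

/-- The parameters `(F, δ)` of the sets `Hom(S, F, δ, σ)`. -/
abbrev HomParam (G : Type*) : Type _ := {x : Finset G × ℝ // x.1.Nonempty ∧ 0 < x.2}

instance : Nonempty (HomParam G) := ⟨⟨({1}, 1), by simp⟩⟩

/-- The sets `Hom(S, F, δ, σ_i)`, as a subset of the disjoint union over `i`. -/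
def homFibre (S : SoficApproximation G) (p : ℕ → C(X, ℂ)) (x : HomParam G) :
    Set (Σ i, C(X, ℂ) →ₐ[ℂ] (Fin (S.d i) → ℂ)) :=
  {z | z.2 ∈ homSet p x.1.1 x.1.2 (S.σ z.1)}

theorem directed_homFibre (S : SoficApproximation G) (p : ℕ → C(X, ℂ)) :
    Directed (· ⊇ ·) (homFibre S p) := by
  classical
  intro x y
  refine ⟨⟨(x.1.1 ∪ y.1.1, min x.1.2 y.1.2), x.2.1.mono Finset.subset_union_left,
    lt_min x.2.2 y.2.2⟩, fun z hz s hs => ?_, fun z hz s hs => ?_⟩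
  · exact (hz s (Finset.subset_union_left hs)).trans_le (min_le_left _ _)
  · exact (hz s (Finset.subset_union_right hs)).trans_le (min_le_right _ _)

/-- The filter of approximately equivariant homomorphisms. -/
def homFilter (S : SoficApproximation G) (p : ℕ → C(X, ℂ)) :
    Filter (Σ i, C(X, ℂ) →ₐ[ℂ] (Fin (S.d i) → ℂ)) :=
  limitFilter (homFibre S p)

theorem tendsto_fst_homFilter {S : SoficApproximation G} {p : ℕ → C(X, ℂ)} :
    Tendsto Sigma.fst (homFilter S p) atTop :=
  tendsto_fst_limitFilter

theorem topEntropySeq_eq (S : SoficApproximation G) (p : ℕ → C(X, ℂ)) :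
    topEntropySeq S p = filterEntropy S (homFilter S p) fun _ φ ψ => rho p φ ψ := by
  refine iSup_congr fun ε => iSup_congr fun _ => ?_
  rw [homFilter, entropyAt_limitFilter (directed_homFibre S p)]
  refine le_antisymm (le_iInf fun x => ?_) (le_iInf₂ fun F hF => le_iInf₂ fun δ hδ => ?_)
  · exact iInf₂_le_of_le x.1.1 x.2.1 (iInf₂_le_of_le x.1.2 x.2.2 le_rfl)
  · exact iInf_le_of_le ⟨(F, δ), hF, hδ⟩ le_rfl

variable [CompactSpace X] [T2Space X] {S : SoficApproximation G} {p q : ℕ → C(X, ℂ)}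

/-- The values of a homomorphism `C(X) → ℂ^d` on the sequence `p`. -/
def valuesC (p : ℕ → C(X, ℂ)) {d : ℕ} (φ : C(X, ℂ) →ₐ[ℂ] (Fin d → ℂ)) : ℕ → Fin d → Seg :=
  fun n k => clamp (p n (homPoint φ k)).re

theorem rho_eq_seqDist_valuesC (hp : IsGeneratingC G p) {d : ℕ}
    (φ ψ : C(X, ℂ) →ₐ[ℂ] (Fin d → ℂ)) : rho p φ ψ = seqDist (valuesC p φ) (valuesC p ψ) := by
  refine tsum_congr fun n => ?_
  congr 2
  funext k
  rw [Pi.sub_apply, apply_homPoint, apply_homPoint,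
    eq_clamp_of_isSelfAdjoint (hp.real n) (hp.norm_le n),
    eq_clamp_of_isSelfAdjoint (hp.real n) (hp.norm_le n) (homPoint ψ k)]
  rfl

/-- The defect of equivariance of a homomorphism as a distance of microstates. -/
theorem tsum_equivariance_eq (hp : IsGeneratingC G p) {d : ℕ} (φ : C(X, ℂ) →ₐ[ℂ] (Fin d → ℂ))
    (τ : Equiv.Perm (Fin d)) (s : G) :
    ∑' n : ℕ, (1 / 2 : ℝ) ^ (n + 1) * norm2 (φ (actC s (p n)) - permAct τ (φ (p n))) =
      seqDist (fun n k => profileC G p (homPoint φ k) (s, n))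
        fun n k => valuesC p φ n (τ⁻¹ k) := by
  refine tsum_congr fun n => ?_
  congr 2
  funext k
  rw [Pi.sub_apply, apply_homPoint, permAct, apply_homPoint,
    eq_clamp_of_isSelfAdjoint (hp.real n) (hp.norm_le n) (homPoint φ _)]
  have : actC s (p n) (homPoint φ k) = ((profileC G p (homPoint φ k) (s, n) : ℝ) : ℂ) :=
    eq_clamp_of_isSelfAdjoint (hp.real n) (hp.norm_le n) (s⁻¹ • homPoint φ k)
  rw [this]
  rfl

/-- Along approximately equivariant homomorphisms the orbits of the values on `p` follow the
profiles of the points. -/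
theorem tendsto_avg_orbit_sub_profileC (hp : IsGeneratingC G p) (u : C(G × ℕ → Seg, ℝ)) :
    Tendsto (fun z => avg fun k => |u (orbit (S.σ z.1) (valuesC p z.2) k)
      - u (profileC G p (homPoint z.2 k))|) (homFilter S p) (𝓝 0) := by
  refine tendsto_avg_abs_sub (d := fun z : Σ i, C(X, ℂ) →ₐ[ℂ] (Fin (S.d i) → ℂ) => S.d z.1)
    (y := fun z => orbit (S.σ z.1) (valuesC p z.2))
    (y' := fun z k => profileC G p (homPoint z.2 k)) (fun j => ?_) u
  refine tendsto_zero_of_forall_eventually_lt (fun z => avg_nonneg fun k => abs_nonneg _)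
    fun δ hδ => ?_
  filter_upwards [mem_limitFilter_of_mem (D := homFibre S p)
    ⟨({j.1}, δ / 2 ^ (j.2 + 1)), by simp, by positivity⟩] with z hz
  have h1 := hz j.1 (by simp)
  rw [tsum_equivariance_eq hp] at h1
  have h2 := avg_le_seqDist (fun n k => profileC G p (homPoint z.2 k) (j.1, n))
    (fun n k => valuesC p z.2 n ((S.σ z.1 j.1)⁻¹ k)) j.2
  have h3 := (mul_lt_mul_of_pos_left h1 (show (0 : ℝ) < 2 ^ (j.2 + 1) by positivity))
  rw [mul_div_cancel₀ _ (by positivity)] at h3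
  refine lt_of_eq_of_lt ?_ (h2.trans_lt h3)
  congr 1
  funext k
  exact abs_sub_comm _ _

/-- Approximate equivariance on a generating sequence implies approximate equivariance on every
continuous function. -/
theorem tendsto_avg_equivariant (hp : IsGeneratingC G p) (f : C(X, ℝ)) (s : G) :
    Tendsto (fun z => avg fun k => |f (s⁻¹ • homPoint z.2 k)
      - f (homPoint z.2 ((S.σ z.1 s)⁻¹ k))|) (homFilter S p) (𝓝 0) := by
  obtain ⟨u, hu⟩ := exists_eq_comp_profileC hp f
  have h1 := tendsto_avg_orbit_sub_profileC (S := S) hp (u.comp (shift s))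
  have h2 := tendsto_avg_orbit_shift S (tendsto_fst_homFilter (S := S) (p := p))
    (fun z => valuesC p z.2) s u
  have h3 := tendsto_avg_abs_perm
    (d := fun z : Σ i, C(X, ℂ) →ₐ[ℂ] (Fin (S.d i) → ℂ) => S.d z.1)
    (f := fun z k => u (orbit (S.σ z.1) (valuesC p z.2) k))
    (g := fun z k => u (profileC G p (homPoint z.2 k))) (fun z => (S.σ z.1 s)⁻¹)
    (tendsto_avg_orbit_sub_profileC (S := S) hp u)
  have h1' : Tendsto (fun z => avg fun k => |u (profileC G p (s⁻¹ • homPoint z.2 k))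
      - u (shift s (orbit (S.σ z.1) (valuesC p z.2) k))|) (homFilter S p) (𝓝 0) := by
    refine h1.congr fun z => congrArg avg (funext fun k => ?_)
    rw [profileC_smul, abs_sub_comm, ContinuousMap.comp_apply, ContinuousMap.comp_apply]
  have h2' : Tendsto (fun z => avg fun k => |u (shift s (orbit (S.σ z.1) (valuesC p z.2) k))
      - u (orbit (S.σ z.1) (valuesC p z.2) ((S.σ z.1 s)⁻¹ k))|) (homFilter S p) (𝓝 0) := by
    refine h2.congr fun z => congrArg avg (funext fun k => ?_)
    rw [abs_sub_comm]
  have h4 := tendsto_avg_abs_trans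
    (d := fun z : Σ i, C(X, ℂ) →ₐ[ℂ] (Fin (S.d i) → ℂ) => S.d z.1)
    (f := fun z k => u (profileC G p (s⁻¹ • homPoint z.2 k)))
    (g := fun z k => u (shift s (orbit (S.σ z.1) (valuesC p z.2) k)))
    (h := fun z k => u (orbit (S.σ z.1) (valuesC p z.2) ((S.σ z.1 s)⁻¹ k))) h1' h2'
  have h5 := tendsto_avg_abs_trans
    (d := fun z : Σ i, C(X, ℂ) →ₐ[ℂ] (Fin (S.d i) → ℂ) => S.d z.1)
    (f := fun z k => u (profileC G p (s⁻¹ • homPoint z.2 k)))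
    (g := fun z k => u (orbit (S.σ z.1) (valuesC p z.2) ((S.σ z.1 s)⁻¹ k)))
    (h := fun z k => u (profileC G p (homPoint z.2 ((S.σ z.1 s)⁻¹ k)))) h4 h3
  simpa only [hu] using h5

/-- With respect to any two generating sequences the approximately equivariant homomorphisms are the
same. -/
theorem homFilter_le_of_isGeneratingC (hp : IsGeneratingC G p) (hq : IsGeneratingC G q) :
    homFilter S p ≤ homFilter S q := by
  intro W hW
  obtain ⟨x, hx⟩ := (mem_limitFilter (directed_homFibre S q)).1 hW
  obtain ⟨N, κ, hκ, hN⟩ := exists_forall_seqDist_lt x.2.2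
  have ev : ∀ᶠ z in homFilter S p, ∀ s ∈ x.1.1, ∀ n : Fin N, avg (fun k =>
      |(profileC G q (homPoint z.2 k) (s, (n : ℕ)) : ℝ)
        - valuesC q z.2 n ((S.σ z.1 s)⁻¹ k)|) < κ := by
    refine (Finset.eventually_all _).2 fun s _ => eventually_all.2 fun n => ?_
    exact (tendsto_avg_equivariant (S := S) hp ⟨fun y => (clamp (q n y).re : ℝ),
      continuous_subtype_val.comp (continuous_clamp.comp (by fun_prop))⟩ s).eventually
        (gt_mem_nhds hκ)
  filter_upwards [ev, tendsto_fst_homFilter.eventually hx] with z h1 h2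
  refine h2 z.2 fun s hs => ?_
  rw [tsum_equivariance_eq hq]
  exact hN _ _ _ fun n hn => h1 s hs ⟨n, hn⟩

/-- The topological entropy does not depend on the generating sequence: the homomorphisms are the
same, and separation for `p` implies separation for `q` since `p` consists of functions of the
profile of `q`. -/
theorem topEntropySeq_le_of_isGeneratingC (S : SoficApproximation G) (hp : IsGeneratingC G p)
    (hq : IsGeneratingC G q) : topEntropySeq S p ≤ topEntropySeq S q := by
  rw [topEntropySeq_eq, topEntropySeq_eq]
  have hself : ∀ (i : ℕ) (φ : C(X, ℂ) →ₐ[ℂ] (Fin (S.d i) → ℂ)), rho q φ φ = 0 := fun i φ => by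
    simp [rho, norm2]
  refine filterEntropy_le_of_map hself fun ε hε => ?_
  obtain ⟨N, κ, hκ, hN⟩ := exists_forall_seqDist_lt hε
  have hr : ∀ n, ∃ u : C(G × ℕ → Seg, ℝ), ∀ x, u (profileC G q x) = clamp (p n x).re := fun n =>
    exists_eq_comp_profileC hq ⟨fun x => (clamp (p n x).re : ℝ),
      continuous_subtype_val.comp (continuous_clamp.comp (by fun_prop))⟩
  choose r hr using hr
  obtain ⟨ε', hε', hrec⟩ := exists_forall_avg_lt_of_recover r N hκ
  refine ⟨ε', hε', fun W hW => ?_⟩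
  have ev : ∀ᶠ z in homFilter S p, ∀ n : Fin N, avg (fun k =>
      |(valuesC p z.2 n k : ℝ) - r n (orbit (S.σ z.1) (valuesC q z.2) k)|) < κ / 3 := by
    refine eventually_all.2 fun n => ?_
    have := (tendsto_avg_orbit_sub_profileC (S := S) hq (r n)).eventually
      (gt_mem_nhds (show 0 < κ / 3 by positivity))
    filter_upwards [homFilter_le_of_isGeneratingC hp hq this] with z hz
    simp only [hr, abs_sub_comm (r n _)] at hz
    exact hz
  refine ⟨fun i φ => φ, _, ev.and (homFilter_le_of_isGeneratingC hp hq hW), fun i φ hφ => hφ.2,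
    fun i φ ψ hφ hψ hlt => ?_⟩
  rw [rho_eq_seqDist_valuesC hp] at hlt
  rw [rho_eq_seqDist_valuesC hq]
  by_contra! hle
  exact absurd hlt (not_lt.2 (hN _ _ _ (hrec _ (S.σ i) _ _ _ _ (fun n hn => hφ.1 ⟨n, hn⟩)
    (fun n hn => hψ.1 ⟨n, hn⟩) hle)).le)

end Top

/-! ### The measure entropies are at most the topological entropy -/

section LowerBound

variable {G : Type*} [Group G] {X : Type*} [TopologicalSpace X] [MulAction G X]
  [ContinuousConstSMul G X]

/-- Evaluation at `d` points, as a unital homomorphism `C(X) → ℂ^d`. -/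
def homOfPoints {d : ℕ} (x : Fin d → X) : C(X, ℂ) →ₐ[ℂ] (Fin d → ℂ) where
  toFun f k := f (x k)
  map_one' := rfl
  map_mul' _ _ := rfl
  map_zero' := rfl
  map_add' _ _ := rfl
  commutes' _ := rfl

variable [CompactSpace X]

theorem homPoint_homOfPoints [T2Space X] {d : ℕ} (x : Fin d → X) (k : Fin d) :
    homPoint (homOfPoints x) k = x k := by
  refine (WeakDual.CharacterSpace.continuousMapEval_bijective (X := X) (𝕜 := ℂ)).1 ?_
  ext f
  exact (apply_homPoint (homOfPoints x) f k).symm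

/-- Nearest points, in finitely many coordinates, on the image of the profile map. -/
theorem exists_nearest [Nonempty X] (p : ℕ → C(X, ℂ)) (J : Finset (G × ℕ)) :
    ∃ (g : C(G × ℕ → Seg, ℝ)) (π : (G × ℕ → Seg) → X), (∀ x, g (profileC G p x) = 0) ∧
      ∀ ω, ∀ j ∈ J, |(ω j : ℝ) - profileC G p (π ω) j| ≤ g ω := by
  let r : C(G × ℕ → Seg, J → ℝ) := ⟨fun ω j => (ω j : ℝ), by fun_prop⟩
  let K : Set (J → ℝ) := Set.range fun x => r (profileC G p x)
  have hK : IsCompact K := isCompact_range (by fun_prop)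
  have hne : K.Nonempty := Set.range_nonempty _
  have h1 : ∀ ω, ∃ x, Metric.infDist (r ω) K = dist (r ω) (r (profileC G p x)) := fun ω => by
    obtain ⟨-, ⟨x, rfl⟩, h⟩ := hK.exists_infDist_eq_dist hne (r ω)
    exact ⟨x, h⟩
  choose π hπ using h1
  refine ⟨⟨fun ω => Metric.infDist (r ω) K, (Metric.continuous_infDist_pt K).comp r.continuous⟩,
    π, fun x => Metric.infDist_zero_of_mem ⟨x, rfl⟩, fun ω j hj => ?_⟩
  change _ ≤ Metric.infDist (r ω) K
  rw [hπ, ← Real.dist_eq]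
  exact dist_le_pi_dist (r ω) (r (profileC G p (π ω))) ⟨j, hj⟩

/-- Microstates of the profile distribution of a measure on `X` are close to points of `X`, hence
give approximately equivariant homomorphisms. -/
theorem microEntropy_le_topEntropySeq [T2Space X] [MeasurableSpace X] (S : SoficApproximation G)
    {p : ℕ → C(X, ℂ)} (hp : IsGeneratingC G p) (μ : Measure X) [IsProbabilityMeasure μ] :
    microEntropy S (fun u => ∫ x, u (profileC G p x) ∂μ) ≤ topEntropySeq S p := by
  classical
  have hX : Nonempty X := nonempty_of_isProbabilityMeasure μ
  rw [topEntropySeq_eq]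
  have hself : ∀ (i : ℕ) (φ : C(X, ℂ) →ₐ[ℂ] (Fin (S.d i) → ℂ)), rho p φ φ = 0 := fun i φ => by
    simp [rho, norm2]
  refine filterEntropy_le_of_map hself fun ε hε => ⟨ε / 2, half_pos hε, fun W hW => ?_⟩
  obtain ⟨x, hx⟩ := (mem_limitFilter (directed_homFibre S p)).1 hW
  obtain ⟨N, κ, hκ, hN⟩ := exists_forall_seqDist_lt
    (show 0 < min x.1.2 (ε / 4) from lt_min x.2.2 (by positivity))
  let J : Finset (G × ℕ) := insert 1 x.1.1 ×ˢ Finset.range N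
  obtain ⟨g, π, hg0, hg⟩ := exists_nearest (G := G) p J
  let T : ∀ i, (ℕ → Fin (S.d i) → Seg) → C(X, ℂ) →ₐ[ℂ] (Fin (S.d i) → ℂ) := fun i a =>
    homOfPoints fun k => π (orbit (S.σ i) a k)
  set l := microFilter S fun u => ∫ x, u (profileC G p x) ∂μ
  have ev1 : ∀ᶠ z in l, avg (fun k => g (orbit (S.σ z.1) z.2 k)) < κ / 3 := by
    have := tendsto_avg_microFilter (S := S) (ν := fun u => ∫ x, u (profileC G p x) ∂μ) g
    simp only [hg0, integral_zero] at this
    exact this.eventually (gt_mem_nhds (by positivity))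
  have ev2 : ∀ᶠ z in l, ∀ n : Fin N, avg (fun k =>
      |(z.2 n ((S.σ z.1 1)⁻¹ k) : ℝ) - z.2 n k|) < κ / 3 :=
    eventually_all.2 fun n => (tendsto_avg_inv_one S (tendsto_fst_microFilter (S := S)
      (ν := fun u => ∫ x, u (profileC G p x) ∂μ)) fun z => z.2 n).eventually
        (gt_mem_nhds (by positivity))
  have key : ∀ᶠ z in l, (⟨z.1, T z.1 z.2⟩ : Σ i, C(X, ℂ) →ₐ[ℂ] (Fin (S.d i) → ℂ)) ∈ W ∧
      seqDist z.2 (valuesC p (T z.1 z.2)) < ε / 4 := by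
    filter_upwards [ev1, ev2, tendsto_fst_microFilter.eventually hx] with z h1 h2 h3
    set τ := S.σ z.1
    set a := z.2
    let y : Fin (S.d z.1) → X := fun k => π (orbit τ a k)
    have hy : ∀ k, homPoint (T z.1 a) k = y k := homPoint_homOfPoints _
    have hJ : ∀ s ∈ insert 1 x.1.1, ∀ n < N, ∀ k,
        |(orbit τ a k (s, n) : ℝ) - profileC G p (y k) (s, n)| ≤ g (orbit τ a k) :=
      fun s hs n hn k => hg _ (s, n) (Finset.mem_product.2 ⟨hs, Finset.mem_range.2 hn⟩)
    have hval : ∀ n k, valuesC p (T z.1 a) n k = profileC G p (y k) (1, n) := fun n k => by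
      rw [← hy]
      simp [valuesC, profileC]
    -- the values of the homomorphism are close to the microstate
    have hclose : ∀ n < N, ∀ k, |(a n k : ℝ) - valuesC p (T z.1 a) n k| ≤
        |(a n ((τ 1)⁻¹ k) : ℝ) - a n k| + g (orbit τ a k) := fun n hn k => by
      have e1 := hJ 1 (Finset.mem_insert_self _ _) n hn k
      have e2 := abs_sub_le (a n k : ℝ) (a n ((τ 1)⁻¹ k)) (valuesC p (T z.1 a) n k)
      rw [abs_sub_comm (a n k : ℝ) (a n ((τ 1)⁻¹ k))] at e2
      rw [← hval] at e1
      have e3 : |(a n ((τ 1)⁻¹ k) : ℝ) - valuesC p (T z.1 a) n k| ≤ g (orbit τ a k) := e1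
      linarith
    refine ⟨h3 _ fun s hs => ?_, (hN _ _ _ fun n hn => ?_).trans_le (min_le_right _ _)⟩
    · rw [tsum_equivariance_eq hp]
      refine (hN _ _ _ fun n hn => ?_).trans_le (min_le_left _ _)
      have e : ∀ k, |(profileC G p (homPoint (T z.1 a) k) (s, n) : ℝ)
          - valuesC p (T z.1 a) n ((τ s)⁻¹ k)| ≤ g (orbit τ a k) +
            (|(a n ((τ 1)⁻¹ ((τ s)⁻¹ k)) : ℝ) - a n ((τ s)⁻¹ k)|
              + g (orbit τ a ((τ s)⁻¹ k))) := fun k => by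
        rw [hy]
        have e1 := hJ s (Finset.mem_insert_of_mem hs) n hn k
        have e2 := hclose n hn ((τ s)⁻¹ k)
        have e3 := abs_sub_le (profileC G p (y k) (s, n) : ℝ) (a n ((τ s)⁻¹ k))
          (valuesC p (T z.1 a) n ((τ s)⁻¹ k))
        rw [abs_sub_comm (profileC G p (y k) (s, n) : ℝ) (a n ((τ s)⁻¹ k))] at e3
        have e4 : |(a n ((τ s)⁻¹ k) : ℝ) - profileC G p (y k) (s, n)| ≤ g (orbit τ a k) := e1
        linarith
      refine (avg_mono e).trans_lt ?_
      rw [avg_add (fun k => g (orbit τ a k)),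
        avg_add (fun k => |(a n ((τ 1)⁻¹ ((τ s)⁻¹ k)) : ℝ) - a n ((τ s)⁻¹ k)|)
          (fun k => g (orbit τ a ((τ s)⁻¹ k))),
        avg_comp_perm (τ s)⁻¹ fun k => g (orbit τ a k),
        avg_comp_perm (τ s)⁻¹ fun k => |(a n ((τ 1)⁻¹ k) : ℝ) - a n k|]
      have := h2 ⟨n, hn⟩
      simp only at this
      linarith
    · refine (avg_mono (hclose n hn)).trans_lt ?_
      rw [avg_add]
      have := h2 ⟨n, hn⟩
      simp only at this
      linarith
  refine ⟨T, _, key, fun i a ha => ha.1, fun i a b ha hb hlt => ?_⟩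
  rw [rho_eq_seqDist_valuesC hp]
  have h1 := ha.2
  have h2 := hb.2
  have h3 := seqDist_triangle a (valuesC p (T i a)) b
  have h4 := seqDist_triangle (valuesC p (T i a)) (valuesC p (T i b)) b
  rw [seqDist_comm (valuesC p (T i b)) b] at h4
  simp only at h1 h2 hlt
  linarith

end LowerBound

/-! ### Invariant measures from approximately equivariant homomorphisms -/

section UpperBound

variable {G : Type*} [Group G] {X : Type*} [TopologicalSpace X] [CompactSpace X]
  [TopologicalSpace.MetrizableSpace X] [MeasurableSpace X] [BorelSpace X]
  (S : SoficApproximation G)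

/-- The distribution of the points at which a homomorphism `C(X) → ℂ^d` evaluates. -/
def empirical (z : Σ i, C(X, ℂ) →ₐ[ℂ] (Fin (S.d i) → ℂ)) : ProbabilityMeasure X :=
  ⟨(S.d z.1 : ℝ≥0∞)⁻¹ • ∑ k, Measure.dirac (homPoint z.2 k), ⟨by
    have h : (S.d z.1 : ℝ≥0∞) ≠ 0 := by exact_mod_cast (S.d_pos z.1).ne'
    simp [ENNReal.inv_mul_cancel h (ENNReal.natCast_ne_top _)]⟩⟩

variable {S}

theorem integral_empirical (z : Σ i, C(X, ℂ) →ₐ[ℂ] (Fin (S.d i) → ℂ)) (f : X → ℝ) :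
    ∫ x, f x ∂(empirical S z : Measure X) = avg fun k => f (homPoint z.2 k) := by
  change ∫ x, f x ∂((S.d z.1 : ℝ≥0∞)⁻¹ • ∑ k, Measure.dirac (homPoint z.2 k)) = _
  rw [integral_smul_measure, integral_finsetSum_measure]
  · simp [avg, integral_dirac]
  · exact fun k _ => integrable_dirac (by simp)

theorem tendsto_avg_of_tendsto_empirical {l : Filter (Σ i, C(X, ℂ) →ₐ[ℂ] (Fin (S.d i) → ℂ))}
    {μ : ProbabilityMeasure X} (h : Tendsto (empirical S) l (𝓝 μ)) {f : X → ℝ}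
    (hf : Continuous f) :
    Tendsto (fun z => avg fun k => f (homPoint z.2 k)) l (𝓝 (∫ x, f x ∂(μ : Measure X))) := by
  have := ProbabilityMeasure.tendsto_iff_forall_integral_tendsto.1 h
    (BoundedContinuousFunction.mkOfCompact ⟨f, hf⟩)
  exact this.congr fun z => integral_empirical z f

variable [MulAction G X] [ContinuousConstSMul G X]

/-- A limit of distributions along approximately equivariant homomorphisms is invariant. -/
theorem smulInvariantMeasure_of_tendsto_empirical {p : ℕ → C(X, ℂ)} (hp : IsGeneratingC G p)
    {l : Filter (Σ i, C(X, ℂ) →ₐ[ℂ] (Fin (S.d i) → ℂ))} [l.NeBot] (hl : l ≤ homFilter S p)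
    {μ : ProbabilityMeasure X} (h : Tendsto (empirical S) l (𝓝 μ)) :
    SMulInvariantMeasure G X (μ : Measure X) := by
  have hint : ∀ (s : G) (f : C(X, ℝ)), ∫ x, f (s⁻¹ • x) ∂(μ : Measure X) =
      ∫ x, f x ∂(μ : Measure X) := by
    intro s f
    have h1 := tendsto_avg_of_tendsto_empirical h (f.continuous.comp (continuous_const_smul s⁻¹))
    have h2 := tendsto_avg_of_tendsto_empirical h f.continuous
    have h3 := tendsto_avg_sub_avg ((tendsto_avg_equivariant (S := S) hp f s).mono_left hl)
    have h4 : Tendsto (fun z : Σ i, C(X, ℂ) →ₐ[ℂ] (Fin (S.d i) → ℂ) =>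
        (avg fun k => f (s⁻¹ • homPoint z.2 k)) - avg fun k => f (homPoint z.2 k)) l (𝓝 0) := by
      refine h3.congr fun z => ?_
      rw [avg_comp_perm (S.σ z.1 s)⁻¹ fun k => f (homPoint z.2 k)]
    exact sub_eq_zero.1 (tendsto_nhds_unique (h1.sub h2) h4)
  have hmap : ∀ s : G, Measure.map (s⁻¹ • ·) (μ : Measure X) = μ := by
    intro s
    have : IsProbabilityMeasure (Measure.map (s⁻¹ • ·) (μ : Measure X)) :=
      Measure.isProbabilityMeasure_map (continuous_const_smul s⁻¹).measurable.aemeasurable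
    refine ext_of_forall_integral_eq_of_IsFiniteMeasure fun f => ?_
    rw [integral_map (continuous_const_smul s⁻¹).measurable.aemeasurable
      f.continuous.aestronglyMeasurable]
    exact hint s f.toContinuousMap
  refine ⟨fun s B hB => ?_⟩
  conv_rhs => rw [← hmap s⁻¹, inv_inv]
  rw [Measure.map_apply (continuous_const_smul s).measurable hB]

theorem tendsto_valuesC {p : ℕ → C(X, ℂ)} (hp : IsGeneratingC G p)
    {l : Filter (Σ i, C(X, ℂ) →ₐ[ℂ] (Fin (S.d i) → ℂ))} (hl : l ≤ homFilter S p)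
    {μ : ProbabilityMeasure X} (h : Tendsto (empirical S) l (𝓝 μ)) :
    Tendsto (fun z => (⟨z.1, valuesC p z.2⟩ : Σ i, ℕ → Fin (S.d i) → Seg)) l
      (microFilter S fun u => ∫ x, u (profileC G p x) ∂(μ : Measure X)) := by
  refine tendsto_microFilter.2 ⟨tendsto_fst_homFilter.mono_left hl, fun u => ?_⟩
  have h1 := tendsto_avg_sub_avg
    ((tendsto_avg_orbit_sub_profileC (S := S) hp u).mono_left hl)
  have h2 := tendsto_avg_of_tendsto_empirical h
    (u.continuous.comp (profileC G p).continuous)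
  simpa using h1.add h2

/-- At each scale the topological entropy is carried by the microstates of a single invariant
measure. -/
theorem exists_entropyAt_le_microEntropy {p : ℕ → C(X, ℂ)} (hp : IsGeneratingC G p) {ε : ℝ}
    (hε : 0 < ε) (h : entropyAt S (homFilter S p) (fun _ φ ψ => rho p φ ψ) ε ≠ ⊥) :
    ∃ μ : InvariantProbability G X, entropyAt S (homFilter S p) (fun _ φ ψ => rho p φ ψ) ε ≤
      microEntropy S fun u => ∫ x, u (profileC G p x) ∂μ.toMeasure := by
  obtain ⟨μ, hμ⟩ := exists_entropyAt_le_inf_nhds (empirical S) h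
  set l := homFilter S p ⊓ comap (empirical S) (𝓝 μ)
  have hne : l.NeBot := neBot_of_entropyAt_ne_bot (ne_bot_of_le_ne_bot h hμ)
  have hl : Tendsto (empirical S) l (𝓝 μ) := tendsto_comap.mono_left inf_le_right
  refine ⟨⟨μ, inferInstance, smulInvariantMeasure_of_tendsto_empirical hp inf_le_left hl⟩,
    hμ.trans (le_iSup₂_of_le ε hε ?_)⟩
  exact entropyAt_le_of_tendsto hε (fun _ => seqDist_self) (fun i => valuesC p)
    (tendsto_valuesC hp inf_le_left hl) univ_mem fun i φ ψ _ _ => rho_eq_seqDist_valuesC hp φ ψ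

end UpperBound

/-! ### Existence of generating sequences -/

section Existence

variable {G : Type*} [Group G] {X : Type*} [TopologicalSpace X] [CompactSpace X]
  [MulAction G X] [ContinuousConstSMul G X]

/-- A dense sequence of continuous functions `X → [-1, 1]` generates. -/
theorem exists_isGeneratingC (G : Type*) [Group G] (X : Type*) [TopologicalSpace X]
    [CompactSpace X] [TopologicalSpace.MetrizableSpace X] [MulAction G X]
    [ContinuousConstSMul G X] : ∃ p : ℕ → C(X, ℂ), IsGeneratingC G p := by
  have : SecondCountableTopology X := by
    let _ := TopologicalSpace.metrizableSpaceMetric X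
    infer_instance
  have hne : Nonempty C(X, Seg) := ⟨.const X (clamp 0)⟩
  let c : C(Seg, ℂ) := ⟨fun t => ((t : ℝ) : ℂ), by fun_prop⟩
  refine ⟨fun n => c.comp (TopologicalSpace.denseSeq C(X, Seg) n), fun n => ?_, fun n => ?_,
    fun A hA _ hpA => ?_⟩
  · ext x
    exact Complex.conj_ofReal _
  · refine (ContinuousMap.norm_le _ zero_le_one).2 fun x => ?_
    change ‖((_ : ℝ) : ℂ)‖ ≤ 1
    rw [Complex.norm_real]
    exact Seg.abs_le _
  · have h1 : ∀ v : C(X, Seg), c.comp v ∈ A := by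
      intro v
      have hcl : IsClosed {v : C(X, Seg) | c.comp v ∈ (A : Set C(X, ℂ))} :=
        hA.preimage (ContinuousMap.continuous_postcomp c)
      refine hcl.closure_subset_iff.2 ?_ (TopologicalSpace.denseRange_denseSeq C(X, Seg) v)
      rintro _ ⟨n, rfl⟩
      exact hpA n
    refine StarSubalgebra.eq_top_iff.2 fun f => ?_
    -- scale the real and imaginary parts into `[-1, 1]`
    let r : ℝ := ‖f‖ + 1
    have hr : 0 < r := by positivity
    let g₁ : C(X, Seg) := ⟨fun x => clamp ((f x).re / r), continuous_clamp.comp (by fun_prop)⟩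
    let g₂ : C(X, Seg) := ⟨fun x => clamp ((f x).im / r), continuous_clamp.comp (by fun_prop)⟩
    have hle : ∀ x, ‖f x‖ ≤ r := fun x => (f.norm_coe_le_norm x).trans (by simp [r])
    have hf : f = (r : ℂ) • c.comp g₁ + ((r : ℂ) * Complex.I) • c.comp g₂ := by
      ext x
      have e1 : ((clamp ((f x).re / r) : Seg) : ℝ) = (f x).re / r := coe_clamp (by
        rw [abs_div, abs_of_pos hr, div_le_one hr]
        exact (Complex.abs_re_le_norm _).trans (hle x))
      have e2 : ((clamp ((f x).im / r) : Seg) : ℝ) = (f x).im / r := coe_clamp (by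
        rw [abs_div, abs_of_pos hr, div_le_one hr]
        exact (Complex.abs_im_le_norm _).trans (hle x))
      have hr' : (r : ℂ) ≠ 0 := Complex.ofReal_ne_zero.2 hr.ne'
      simp only [ContinuousMap.add_apply, ContinuousMap.smul_apply, ContinuousMap.comp_apply,
        smul_eq_mul, c, g₁, g₂, ContinuousMap.coe_mk, e1, e2]
      rw [Complex.ofReal_div, Complex.ofReal_div, mul_div_cancel₀ _ hr', mul_assoc, mul_left_comm,
        mul_div_cancel₀ _ hr', mul_comm Complex.I, Complex.re_add_im]
    rw [hf]
    exact add_mem (A.smul_mem (h1 _) _) (A.smul_mem (h1 _) _)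

variable [MeasurableSpace X] [BorelSpace X] {μ : Measure X} [IsProbabilityMeasure μ]

/-- The class of a continuous function in `L^∞`. -/
def toLinfty (μ : Measure X) [IsProbabilityMeasure μ] (f : C(X, ℂ)) : Linfty μ :=
  ContinuousMap.toLp ∞ μ ℂ f

theorem coeFn_toLinfty (f : C(X, ℂ)) : ⇑(toLinfty μ f) =ᵐ[μ] f :=
  ContinuousMap.coeFn_toLp μ f

/-- The preimage in `C(X)` of a subalgebra of `L^∞`. -/
def comapLinfty (A : StarSubalgebra ℂ (Linfty μ)) : StarSubalgebra ℂ C(X, ℂ) where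
  carrier := {f | toLinfty μ f ∈ A}
  add_mem' := fun {f g} hf hg => by
    have : toLinfty μ (f + g) = toLinfty μ f + toLinfty μ g := map_add _ f g
    change toLinfty μ (f + g) ∈ A
    rw [this]
    exact add_mem hf hg
  mul_mem' := fun {f g} hf hg => by
    have : toLinfty μ (f * g) = toLinfty μ f * toLinfty μ g := by
      refine Lp.ext ?_
      filter_upwards [coeFn_toLinfty (μ := μ) (f * g), coeFn_mul_Linfty (toLinfty μ f)
        (toLinfty μ g), coeFn_toLinfty (μ := μ) f, coeFn_toLinfty (μ := μ) g] with x h1 h2 h3 h4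
      rw [h1, h2, h3, h4, ContinuousMap.mul_apply]
    change toLinfty μ (f * g) ∈ A
    rw [this]
    exact mul_mem hf hg
  algebraMap_mem' := fun c => by
    have : toLinfty μ (algebraMap ℂ C(X, ℂ) c) = algebraMap ℂ (Linfty μ) c := by
      refine Lp.ext ?_
      rw [Algebra.algebraMap_eq_smul_one (A := Linfty μ)]
      filter_upwards [coeFn_toLinfty (μ := μ) (algebraMap ℂ C(X, ℂ) c),
        Lp.coeFn_smul c (1 : Linfty μ), coeFn_one_Linfty (μ := μ)] with x h1 h2 h3
      rw [h1, h2, Pi.smul_apply, h3]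
      simp
    change toLinfty μ (algebraMap ℂ C(X, ℂ) c) ∈ A
    rw [this]
    exact algebraMap_mem A c
  star_mem' := fun {f} hf => by
    have : toLinfty μ (star f) = star (toLinfty μ f) := by
      refine Lp.ext ?_
      filter_upwards [coeFn_toLinfty (μ := μ) (star f), coeFn_star_Linfty (toLinfty μ f),
        coeFn_toLinfty (μ := μ) f] with x h1 h2 h3
      rw [h1, h2, h3, ContinuousMap.star_apply]
    change toLinfty μ (star f) ∈ A
    rw [this]
    exact star_mem hf

variable [SMulInvariantMeasure G X μ]

theorem actL_toLinfty (s : G) (f : C(X, ℂ)) :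
    actL s (toLinfty μ f) = toLinfty μ (actC s f) := by
  refine Lp.ext ?_
  filter_upwards [coeFn_actL s (toLinfty μ f), coeFn_toLinfty (μ := μ) (actC s f),
    (measurePreserving_smul s⁻¹ μ).quasiMeasurePreserving.ae (coeFn_toLinfty (μ := μ) f)]
    with x h1 h2 h3
  rw [h1, h2, h3]
  rfl

/-- A sequence which generates the continuous functions generates `L^∞` for every invariant
measure. -/
theorem IsGeneratingC.isGeneratingL [TopologicalSpace.MetrizableSpace X] {p : ℕ → C(X, ℂ)}
    (hp : IsGeneratingC G p) : IsGeneratingL G fun n => toLinfty μ (p n) where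
  real n := by
    refine Lp.ext ?_
    filter_upwards [coeFn_star_Linfty (toLinfty μ (p n)), coeFn_toLinfty (μ := μ) (p n)]
      with x h1 h2
    rw [h1, h2, ← ContinuousMap.star_apply, (hp.real n).star_eq]
  norm_le n := by
    have h := Lp.norm_le_of_ae_bound (f := toLinfty μ (p n)) zero_le_one (by
      filter_upwards [coeFn_toLinfty (μ := μ) (p n)] with x hx
      rw [hx]
      exact ((p n).norm_coe_le_norm x).trans (hp.norm_le n))
    simpa using h
  generating A hA hact hpA := by
    -- the preimage in `C(X)` is closed, as uniform convergence implies convergence in `L²`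
    have hB : comapLinfty A = ⊤ := by
      refine hp.generating _ (isClosed_of_closure_subset fun f hf => hA _ fun ε hε => ?_)
        (fun s f hf => ?_) hpA
      · obtain ⟨g, hg, hfg⟩ := Metric.mem_closure_iff.1 hf (ε / 2) (half_pos hε)
        refine ⟨toLinfty μ g, hg, ?_⟩
        refine (eLpNorm_le_of_ae_bound (C := ε / 2) ?_).trans_lt ?_
        · filter_upwards [Lp.coeFn_sub (toLinfty μ f) (toLinfty μ g),
            coeFn_toLinfty (μ := μ) f, coeFn_toLinfty (μ := μ) g] with x h1 h2 h3
          rw [h1, Pi.sub_apply, h2, h3, ← dist_eq_norm]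
          exact (ContinuousMap.dist_apply_le_dist x).trans hfg.le
        · rw [measure_univ, ENNReal.one_rpow, one_mul]
          exact (ENNReal.ofReal_lt_ofReal_iff hε).2 (half_lt_self hε)
      · have := hact s _ hf
        rw [actL_toLinfty] at this
        exact this
    -- continuous functions are dense in `L²`
    refine StarSubalgebra.eq_top_iff.2 fun f => hA f fun ε hε => ?_
    have hf : MemLp f 2 μ := (Lp.memLp f).mono_exponent le_top
    obtain ⟨g, hg, -⟩ := hf.exists_boundedContinuous_eLpNorm_sub_le (by norm_num)
      (ε := ENNReal.ofReal (ε / 2)) (by simpa using hε)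
    have hgA : g.toContinuousMap ∈ comapLinfty A := by rw [hB]; trivial
    refine ⟨toLinfty μ g.toContinuousMap, hgA, ?_⟩
    refine (eLpNorm_congr_ae (g := ⇑f - ⇑g) ?_).trans_lt (hg.trans_lt
      ((ENNReal.ofReal_lt_ofReal_iff hε).2 (half_lt_self hε)))
    filter_upwards [Lp.coeFn_sub f (toLinfty μ g.toContinuousMap),
      coeFn_toLinfty (μ := μ) g.toContinuousMap] with x h1 h2
    rw [h1, Pi.sub_apply, h2]
    rfl

theorem integral_profile_toLinfty [Countable G] (p : ℕ → C(X, ℂ)) (u : C(G × ℕ → Seg, ℝ)) :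
    ∫ x, u (profile G (fun n => toLinfty μ (p n)) x) ∂μ = ∫ x, u (profileC G p x) ∂μ := by
  refine integral_congr_ae ?_
  have h : ∀ᵐ x ∂μ, ∀ j : G × ℕ, toLinfty μ (p j.2) (j.1⁻¹ • x) = p j.2 (j.1⁻¹ • x) :=
    ae_all_iff.2 fun j => (measurePreserving_smul j.1⁻¹ μ).quasiMeasurePreserving.ae
      (coeFn_toLinfty (μ := μ) (p j.2))
  filter_upwards [h] with x hx
  congr 1
  funext j
  simp [profile, profileC, hx]

end Existence

/-! ### The variational principle -/

section Main

variable {G : Type*} [Group G] {X : Type*}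

theorem topEntropySeq_eq_topEntropy [TopologicalSpace X] [CompactSpace X] [T2Space X]
    [MulAction G X] [ContinuousConstSMul G X] (S : SoficApproximation G) {p : ℕ → C(X, ℂ)}
    (hp : IsGeneratingC G p) : topEntropySeq S p = topEntropy S X :=
  le_antisymm (le_iSup₂_of_le p hp le_rfl)
    (iSup₂_le fun _ hq => topEntropySeq_le_of_isGeneratingC S hq hp)

theorem measureEntropySeq_eq_measureEntropy [Countable G] [MeasurableSpace X] [MulAction G X]
    [MeasurableConstSMul G X] {μ : Measure X} [IsProbabilityMeasure μ] [SMulInvariantMeasure G X μ]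
    (S : SoficApproximation G) {p : ℕ → Linfty μ} (hp : IsGeneratingL G p) :
    measureEntropySeq S p = measureEntropy S μ := by
  refine le_antisymm (le_iSup₂_of_le p hp le_rfl) (iSup₂_le fun q hq => ?_)
  rw [measureEntropySeq_eq_microEntropy S hq.real hq.norm_le,
    measureEntropySeq_eq_microEntropy S hp.real hp.norm_le]
  exact microEntropy_le_of_isGeneratingL S hq hp

variable [Countable G] [TopologicalSpace X] [CompactSpace X] [TopologicalSpace.MetrizableSpace X]
  [MeasurableSpace X] [BorelSpace X] [MulAction G X] [ContinuousConstSMul G X]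

/-- The measure entropy, computed from the profile of a sequence generating the continuous
functions. -/
theorem measureEntropy_eq_microEntropy_profileC (S : SoficApproximation G) {p : ℕ → C(X, ℂ)}
    (hp : IsGeneratingC G p) (μ : Measure X) [IsProbabilityMeasure μ]
    [SMulInvariantMeasure G X μ] :
    measureEntropy S μ = microEntropy S fun u => ∫ x, u (profileC G p x) ∂μ := by
  have hL := hp.isGeneratingL (μ := μ)
  rw [← measureEntropySeq_eq_measureEntropy S hL,
    measureEntropySeq_eq_microEntropy S hL.real hL.norm_le]
  simp only [integral_profile_toLinfty]

theorem topEntropy_eq_iSup_measureEntropy (S : SoficApproximation G) :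
    topEntropy S X = ⨆ μ : InvariantProbability G X, measureEntropy S μ.toMeasure := by
  obtain ⟨p, hp⟩ := exists_isGeneratingC G X
  rw [← topEntropySeq_eq_topEntropy S hp]
  refine le_antisymm ?_ (iSup_le fun μ => ?_)
  · rw [topEntropySeq_eq]
    refine iSup₂_le fun ε hε => ?_
    by_cases h : entropyAt S (homFilter S p) (fun _ φ ψ => rho p φ ψ) ε = ⊥
    · rw [h]; exact bot_le
    · obtain ⟨μ, hμ⟩ := exists_entropyAt_le_microEntropy hp hε h
      rw [← measureEntropy_eq_microEntropy_profileC S hp μ.toMeasure] at hμ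
      exact le_iSup_of_le μ hμ
  · rw [measureEntropy_eq_microEntropy_profileC S hp μ.toMeasure]
    exact microEntropy_le_topEntropySeq S hp μ.toMeasure

end Main

end SoficEntropy

end

theorem mainTheorem1 {G : Type*} [Group G] [Countable G] {X : Type*} [TopologicalSpace X]
    [CompactSpace X] [TopologicalSpace.MetrizableSpace X] [MeasurableSpace X] [BorelSpace X]
    [MulAction G X] [ContinuousConstSMul G X] (S : SoficEntropy.SoficApproximation G) :
    ((∃ p : ℕ → C(X, ℂ), SoficEntropy.IsGeneratingC G p) ∧
      ∀ p : ℕ → C(X, ℂ), SoficEntropy.IsGeneratingC G p →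
        SoficEntropy.topEntropySeq S p = SoficEntropy.topEntropy S X) ∧
    (∀ μ : SoficEntropy.InvariantProbability G X,
      (∃ p : ℕ → SoficEntropy.Linfty μ.toMeasure, SoficEntropy.IsGeneratingL G p) ∧
      ∀ p : ℕ → SoficEntropy.Linfty μ.toMeasure, SoficEntropy.IsGeneratingL G p →
        SoficEntropy.measureEntropySeq S p = SoficEntropy.measureEntropy S μ.toMeasure) ∧
    SoficEntropy.topEntropy S X =
      ⨆ μ : SoficEntropy.InvariantProbability G X, SoficEntropy.measureEntropy S μ.toMeasure ∧
    (SoficEntropy.topEntropy S X ≠ ⊥ → Nonempty (SoficEntropy.InvariantProbability G X)) := by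
  obtain ⟨p, hp⟩ := SoficEntropy.exists_isGeneratingC G X
  have hvar := SoficEntropy.topEntropy_eq_iSup_measureEntropy (X := X) S
  refine ⟨⟨⟨p, hp⟩, fun q hq => SoficEntropy.topEntropySeq_eq_topEntropy S hq⟩,
    fun μ => ⟨⟨_, hp.isGeneratingL⟩, fun q hq =>
      SoficEntropy.measureEntropySeq_eq_measureEntropy S hq⟩, hvar, fun h => ?_⟩
  by_contra hempty
  rw [not_nonempty_iff] at hempty
  exact h (by rw [hvar, iSup_of_empty])
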